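/- Identify $\mathbb{C}^4$ with $\mathbb{H}^2$ by $(z_1,z_2,z_3,z_4)\mapsto(z_1+z_2j,\;z_3+z_4j)$ and $S^4$ with the quaternionic projective line $\mathbb{HP}^1=(\mathbb{H}^2\setminus 0)/\mathbb{H}^*$ (left multiplication). Let $\pi:\mathbb{CP}^3\to S^4$ be the twistor fibration, sending a complex line of $\mathbb{C}^4$ to the quaternionic line it spans. A *twistor line* is a fibre of $\pi$. Let $\mathbf{j}[z_1,z_2,z_3,z_4]=[-\bar z_2,\bar z_1,-\bar z_4,\bar z_3]$. Two subsets of $\mathbb{CP}^3$ are *projectively equivalent* if a projective transformation carries one to the other, and *conformally equivalent* if this transformation can be chosen to commute with $\mathbf{j}$. Two subsets of $S^4$ are *conformally equivalent* if a quaternionic Möbius transformation of $S^4=\mathbb{HP}^1$ carries one to the other. *Concyclic* means: contained in a round circle. **Theorem.** 1. *(Existence.)* Let $P$ be a set of $5$ points on a round $2$-sphere $S\subset S^4$. There is a non-singular cubic surface in $\mathbb{CP}^3$ containing the five twistor lines $\pi^{-1}(q)$, $q\in P$, if and only if no $4$ points of $P$ are concyclic. 2. *(The family.)* Let $P\subset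 S$ be as in 1, with no $4$ points concyclic. Exactly two projective lines $b_5\neq b_6$ meet all five twistor lines over $P$; they satisfy $\mathbf{j}(b_5)=b_6$ and $\pi(b_5)=\pi(b_6)=S$. There are cubic forms $F_1,F_2$ such that $t\mapsto X_t=\{F_1+tF_2=0\}$ is a bijection from $\mathbb{C}\setminus\{0\}$ onto the set of non-singular cubic surfaces containing the five twistor lines over $P$. Each $X_t$ contains $b_5$ and $b_6$, and its twistor lines are exactly the five over $P$. Moreover, for $s,t\ne 0$: * $X_s$ and $X_t$ are projectively equivalent, by a projective transformation mapping each of the five twistor lines to itself; * a projective transformation commuting with $\mathbf{j}$, mapping each of the five twistor lines to itself and $X_s$ to $X_t$, exists if and only if $|s|=|t|$; * if every Möbius transformation preserving $P$ fixes each point of $P$, then $X_s$ and $X_t$ are conformally equivalent if and only if $|s|=|t|$; * in general there is a constant $c>0$, independent of $s$ and $t$, such that $X_s$ and $X_t$ can be conformally equivalent only if $|s|=|t|$ or $|s||t|=c$. 3. *(The invariant $\xi$.)* Consider labelled configurations: five distinct points of $S^4$ with an ordering $a_1,a_2,a_3,a_4,c_{56}$ of the five twistor lines over them, and an ordered pair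 $b_5\ne b_6$ of projective lines meeting all five. A labelled cubic is such a configuration together with a non-singular cubic surface $X$ containing $a_1,\dots,a_4,c_{56}$. For a labelled cubic there are homogeneous coordinates in which $\mathbf{j}$ has the standard form above, $b_5=\{z_1=z_3=0\}$, $b_6=\{z_2=z_4=0\}$, the lines $a_1,a_2,c_{56}$ meet $b_5$ where $z_2/z_4=0,1,\infty$ and meet $b_6$ where $z_1/z_3=0,1,\infty$. Let $M$ and $N$ be the coefficients of $z_4z_1^2$ and $z_3z_2^2$ in an equation of $X$ in such coordinates. Then $M,N\neq 0$, and $\xi=|M/N|>0$ depends only on the labelled cubic. Two labelled cubics are conformally equivalent, with all labels respected, if and only if their labelled configurations are conformally equivalent (by a projective transformation commuting with $\mathbf{j}$ and respecting all labels) and their values of $\xi$ are equal. Over every labelled configuration with no $4$ of its points concyclic, $\xi$ takes every positive value. 4. *(Projective equivalence.)* Let $X,X'$ be non-singular cubic surfaces containing the twistor lines over sets $P,P'$ of $5$ points respectively. There is a projective transformation carrying $X$ to $X'$ and the five twistor lines over $P$ to those over $P'$ if and only if $P$ and $P'$ are conformally equivalent. (In particular $X$ and $X'$ are projectively equivalent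 if $P$ and $P'$ are conformally equivalent.) 5. *(Every such cubic arises in this way.)* If a non-singular cubic surface contains the twistor lines over a set $P$ of $5$ points, then $P$ lies on a round $2$-sphere and no $4$ points of $P$ are concyclic. -/

import Mathlib

namespace TwistorCubic

open scoped LinearAlgebra.Projectivization Quaternion

/-- Complex projective 3-space. The coordinates `z 0, z 1, z 2, z 3` are the classical
`z₁, z₂, z₃, z₄`. -/
abbrev CP3 : Type := ℙ ℂ (Fin 4 → ℂ)

/-- The 4-sphere as the quaternionic projective line `(ℍ² - 0) / ℍ*`, with `ℍ*` acting by left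
multiplication. -/
abbrev HP1 : Type := ℙ ℍ (Fin 2 → ℍ)

/-- Projective transformations of `CP3` come from invertible complex linear maps. -/
abbrev ProjGroup : Type := LinearMap.GeneralLinearGroup ℂ (Fin 4 → ℂ)

/-- Quaternionic Möbius transformations of the 4-sphere: they come from the invertible
left-`ℍ`-linear maps of `ℍ²`, i.e. `[q₁, q₂] ↦ [q₁ a + q₂ b, q₁ c + q₂ d]`. These are the
(orientation preserving) conformal transformations of `S⁴`. -/
abbrev MobiusGroup : Type := LinearMap.GeneralLinearGroup ℍ (Fin 2 → ℍ)

/-! ### The twistor fibration -/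

/-- The inclusion of the complex numbers `a + b i` in the quaternions. -/
noncomputable def complexToQuat : ℂ →+* ℍ :=
  (Quaternion.ofComplex : ℂ →ₐ[ℝ] ℍ).toRingHom

/-- The quaternion unit `j`. -/
def quatJ : ℍ := ⟨0, 0, 1, 0⟩

/-- The identification `ℂ⁴ = ℍ²`, `(z₁, z₂, z₃, z₄) ↦ (z₁ + z₂ j, z₃ + z₄ j)`; it is linear
over `ℂ ⊆ ℍ`, for left multiplication. -/
noncomputable def toQuat : (Fin 4 → ℂ) →ₛₗ[complexToQuat] (Fin 2 → ℍ) where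
  toFun z := ![complexToQuat (z 0) + complexToQuat (z 1) * quatJ,
    complexToQuat (z 2) + complexToQuat (z 3) * quatJ]
  map_add' z w := by
    funext i
    fin_cases i <;> simp [add_mul] <;> abel
  map_smul' c z := by
    funext i
    fin_cases i <;> simp [mul_add, mul_assoc]

theorem complexToQuat_add_mul_quatJ_injective {a b c d : ℂ}
    (h : complexToQuat a + complexToQuat b * quatJ = complexToQuat c + complexToQuat d * quatJ) :
    a = c ∧ b = d := by
  change (a : ℍ) + (b : ℍ) * quatJ = (c : ℍ) + (d : ℍ) * quatJ at h
  have e1 : quatJ.re = 0 := rfl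
  have e2 : quatJ.imI = 0 := rfl
  have e3 : quatJ.imJ = 1 := rfl
  have e4 : quatJ.imK = 0 := rfl
  have h1 := congrArg (fun q : ℍ => q.re) h
  have h2 := congrArg (fun q : ℍ => q.imI) h
  have h3 := congrArg (fun q : ℍ => q.imJ) h
  have h4 := congrArg (fun q : ℍ => q.imK) h
  simp [e1, e2, e3, e4] at h1 h2 h3 h4
  exact ⟨Complex.ext h1 h2, Complex.ext h3 h4⟩

theorem toQuat_injective : Function.Injective toQuat := by
  intro z w h
  have h0 := complexToQuat_add_mul_quatJ_injective (congrFun h 0)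
  have h1 := complexToQuat_add_mul_quatJ_injective (congrFun h 1)
  funext i
  fin_cases i
  · exact h0.1
  · exact h0.2
  · exact h1.1
  · exact h1.2

/-- The twistor fibration `π : CP³ → S⁴`: a complex line of `ℂ⁴ = ℍ²` is sent to the quaternionic
line that it spans. -/
noncomputable def twistorProj : CP3 → HP1 :=
  Projectivization.map toQuat toQuat_injective

/-- The twistor line over `q`: the fibre of the twistor fibration. -/
def twistorLine (q : HP1) : Set CP3 := twistorProj ⁻¹' {q}

/-- The antilinear map `(z₁, z₂, z₃, z₄) ↦ (-conj z₂, conj z₁, -conj z₄, conj z₃)`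
(left multiplication by the quaternion `j`). -/
noncomputable def jLinear : (Fin 4 → ℂ) →ₛₗ[starRingEnd ℂ] (Fin 4 → ℂ) where
  toFun z := ![-(starRingEnd ℂ) (z 1), (starRingEnd ℂ) (z 0),
    -(starRingEnd ℂ) (z 3), (starRingEnd ℂ) (z 2)]
  map_add' z w := by
    funext i
    fin_cases i <;> simp <;> ring
  map_smul' c z := by
    funext i
    fin_cases i <;> simp

theorem jLinear_injective : Function.Injective jLinear := by
  intro z w h
  have h0 := congrFun h 0
  have h1 := congrFun h 1
  have h2 := congrFun h 2
  have h3 := congrFun h 3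
  simp [jLinear] at h0 h1 h2 h3
  funext i
  fin_cases i
  · exact (starRingEnd ℂ).injective h1
  · exact (starRingEnd ℂ).injective h0
  · exact (starRingEnd ℂ).injective h3
  · exact (starRingEnd ℂ).injective h2

/-- The standard twistor structure `j` on `CP³`. -/
noncomputable def jMap : CP3 → CP3 := Projectivization.map jLinear jLinear_injective

/-! ### Round spheres in the 4-sphere -/

/-- The identification of the quaternionic projective line with the unit sphere of
`ℍ ⊕ ℝ = ℝ⁵`, `[q₁, q₂] ↦ (2 conj(q₁) q₂, |q₁|² - |q₂|²) / (|q₁|² + |q₂|²)`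
(inverse stereographic projection in the affine coordinate `q₁⁻¹ q₂`). -/
noncomputable def toSphere : HP1 → WithLp 2 (ℍ × ℝ) :=
  Projectivization.lift
    (fun v => WithLp.toLp 2
      ((2 / (Quaternion.normSq (v.1 0) + Quaternion.normSq (v.1 1))) • (star (v.1 0) * v.1 1),
        (Quaternion.normSq (v.1 0) - Quaternion.normSq (v.1 1)) /
          (Quaternion.normSq (v.1 0) + Quaternion.normSq (v.1 1))))
    (by
      rintro ⟨a, ha⟩ ⟨b, hb⟩ t h
      simp only at h
      subst h
      have ht : Quaternion.normSq t ≠ 0 := by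
        rw [Quaternion.normSq_ne_zero]
        rintro rfl
        exact ha (zero_smul _ _)
      have key : star (t * b 0) * (t * b 1)
          = Quaternion.normSq t • (star (b 0) * b 1) := by
        rw [star_mul, mul_assoc, ← mul_assoc (star t), Quaternion.star_mul_self,
          ← mul_assoc, ← Quaternion.coe_commutes, mul_assoc, Quaternion.coe_mul_eq_smul]
      simp only [Pi.smul_apply, smul_eq_mul, map_mul, key, smul_smul, ← mul_add, ← mul_sub]
      rw [mul_div_mul_left _ _ ht, div_mul_eq_mul_div, mul_comm (2 : ℝ),
        mul_div_mul_left _ _ ht])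

/-- Round `k`-spheres in the 4-sphere: sections of the unit sphere of `ℝ⁵` by affine subspaces of
dimension `k + 1`, with more than one point. -/
def IsRoundSphere (k : ℕ) (S : Set HP1) : Prop :=
  S.Nontrivial ∧ ∃ E : AffineSubspace ℝ (WithLp 2 (ℍ × ℝ)),
    Module.finrank ℝ E.direction = k + 1 ∧ S = {q | toSphere q ∈ E}

/-- No four points of `P` lie on a circle. -/
def NoFourConcyclic (P : Set HP1) : Prop :=
  ∀ A ⊆ P, A.ncard = 4 → ¬ ∃ C, IsRoundSphere 1 C ∧ A ⊆ C

/-! ### Lines and cubic surfaces in projective space -/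

/-- Projective lines in `CP³`. -/
def IsLine (l : Set CP3) : Prop :=
  ∃ W : Submodule ℂ (Fin 4 → ℂ), Module.finrank ℂ W = 2 ∧ l = {x | x.submodule ≤ W}

/-- The projective zero set of a form. -/
def zeroLocus (F : MvPolynomial (Fin 4) ℂ) : Set CP3 :=
  {x | ∀ z ∈ x.submodule, MvPolynomial.eval z F = 0}

/-- `F` is a cubic form without singular point. -/
def IsNonsingularForm (F : MvPolynomial (Fin 4) ℂ) : Prop :=
  F.IsHomogeneous 3 ∧ ∀ z : Fin 4 → ℂ, z ≠ 0 → MvPolynomial.eval z F = 0 →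
    ∃ i, MvPolynomial.eval z (MvPolynomial.pderiv i F) ≠ 0

/-- Non-singular cubic surfaces in `CP³`. -/
def IsNonsingularCubic (X : Set CP3) : Prop :=
  ∃ F, IsNonsingularForm F ∧ X = zeroLocus F

/-- The points of the 4-sphere over which `X` contains the whole twistor line. -/
def twistorPoints (X : Set CP3) : Set HP1 := {q | twistorLine q ⊆ X}

/-- The non-singular cubic surfaces that contain the twistor lines over all points of `P`. -/
def cubicsOver (P : Set HP1) : Set (Set CP3) :=
  {X | IsNonsingularCubic X ∧ P ⊆ twistorPoints X}

/-- The image of a subset of `CP³` under a projective transformation. -/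
def transform (g : ProjGroup) (X : Set CP3) : Set CP3 := (fun x => g • x) '' X

/-- Projective transformations that preserve the twistor structure `j`. -/
def PreservesJ (g : ProjGroup) : Prop := ∀ x : CP3, g • jMap x = jMap (g • x)

/-- Conformal equivalence of subsets of `CP³`: projective equivalence by a transformation that
preserves `j`. -/
def ConformallyEquivalent (X Y : Set CP3) : Prop :=
  ∃ g : ProjGroup, PreservesJ g ∧ transform g X = Y

/-- Conformal equivalence of subsets of the 4-sphere. -/
def PointsConformallyEquivalent (P Q : Set HP1) : Prop :=
  ∃ T : MobiusGroup, (fun q => T • q) '' P = Q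

/-! ### Labelled cubic surfaces and the invariant `ξ` -/

/-- Five labelled points of the 4-sphere, together with two labelled lines `b₅ ≠ b₆` of `CP³`
that meet all five twistor lines over these points. The twistor lines over
`p 0, p 1, p 2, p 3, p 4` are the lines `a₁, a₂, a₃, a₄, c₅₆`. -/
structure LabelledPoints where
  p : Fin 5 → HP1
  p_injective : Function.Injective p
  b5 : Set CP3
  b6 : Set CP3
  b5_line : IsLine b5
  b6_line : IsLine b6
  b5_ne_b6 : b5 ≠ b6
  b5_meets : ∀ i, (b5 ∩ twistorLine (p i)).Nonempty
  b6_meets : ∀ i, (b6 ∩ twistorLine (p i)).Nonempty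

/-- A labelled cubic surface with five twistor lines: a non-singular cubic surface with a
labelling `a₁, a₂, a₃, a₄, c₅₆` of five twistor lines in it and a labelling `b₅, b₆` of their
two transversals. -/
structure LabelledCubic extends LabelledPoints where
  X : Set CP3
  nonsingular : IsNonsingularCubic X
  twistorLine_subset : ∀ i, twistorLine (p i) ⊆ X

/-- `g` carries the first labelled configuration to the second one, respecting all labels. -/
def LabelledPoints.Carries (g : ProjGroup) (c c' : LabelledPoints) : Prop :=
  (∀ i, transform g (twistorLine (c.p i)) = twistorLine (c'.p i)) ∧
    transform g c.b5 = c'.b5 ∧ transform g c.b6 = c'.b6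

/-- The labelled five points are conformally equivalent (including the labelling of the two lines
over the sphere, i.e. the orientation of the sphere). -/
def LabelledPoints.ConformallyEquivalent (c c' : LabelledPoints) : Prop :=
  ∃ g, PreservesJ g ∧ LabelledPoints.Carries g c c'

/-- The labelled cubic surfaces are conformally equivalent. -/
def LabelledCubic.ConformallyEquivalent (L L' : LabelledCubic) : Prop :=
  ∃ g, PreservesJ g ∧ LabelledPoints.Carries g L.toLabelledPoints L'.toLabelledPoints ∧
    transform g L.X = L'.X

/-- The subset `X` of `CP³` passes through the point with homogeneous coordinates `v`. -/
def Through (X : Set CP3) (v : Fin 4 → ℂ) : Prop :=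
  ∃ x ∈ X, x.submodule = Submodule.span ℂ {v}

/-- `g` gives linear coordinates adapted to the labelled configuration: in these coordinates `j`
is standard, `b₅` is `z₁ = z₃ = 0`, `b₆` is `z₂ = z₄ = 0`, the lines `a₁, a₂, c₅₆` meet `b₅` where
`z₂ / z₄` is `0, 1, ∞`, and they meet `b₆` where `z₁ / z₃` is `0, 1, ∞`. -/
def LabelledPoints.Adapted (c : LabelledPoints) (g : ProjGroup) : Prop :=
  PreservesJ g ∧
  transform g c.b5 = {x | ∀ z ∈ x.submodule, z 0 = 0 ∧ z 2 = 0} ∧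
  transform g c.b6 = {x | ∀ z ∈ x.submodule, z 1 = 0 ∧ z 3 = 0} ∧
  Through (transform g (twistorLine (c.p 0))) ![0, 0, 0, 1] ∧
  Through (transform g (twistorLine (c.p 1))) ![0, 1, 0, 1] ∧
  Through (transform g (twistorLine (c.p 4))) ![0, 1, 0, 0] ∧
  Through (transform g (twistorLine (c.p 0))) ![0, 0, 1, 0] ∧
  Through (transform g (twistorLine (c.p 1))) ![1, 0, 1, 0] ∧
  Through (transform g (twistorLine (c.p 4))) ![1, 0, 0, 0]

/-- `r` is a value of the invariant `ξ = |M / N|` of a labelled cubic surface, where `M` and `N`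
are the coefficients of `z₄ z₁²` and of `z₃ z₂²` in an equation of the surface in adapted
coordinates. -/
def LabelledCubic.HasXi (L : LabelledCubic) (r : ℝ) : Prop :=
  ∃ g F, L.toLabelledPoints.Adapted g ∧ IsNonsingularForm F ∧ transform g L.X = zeroLocus F ∧
    r = ‖F.coeff (Finsupp.single 3 1 + Finsupp.single 0 2) /
          F.coeff (Finsupp.single 2 1 + Finsupp.single 1 2)‖

end TwistorCubic

/-!
A Möbius transformation lifts to a projective transformation that commutes with `j`, and up to a
scalar factor every transformation that commutes with `j` is such a lift
(`PreservesJ.exists_lifts`). Hence the five points may be taken to be `0, 1, λ, μ, ∞` on the complex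
projective line in the 4-sphere. Write `x = (z₁, z₃)` and `y = (z₂, z₄)`. The twistor line over the
complex number `ν` joins the point `(ν, 1)` of the line `y = 0` to the point `(conj ν, 1)` of the
line `x = 0`; these two lines are the transversals of the five twistor lines
(`eq_of_isLine_of_meets`), and `j` interchanges them.

*The pencil.* A cubic form that vanishes on the twistor lines over `0, 1, λ, μ, ∞` has a part `f` of
bidegree `(2, 1)` and a part of bidegree `(1, 2)` in `x, y`, and nothing else. Vanishing is a system
of three linear equations for the four coefficients of `f`. If no four points are concyclic, the
solution is unique up to a factor: otherwise a `(1, 1)`-form in `x` and `conj x` would vanish at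
four of the points, and the zeros of such a form on the sphere lie on a circle
(`IsPentad.coprime`). The second part is a multiple of the transform `f'` of `f` by `j`. So the
forms are `α f + β f'` (`IsSol.exists_eq_pencil`).

*Smoothness.* The member `α f + β f'` is singular if `α` or `β` is zero. Otherwise `f` and `f'` both
vanish at a singular point, because both Euler relations (in `x` and in `y`) hold there. Solving
`f = 0` for `y` and substituting in `f'` gives a binary quintic in `x`; it vanishes at
`0, 1, λ, μ, ∞`, so it has no double root, but a singular point would produce one
(`IsSol.isNonsingularForm_pencil`). The same quintic shows that there are no further twistor lines.

*Necessity.* The twistor lines over `0, 1, ∞` lie on the quadric `z₁ z₄ = z₂ z₃`, on which a cubic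
form through them reduces to a binary cubic `p(s, t)`, which is not zero for a non-singular surface:
no such surface contains a quadric. Any four points can be moved to `0, 1, ∞, ν` with `ν` complex.
If the twistor line over `ν` lies in the surface as well, then `ν` is not real, since otherwise this
line lies on the quadric; so the four points are not concyclic. Moreover `p` is then divisible by
`s t`, and a further twistor line over a point outside the complex line would give two more roots of
`p`; so all points lie on one sphere (`four_twistorLines`).

*Conformal classes.* A transformation that commutes with `j` and permutes the five twistor lines
preserves or interchanges the singular members `f` and `f'`, acting on them by `κ` and `conj κ` up
to sign. This preserves `|β / α|` or inverts it, and the second case cannot occur if the lines are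
fixed (`IsSol.norm_of_transform`, `IsSol.norm_of_transform_fix`). Conversely, the diagonal
transformations `(x, y) ↦ (p x, r y)` act transitively on the pencil, and with `r = conj p` they
commute with `j` and realize every change of `β / α` by a factor of absolute value 1. The
invariant `ξ` is `|α / β|`.

*Projective equivalence.* A projective transformation that carries twistor lines to twistor lines,
restricted to the line `y = 0` and composed with the twistor fibration, is given by a quaternionic
linear map, so it acts on the five points as a Möbius transformation
(`exists_mobius_of_maps_twistorLines`).

Round spheres are handled as sections of the null cone of quaternionic Hermitian `2 × 2` matrices
by linear subspaces of `ℝ⁶`, on which Möbius transformations act linearly (`isRoundSphere_iff`).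
-/

namespace TwistorCubic

open scoped LinearAlgebra.Projectivization Quaternion ComplexConjugate

/-! ### Quaternions as pairs of complex numbers -/

/-- The quaternion `u + v j`. -/
noncomputable def quat (u v : ℂ) : ℍ := complexToQuat u + complexToQuat v * quatJ

@[simp] lemma quatJ_re : quatJ.re = 0 := rfl

@[simp] lemma quatJ_imI : quatJ.imI = 0 := rfl

@[simp] lemma quatJ_imJ : quatJ.imJ = 1 := rfl

@[simp] lemma quatJ_imK : quatJ.imK = 0 := rfl

@[simp] lemma quat_re (u v : ℂ) : (quat u v).re = u.re := by
  change ((u : ℍ) + (v : ℍ) * quatJ).re = _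
  simp

@[simp] lemma quat_imI (u v : ℂ) : (quat u v).imI = u.im := by
  change ((u : ℍ) + (v : ℍ) * quatJ).imI = _
  simp

@[simp] lemma quat_imJ (u v : ℂ) : (quat u v).imJ = v.re := by
  change ((u : ℍ) + (v : ℍ) * quatJ).imJ = _
  simp

@[simp] lemma quat_imK (u v : ℂ) : (quat u v).imK = v.im := by
  change ((u : ℍ) + (v : ℍ) * quatJ).imK = _
  simp

lemma quat_inj {u v u' v' : ℂ} : quat u v = quat u' v' ↔ u = u' ∧ v = v' :=
  ⟨complexToQuat_add_mul_quatJ_injective, by rintro ⟨rfl, rfl⟩; rfl⟩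

lemma exists_quat (q : ℍ) : ∃ u v, q = quat u v :=
  ⟨⟨q.re, q.imI⟩, ⟨q.imJ, q.imK⟩, by ext <;> simp⟩

lemma complexToQuat_eq_quat (u : ℂ) : complexToQuat u = quat u 0 := by simp [quat]

lemma quat_mul (a b u v : ℂ) :
    quat a b * quat u v = quat (a * u - b * conj v) (a * v + b * conj u) := by
  ext <;> simp <;> ring

lemma star_quat (u v : ℂ) : star (quat u v) = quat (conj u) (-v) := by
  ext <;> simp

lemma quat_zero : quat 0 0 = 0 := by ext <;> simp

lemma quat_one : quat 1 0 = 1 := by ext <;> simp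

lemma quat_eq_zero {u v : ℂ} : quat u v = 0 ↔ u = 0 ∧ v = 0 := by
  rw [← quat_zero, quat_inj]

lemma normSq_quat (u v : ℂ) :
    Quaternion.normSq (quat u v) = Complex.normSq u + Complex.normSq v := by
  simp [Quaternion.normSq_def', Complex.normSq_apply]; ring

lemma quat_zero_one : quat 0 1 = quatJ := by simp [quat]

lemma toQuat_apply (z : Fin 4 → ℂ) : toQuat z = ![quat (z 0) (z 1), quat (z 2) (z 3)] := rfl

lemma toQuat_surjective : Function.Surjective toQuat := by
  intro v
  obtain ⟨a, b, h⟩ := exists_quat (v 0)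
  obtain ⟨c, d, h'⟩ := exists_quat (v 1)
  refine ⟨![a, b, c, d], ?_⟩
  funext i
  fin_cases i <;> simp [toQuat_apply, h, h']

lemma toQuat_ne_zero {z : Fin 4 → ℂ} (hz : z ≠ 0) : toQuat z ≠ 0 := fun h =>
  hz (toQuat_injective (h.trans (map_zero toQuat).symm))

lemma jLinear_apply (z : Fin 4 → ℂ) :
    jLinear z = ![-conj (z 1), conj (z 0), -conj (z 3), conj (z 2)] := rfl

lemma toQuat_jLinear (z : Fin 4 → ℂ) : toQuat (jLinear z) = quatJ • toQuat z := by
  rw [← quat_zero_one]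
  funext i
  fin_cases i <;> simp [toQuat_apply, jLinear_apply, quat_mul]

lemma jLinear_jLinear (z : Fin 4 → ℂ) : jLinear (jLinear z) = -z := by
  funext i
  fin_cases i <;> simp [jLinear_apply]

/-- Every quaternion is conjugate to a complex number. -/
lemma exists_conj_complex (q : ℍ) : ∃ w : ℍ, w ≠ 0 ∧ ∃ u : ℂ, q * w = w * quat u 0 := by
  set r := Real.sqrt (q.imI ^ 2 + q.imJ ^ 2 + q.imK ^ 2) with hr
  have hr2 : r ^ 2 = q.imI ^ 2 + q.imJ ^ 2 + q.imK ^ 2 := Real.sq_sqrt (by positivity)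
  by_cases h : q.imI = -r ∧ q.imJ = 0 ∧ q.imK = 0
  · refine ⟨1, one_ne_zero, ⟨q.re, q.imI⟩, ?_⟩
    ext <;> simp [h]
  · -- for purely imaginary `q` of norm `r` this is the element `r - q i`
    refine ⟨quat ⟨r + q.imI, 0⟩ ⟨-q.imK, q.imJ⟩, ?_, ⟨q.re, r⟩, ?_⟩
    · intro h0
      obtain ⟨h1, h2⟩ := quat_eq_zero.1 h0
      have h3 := congrArg Complex.re h1
      have h4 := congrArg Complex.re h2
      have h5 := congrArg Complex.im h2
      simp at h3 h4 h5
      exact h ⟨by linarith, h5, h4⟩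
    · ext <;> simp <;> nlinarith [hr2]

/-! ### Points and projective transformations -/

lemma CP3.exists_rep (x : CP3) : ∃ z, ∃ hz : z ≠ 0, x = Projectivization.mk ℂ z hz :=
  ⟨x.rep, x.rep_nonzero, (x.mk_rep).symm⟩

/-- The point of the 4-sphere with homogeneous coordinates `v`. -/
noncomputable def hp (v : Fin 2 → ℍ) (hv : v ≠ 0) : HP1 := Projectivization.mk ℍ v hv

lemma hp_eq_iff {v w : Fin 2 → ℍ} (hv : v ≠ 0) (hw : w ≠ 0) :
    hp v hv = hp w hw ↔ ∃ a : ℍ, a • w = v := Projectivization.mk_eq_mk_iff' _ _ _ _ _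

lemma mk_eq_iff {v w : Fin 4 → ℂ} (hv : v ≠ 0) (hw : w ≠ 0) :
    (Projectivization.mk ℂ v hv : CP3) = Projectivization.mk ℂ w hw ↔ ∃ a : ℂ, a • w = v :=
  Projectivization.mk_eq_mk_iff' _ _ _ _ _

lemma twistorProj_mk (z : Fin 4 → ℂ) (hz : z ≠ 0) :
    twistorProj (Projectivization.mk ℂ z hz) = hp (toQuat z) (toQuat_ne_zero hz) := rfl

lemma jLinear_ne_zero {z : Fin 4 → ℂ} (hz : z ≠ 0) : jLinear z ≠ 0 := fun h =>
  hz (jLinear_injective (h.trans (map_zero jLinear).symm))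

lemma jMap_mk (z : Fin 4 → ℂ) (hz : z ≠ 0) :
    jMap (Projectivization.mk ℂ z hz) = Projectivization.mk ℂ (jLinear z) (jLinear_ne_zero hz) :=
  rfl

lemma gl_smul_ne_zero (g : ProjGroup) {z : Fin 4 → ℂ} (hz : z ≠ 0) : g • z ≠ 0 :=
  (smul_ne_zero_iff_ne g).mpr hz

lemma mobius_smul_ne_zero (g : MobiusGroup) {z : Fin 2 → ℍ} (hz : z ≠ 0) : g • z ≠ 0 :=
  (smul_ne_zero_iff_ne g).mpr hz

lemma gl_smul_mk (g : ProjGroup) (z : Fin 4 → ℂ) (hz : z ≠ 0) :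
    g • (Projectivization.mk ℂ z hz : CP3) = Projectivization.mk ℂ (g • z) (gl_smul_ne_zero g hz) :=
  rfl

lemma mobius_smul_hp (T : MobiusGroup) (v : Fin 2 → ℍ) (hv : v ≠ 0) :
    T • hp v hv = hp (T • v) (mobius_smul_ne_zero T hv) := rfl

lemma gl_smul_smul (g : ProjGroup) (a : ℂ) (z : Fin 4 → ℂ) : g • (a • z) = a • (g • z) :=
  map_smul (g : Module.End ℂ (Fin 4 → ℂ)) a z

lemma gl_smul_add (g : ProjGroup) (z w : Fin 4 → ℂ) : g • (z + w) = g • z + g • w := smul_add g z w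

lemma mobius_smul_smul (g : MobiusGroup) (a : ℍ) (z : Fin 2 → ℍ) : g • (a • z) = a • (g • z) :=
  map_smul (g : Module.End ℍ (Fin 2 → ℍ)) a z

lemma transform_mul (g h : ProjGroup) (X : Set CP3) :
    transform (g * h) X = transform g (transform h X) := by
  simp only [transform, Set.image_image, mul_smul]

@[simp] lemma transform_one (X : Set CP3) : transform 1 X = X := by
  simp [transform]

lemma transform_inv_transform (g : ProjGroup) (X : Set CP3) :
    transform g⁻¹ (transform g X) = X := by rw [← transform_mul]; simp

lemma transform_transform_inv (g : ProjGroup) (X : Set CP3) :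
    transform g (transform g⁻¹ X) = X := by rw [← transform_mul]; simp

lemma transform_injective (g : ProjGroup) : Function.Injective (transform g) :=
  Function.LeftInverse.injective (transform_inv_transform g)

lemma smul_mem_transform {g : ProjGroup} {X : Set CP3} {x : CP3} :
    g • x ∈ transform g X ↔ x ∈ X :=
  (MulAction.injective g).mem_set_image

lemma mem_transform {g : ProjGroup} {X : Set CP3} {x : CP3} :
    x ∈ transform g X ↔ g⁻¹ • x ∈ X := by
  rw [← smul_mem_transform (g := g) (x := g⁻¹ • x), smul_inv_smul]

lemma transform_mono {g : ProjGroup} {X Y : Set CP3} :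
    transform g X ⊆ transform g Y ↔ X ⊆ Y :=
  Set.image_subset_image_iff (MulAction.injective g)

lemma transform_inter {g : ProjGroup} {X Y : Set CP3} :
    transform g (X ∩ Y) = transform g X ∩ transform g Y :=
  Set.image_inter (MulAction.injective g)

/-! ### Projective transformations over Möbius transformations -/

/-- The linear map `g` of `ℂ⁴` is the `ℍ`-linear map `T` of `ℍ²`. -/
def Lifts (g : ProjGroup) (T : MobiusGroup) : Prop := ∀ z, toQuat (g • z) = T • toQuat z

lemma Lifts.mul {g h : ProjGroup} {S T : MobiusGroup} (hg : Lifts g S) (hh : Lifts h T) :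
    Lifts (g * h) (S * T) := fun z => by rw [mul_smul, hg, hh, mul_smul]

lemma Lifts.inv {g : ProjGroup} {T : MobiusGroup} (h : Lifts g T) : Lifts g⁻¹ T⁻¹ := fun z => by
  rw [eq_inv_smul_iff, ← h, smul_inv_smul]

lemma Lifts.jLinear {g : ProjGroup} {T : MobiusGroup} (h : Lifts g T) (z : Fin 4 → ℂ) :
    g • jLinear z = jLinear (g • z) := by
  apply toQuat_injective
  rw [h, toQuat_jLinear, toQuat_jLinear, h, mobius_smul_smul]

lemma Lifts.preservesJ {g : ProjGroup} {T : MobiusGroup} (h : Lifts g T) : PreservesJ g := by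
  intro x
  obtain ⟨z, hz, rfl⟩ := CP3.exists_rep x
  simp only [jMap_mk, gl_smul_mk, h.jLinear]

lemma Lifts.twistorProj {g : ProjGroup} {T : MobiusGroup} (h : Lifts g T) (x : CP3) :
    twistorProj (g • x) = T • twistorProj x := by
  obtain ⟨z, hz, rfl⟩ := CP3.exists_rep x
  simp only [twistorProj_mk, gl_smul_mk, mobius_smul_hp, h z]

lemma Lifts.transform_twistorLine {g : ProjGroup} {T : MobiusGroup} (h : Lifts g T) (q : HP1) :
    transform g (twistorLine q) = twistorLine (T • q) := by
  ext x
  rw [mem_transform]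
  simp only [twistorLine, Set.mem_preimage, Set.mem_singleton_iff, h.inv.twistorProj]
  rw [inv_smul_eq_iff]

lemma twistorLine_nonempty (q : HP1) : (twistorLine q).Nonempty := by
  obtain ⟨z, hz⟩ := toQuat_surjective q.rep
  have h0 : z ≠ 0 := by
    rintro rfl
    exact q.rep_nonzero (by rw [← hz, map_zero])
  refine ⟨Projectivization.mk ℂ z h0, ?_⟩
  change twistorProj _ = q
  rw [twistorProj_mk, ← q.mk_rep]
  simp only [hp, hz]

lemma twistorLine_injective : Function.Injective twistorLine := by
  intro p q h
  obtain ⟨x, hx⟩ := twistorLine_nonempty p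
  have hx' : x ∈ twistorLine q := h ▸ hx
  exact hx.symm.trans hx'

/-- Every Möbius transformation lifts to projective space. -/
lemma exists_lift (T : MobiusGroup) : ∃ g, Lifts g T := by
  let e := Equiv.ofBijective toQuat ⟨toQuat_injective, toQuat_surjective⟩
  have he : ∀ v, toQuat (e.symm v) = v := fun v => e.apply_symm_apply v
  let F : MobiusGroup → (Fin 4 → ℂ) →ₗ[ℂ] (Fin 4 → ℂ) := fun T =>
    { toFun := fun z => e.symm (T • toQuat z)
      map_add' := fun z w => toQuat_injective (by simp only [map_add, he, smul_add])
      map_smul' := fun c z => toQuat_injective (by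
        simp only [map_smulₛₗ, he, mobius_smul_smul, RingHom.id_apply]) }
  have hF : ∀ T z, toQuat (F T z) = T • toQuat z := fun T z => he _
  let g : ProjGroup :=
    { val := F T
      inv := F T⁻¹
      val_inv := LinearMap.ext fun z => toQuat_injective (by
        simp only [Module.End.mul_apply, hF, smul_inv_smul, Module.End.one_apply])
      inv_val := LinearMap.ext fun z => toQuat_injective (by
        simp only [Module.End.mul_apply, hF, inv_smul_smul, Module.End.one_apply]) }
  exact ⟨g, fun z => hF T z⟩

/-! ### Round spheres and Hermitian coordinates -/

/-- The Hermitian matrix `v* v` of a vector of `ℍ²`, as the triple of its entry `conj v₀ v₁` and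
its two diagonal entries. The 4-sphere becomes the projectivized null cone in `ℝ⁶`. -/
noncomputable def hermVec (v : Fin 2 → ℍ) : ℍ × ℝ × ℝ :=
  (star (v 0) * v 1, Quaternion.normSq (v 0), Quaternion.normSq (v 1))

lemma hermVec_smul (t : ℍ) (v : Fin 2 → ℍ) :
    hermVec (t • v) = Quaternion.normSq t • hermVec v := by
  have key : star (t * v 0) * (t * v 1) = Quaternion.normSq t • (star (v 0) * v 1) := by
    rw [star_mul, mul_assoc, ← mul_assoc (star t), Quaternion.star_mul_self,
      ← mul_assoc, ← Quaternion.coe_commutes, mul_assoc, Quaternion.coe_mul_eq_smul]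
  simp only [hermVec, Pi.smul_apply, smul_eq_mul, key, map_mul]
  rfl

/-- The subset of the 4-sphere cut out by a linear subspace of `ℝ⁶`. -/
def hermSet (V : Submodule ℝ (ℍ × ℝ × ℝ)) : Set HP1 := {q | hermVec q.rep ∈ V}

lemma hp_mem_hermSet {V : Submodule ℝ (ℍ × ℝ × ℝ)} {v : Fin 2 → ℍ} {hv : v ≠ 0} :
    hp v hv ∈ hermSet V ↔ hermVec v ∈ V := by
  obtain ⟨a, ha⟩ := Projectivization.exists_smul_eq_mk_rep ℍ v hv
  change hermVec (Projectivization.mk ℍ v hv).rep ∈ V ↔ _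
  rw [← ha]
  change hermVec ((a : ℍ) • v) ∈ V ↔ _
  rw [hermVec_smul]
  exact V.smul_mem_iff (Quaternion.normSq_ne_zero.2 a.ne_zero)

/-- The linear isomorphism from `ℝ⁶` to `ℝ⁵ × ℝ` under which the affine hyperplane of matrices of
trace 1 is the ambient space of the unit sphere, with the origin shifted to `x₀`. -/
noncomputable def chartEquiv (x₀ : WithLp 2 (ℍ × ℝ)) :
    (ℍ × ℝ × ℝ) ≃ₗ[ℝ] (WithLp 2 (ℍ × ℝ) × ℝ) where
  toFun n := (WithLp.toLp 2 ((2 : ℝ) • n.1, n.2.1 - n.2.2) - (n.2.1 + n.2.2) • x₀, n.2.1 + n.2.2)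
  invFun m := ((2⁻¹ : ℝ) • (m.1 + m.2 • x₀).fst, 2⁻¹ * (m.2 + (m.1 + m.2 • x₀).snd),
    2⁻¹ * (m.2 - (m.1 + m.2 • x₀).snd))
  map_add' a b := by
    apply Prod.ext
    · apply WithLp.ofLp_injective
      apply Prod.ext
      · simp [add_smul]; abel
      · simp; ring
    · simp; ring
  map_smul' c a := by
    apply Prod.ext
    · apply WithLp.ofLp_injective
      apply Prod.ext
      · simp [smul_sub, smul_smul, mul_add, mul_comm]
      · simp; ring
    · simp; ring
  left_inv a := by
    apply Prod.ext
    · simp [smul_smul]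
    · apply Prod.ext
      · simp; ring
      · simp; ring
  right_inv m := by
    have h2 : 2⁻¹ * (m.2 + (m.1 + m.2 • x₀).snd) + 2⁻¹ * (m.2 - (m.1 + m.2 • x₀).snd) = m.2 := by
      ring
    apply Prod.ext
    · apply WithLp.ofLp_injective
      simp only [h2]
      apply Prod.ext
      · simp [smul_smul]
      · simp; ring
    · exact h2

lemma toSphere_hp (v : Fin 2 → ℍ) (hv : v ≠ 0) : toSphere (hp v hv) = WithLp.toLp 2
      ((2 / (Quaternion.normSq (v 0) + Quaternion.normSq (v 1))) • (star (v 0) * v 1),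
        (Quaternion.normSq (v 0) - Quaternion.normSq (v 1)) /
          (Quaternion.normSq (v 0) + Quaternion.normSq (v 1))) := rfl

lemma normSq_add_pos {v : Fin 2 → ℍ} (hv : v ≠ 0) :
    0 < Quaternion.normSq (v 0) + Quaternion.normSq (v 1) := by
  by_contra h
  have h0 := Quaternion.normSq_nonneg (a := v 0)
  have h1 := Quaternion.normSq_nonneg (a := v 1)
  have e0 : v 0 = 0 := Quaternion.normSq_eq_zero.1 (by linarith)
  have e1 : v 1 = 0 := Quaternion.normSq_eq_zero.1 (by linarith)
  apply hv
  funext i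
  fin_cases i
  · exact e0
  · exact e1

lemma chartEquiv_hermVec (x₀ : WithLp 2 (ℍ × ℝ)) (v : Fin 2 → ℍ) (hv : v ≠ 0) :
    chartEquiv x₀ (hermVec v) = (Quaternion.normSq (v 0) + Quaternion.normSq (v 1)) •
      (toSphere (hp v hv) - x₀, (1 : ℝ)) := by
  have h := (normSq_add_pos hv).ne'
  rw [toSphere_hp]
  apply Prod.ext
  · apply WithLp.ofLp_injective
    apply Prod.ext
    · simp [chartEquiv, hermVec, smul_sub, smul_smul, mul_div_cancel₀ _ h]
    · simp [chartEquiv, hermVec, mul_sub, mul_div_cancel₀ _ h]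
  · simp [chartEquiv, hermVec]

lemma finrank_prod_top {E : Type*} [AddCommGroup E] [Module ℝ E] [FiniteDimensional ℝ E]
    (D : Submodule ℝ E) :
    Module.finrank ℝ (D.prod (⊤ : Submodule ℝ ℝ)) = Module.finrank ℝ D + 1 := by
  let e : (D.prod (⊤ : Submodule ℝ ℝ)) ≃ₗ[ℝ] D × ℝ :=
    { toFun := fun x => (⟨x.1.1, x.2.1⟩, x.1.2)
      invFun := fun x => ⟨(x.1.1, x.2), x.1.2, trivial⟩
      map_add' := fun _ _ => rfl
      map_smul' := fun _ _ => rfl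
      left_inv := fun _ => rfl
      right_inv := fun _ => rfl }
  rw [e.finrank_eq, Module.finrank_prod, Module.finrank_self]

lemma HP1.exists_rep (q : HP1) : ∃ v, ∃ hv : v ≠ 0, q = hp v hv :=
  ⟨q.rep, q.rep_nonzero, (q.mk_rep).symm⟩

/-- Round `k`-spheres are the nontrivial sections of the null cone by linear subspaces of
dimension `k + 2`. -/
lemma isRoundSphere_iff {k : ℕ} {S : Set HP1} : IsRoundSphere k S ↔
    S.Nontrivial ∧ ∃ V : Submodule ℝ (ℍ × ℝ × ℝ), Module.finrank ℝ V = k + 2 ∧ S = hermSet V := by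
  constructor
  · rintro ⟨hS, E, hE, rfl⟩
    refine ⟨hS, ?_⟩
    obtain ⟨q, hq⟩ := hS.nonempty
    set x₀ := toSphere q
    refine ⟨(E.direction.prod ⊤).comap (chartEquiv x₀).toLinearMap, ?_, ?_⟩
    · rw [((chartEquiv x₀).ofSubmodule' (E.direction.prod ⊤)).finrank_eq, finrank_prod_top, hE]
    · ext p
      obtain ⟨v, hv, rfl⟩ := HP1.exists_rep p
      rw [hp_mem_hermSet, Submodule.mem_comap, LinearEquiv.coe_coe, chartEquiv_hermVec x₀ v hv,
        Submodule.smul_mem_iff _ (normSq_add_pos hv).ne', Submodule.mem_prod]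
      have := AffineSubspace.vsub_right_mem_direction_iff_mem hq (toSphere (hp v hv))
      rw [vsub_eq_sub] at this
      simp only [Submodule.mem_top, and_true]
      exact this.symm
  · rintro ⟨hS, V, hV, rfl⟩
    refine ⟨hS, ?_⟩
    obtain ⟨q, hq⟩ := hS.nonempty
    obtain ⟨w, hw, rfl⟩ := HP1.exists_rep q
    set x₀ := toSphere (hp w hw) with hx₀
    set W := V.map (chartEquiv x₀).toLinearMap with hW
    set D := W.comap (LinearMap.inl ℝ (WithLp 2 (ℍ × ℝ)) ℝ) with hD
    have mem_W : ∀ n, chartEquiv x₀ n ∈ W ↔ n ∈ V := fun n =>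
      ⟨by rintro ⟨m, hm, h⟩; exact (chartEquiv x₀).injective h ▸ hm, fun h => ⟨n, h, rfl⟩⟩
    -- the base point makes `W` the product of its direction space with the vertical axis
    have h1 : ((0 : WithLp 2 (ℍ × ℝ)), (1 : ℝ)) ∈ W := by
      have := (mem_W _).2 (hp_mem_hermSet.1 hq)
      rw [chartEquiv_hermVec x₀ w hw, Submodule.smul_mem_iff _ (normSq_add_pos hw).ne', ← hx₀,
        sub_self] at this
      exact this
    have hWD : W = D.prod ⊤ := by
      ext ⟨m, t⟩
      have e : (m, t) = (m, (0 : ℝ)) + t • ((0 : WithLp 2 (ℍ × ℝ)), (1 : ℝ)) := by simp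
      rw [e, Submodule.add_mem_iff_left _ (W.smul_mem t h1)]
      simp [hD]
    refine ⟨AffineSubspace.mk' x₀ D, ?_, ?_⟩
    · rw [AffineSubspace.direction_mk']
      have : Module.finrank ℝ W = Module.finrank ℝ V := LinearEquiv.finrank_map_eq _ _
      rw [hWD, finrank_prod_top, hV] at this
      omega
    · ext p
      obtain ⟨v, hv, rfl⟩ := HP1.exists_rep p
      rw [hp_mem_hermSet, ← mem_W, chartEquiv_hermVec x₀ v hv,
        Submodule.smul_mem_iff _ (normSq_add_pos hv).ne', hWD, Set.mem_ofPred_eq,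
        AffineSubspace.mem_mk', vsub_eq_sub]
      simp

/-- The first standard basis vector of `ℍ²`. -/
noncomputable def e₀ : Fin 2 → ℍ := ![1, 0]

/-- The second standard basis vector of `ℍ²`. -/
noncomputable def e₁ : Fin 2 → ℍ := ![0, 1]

lemma mobius_smul_eq (T : MobiusGroup) (v : Fin 2 → ℍ) :
    T • v = v 0 • (T • e₀) + v 1 • (T • e₁) := by
  rw [← mobius_smul_smul, ← mobius_smul_smul, ← smul_add]
  congr 1
  funext i
  fin_cases i <;> simp [e₀, e₁]

/-- The action of a Möbius transformation on Hermitian matrices: the real-linear map that sends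
`v* v` to `(T v)* (T v)`. -/
noncomputable def hermMap (T : MobiusGroup) : (ℍ × ℝ × ℝ) →ₗ[ℝ] (ℍ × ℝ × ℝ) where
  toFun n :=
    (n.2.1 • (star ((T • e₀) 0) * (T • e₀) 1) + star ((T • e₀) 0) * n.1 * (T • e₁) 1 +
      star ((T • e₁) 0) * star n.1 * (T • e₀) 1 + n.2.2 • (star ((T • e₁) 0) * (T • e₁) 1),
    n.2.1 * Quaternion.normSq ((T • e₀) 0) + n.2.2 * Quaternion.normSq ((T • e₁) 0) +
      2 * (star ((T • e₀) 0) * n.1 * (T • e₁) 0).re,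
    n.2.1 * Quaternion.normSq ((T • e₀) 1) + n.2.2 * Quaternion.normSq ((T • e₁) 1) +
      2 * (star ((T • e₀) 1) * n.1 * (T • e₁) 1).re)
  map_add' a b := by
    apply Prod.ext
    · simp only [Prod.fst_add, Prod.snd_add, add_smul, mul_add, add_mul, star_add]; abel
    · apply Prod.ext
      · simp only [Prod.fst_add, Prod.snd_add, mul_add, add_mul, Quaternion.re_add]; ring
      · simp only [Prod.fst_add, Prod.snd_add, mul_add, add_mul, Quaternion.re_add]; ring
  map_smul' c a := by
    apply Prod.ext
    · simp [smul_smul]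
    · apply Prod.ext
      · simp only [Prod.smul_fst, Prod.smul_snd, mul_smul_comm, smul_mul_assoc,
          Quaternion.re_smul, smul_eq_mul, RingHom.id_apply]; ring
      · simp only [Prod.smul_fst, Prod.smul_snd, mul_smul_comm, smul_mul_assoc,
          Quaternion.re_smul, smul_eq_mul, RingHom.id_apply]; ring

lemma normSq_mul_add_mul (a b c d : ℍ) : Quaternion.normSq (a * b + c * d) =
    Quaternion.normSq a * Quaternion.normSq b + Quaternion.normSq c * Quaternion.normSq d +
      2 * (star b * (star a * c) * d).re := by
  simp [Quaternion.normSq_def']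
  ring

lemma hermVec_mobius (T : MobiusGroup) (v : Fin 2 → ℍ) :
    hermVec (T • v) = hermMap T (hermVec v) := by
  have h : ∀ i, (T • v) i = v 0 * (T • e₀) i + v 1 * (T • e₁) i := fun i => by
    rw [mobius_smul_eq]; rfl
  apply Prod.ext
  · simp only [hermVec, hermMap, h, LinearMap.coe_mk, AddHom.coe_mk, star_add, star_mul, star_star]
    simp only [← Quaternion.coe_mul_eq_smul, ← Quaternion.star_mul_self]
    generalize (T • e₀) 0 = p, (T • e₀) 1 = q, (T • e₁) 0 = r, (T • e₁) 1 = s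
    have h1 : (star (v 0) * v 0) * (star p * q) = star p * (star (v 0) * v 0) * q := by
      rw [Quaternion.star_mul_self, ← mul_assoc, Quaternion.coe_commutes]
    have h2 : (star (v 1) * v 1) * (star r * s) = star r * (star (v 1) * v 1) * s := by
      rw [Quaternion.star_mul_self, ← mul_assoc, Quaternion.coe_commutes]
    rw [h1, h2]
    noncomm_ring
  · apply Prod.ext
    · simp only [hermVec, hermMap, h, LinearMap.coe_mk, AddHom.coe_mk, normSq_mul_add_mul]
    · simp only [hermVec, hermMap, h, LinearMap.coe_mk, AddHom.coe_mk, normSq_mul_add_mul]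

lemma hermVec_vec (a b : ℍ) :
    hermVec ![a, b] = (star a * b, Quaternion.normSq a, Quaternion.normSq b) := rfl

/-- The Hermitian matrices `v* v` span. -/
lemma linearMap_ext_hermVec {φ ψ : (ℍ × ℝ × ℝ) →ₗ[ℝ] (ℍ × ℝ × ℝ)}
    (h : ∀ v, φ (hermVec v) = ψ (hermVec v)) : φ = ψ := by
  have h0 : φ (0, 1, 0) = ψ (0, 1, 0) := by simpa [hermVec_vec] using h ![1, 0]
  have h1 : φ (0, 0, 1) = ψ (0, 0, 1) := by simpa [hermVec_vec] using h ![0, 1]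
  refine LinearMap.ext fun ⟨w, r, s⟩ => ?_
  have e : (w, r, s) = hermVec ![1, w] + (r - 1) • ((0 : ℍ), (1 : ℝ), (0 : ℝ)) +
      (s - Quaternion.normSq w) • ((0 : ℍ), (0 : ℝ), (1 : ℝ)) := by
    simp [hermVec_vec]
  rw [e]
  simp only [map_add, map_smul, h, h0, h1]

lemma hermMap_mul_inv (T : MobiusGroup) (n : ℍ × ℝ × ℝ) : hermMap T (hermMap T⁻¹ n) = n := by
  have : hermMap T ∘ₗ hermMap T⁻¹ = LinearMap.id := linearMap_ext_hermVec fun v => by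
    simp [← hermVec_mobius]
  exact LinearMap.congr_fun this n

/-- The action of a Möbius transformation on Hermitian matrices, as an isomorphism. -/
noncomputable def hermEquiv (T : MobiusGroup) : (ℍ × ℝ × ℝ) ≃ₗ[ℝ] (ℍ × ℝ × ℝ) :=
  LinearEquiv.ofLinearMap (hermMap T) (hermMap T⁻¹) (LinearMap.ext (hermMap_mul_inv T))
    (LinearMap.ext fun n => by simpa using hermMap_mul_inv T⁻¹ n)

lemma image_hermSet (T : MobiusGroup) (V : Submodule ℝ (ℍ × ℝ × ℝ)) :
    (fun q => T • q) '' hermSet V = hermSet (V.map (hermEquiv T).toLinearMap) := by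
  ext q
  constructor
  · rintro ⟨p, hp', rfl⟩
    obtain ⟨v, hv, rfl⟩ := HP1.exists_rep p
    rw [hp_mem_hermSet] at hp'
    simp only [mobius_smul_hp, hp_mem_hermSet, hermVec_mobius]
    exact ⟨_, hp', rfl⟩
  · intro h
    refine ⟨T⁻¹ • q, ?_, smul_inv_smul _ _⟩
    obtain ⟨v, hv, rfl⟩ := HP1.exists_rep q
    simp only [mobius_smul_hp, hp_mem_hermSet, hermVec_mobius] at h ⊢
    obtain ⟨n, hn, h⟩ := h
    rw [← h]
    change hermMap T⁻¹ (hermMap T n) ∈ V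
    have := hermMap_mul_inv T⁻¹ n
    rw [inv_inv] at this
    rwa [this]

lemma IsRoundSphere.image {k : ℕ} {S : Set HP1} (h : IsRoundSphere k S) (T : MobiusGroup) :
    IsRoundSphere k ((fun q => T • q) '' S) := by
  rw [isRoundSphere_iff] at h ⊢
  obtain ⟨hS, V, hV, rfl⟩ := h
  refine ⟨hS.image (MulAction.injective T), _, ?_, image_hermSet T V⟩
  rw [← hV]
  exact LinearEquiv.finrank_map_eq _ _

lemma image_inv_image (T : MobiusGroup) (A : Set HP1) :
    (fun q => T⁻¹ • q) '' ((fun q => T • q) '' A) = A := by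
  simp [Set.image_image]

lemma NoFourConcyclic.image {P : Set HP1} (h : NoFourConcyclic P) (T : MobiusGroup) :
    NoFourConcyclic ((fun q => T • q) '' P) := by
  rintro A hA hc ⟨C, hC, hAC⟩
  refine h ((fun q => T⁻¹ • q) '' A) ?_ ?_ ⟨_, hC.image T⁻¹, Set.image_mono hAC⟩
  · rw [← image_inv_image T P]
    exact Set.image_mono hA
  · rw [Set.ncard_image_of_injective _ (MulAction.injective T⁻¹), hc]

/-! ### Normal forms for points of the 4-sphere -/

lemma pt_aux (u v : ℂ) : (![quat u v, quat 1 0] : Fin 2 → ℍ) ≠ 0 := fun h => by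
  simpa [quat_eq_zero] using congrFun h 1

lemma ptInf_aux : (![quat 1 0, quat 0 0] : Fin 2 → ℍ) ≠ 0 := fun h => by
  simpa [quat_eq_zero] using congrFun h 0

/-- The point `u + v j` of the affine chart `[q, 1]` of the 4-sphere. -/
noncomputable def pt (u v : ℂ) : HP1 := hp ![quat u v, quat 1 0] (pt_aux u v)

/-- The point at infinity `[1, 0]`. -/
noncomputable def ptInf : HP1 := hp ![quat 1 0, quat 0 0] ptInf_aux

lemma pt_inj {u v u' v' : ℂ} : pt u v = pt u' v' ↔ u = u' ∧ v = v' := by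
  constructor
  · intro h
    obtain ⟨a, ha⟩ := (hp_eq_iff _ _).1 h
    have h0 := congrFun ha 0
    have h1 := congrFun ha 1
    simp only [quat_one, Pi.smul_apply, smul_eq_mul, Matrix.cons_val_zero, Matrix.cons_val_one,
      mul_one] at h0 h1
    rw [h1, one_mul, quat_inj] at h0
    exact ⟨h0.1.symm, h0.2.symm⟩
  · rintro ⟨rfl, rfl⟩
    rfl

lemma pt_ne_ptInf (u v : ℂ) : pt u v ≠ ptInf := fun h => by
  obtain ⟨a, ha⟩ := (hp_eq_iff _ _).1 h
  have h1 := congrFun ha 1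
  simp [quat_one, quat_zero] at h1

lemma eq_pt_or_eq_ptInf (q : HP1) : (∃ u v, q = pt u v) ∨ q = ptInf := by
  obtain ⟨w, hw, rfl⟩ := HP1.exists_rep q
  by_cases h : w 1 = 0
  · right
    refine (hp_eq_iff _ _).2 ⟨w 0, ?_⟩
    funext i
    fin_cases i <;> simp [quat_one, quat_zero, h]
  · left
    obtain ⟨u, v, huv⟩ := exists_quat ((w 1)⁻¹ * w 0)
    refine ⟨u, v, (hp_eq_iff _ _).2 ⟨w 1, ?_⟩⟩
    rw [← huv]
    funext i
    fin_cases i <;> simp [quat_one, mul_inv_cancel_left₀ h]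

lemma mem_twistorLine_pt {u v : ℂ} {z : Fin 4 → ℂ} {hz : z ≠ 0} :
    Projectivization.mk ℂ z hz ∈ twistorLine (pt u v) ↔
      z 0 = z 2 * u - z 3 * conj v ∧ z 1 = z 2 * v + z 3 * conj u := by
  change hp _ _ = _ ↔ _
  rw [pt, hp_eq_iff, ← quat_inj, ← quat_mul]
  constructor
  · rintro ⟨a, ha⟩
    have h0 := congrFun ha 0
    have h1 := congrFun ha 1
    simp only [quat_one, Pi.smul_apply, smul_eq_mul, Matrix.cons_val_zero, Matrix.cons_val_one,
      mul_one, toQuat_apply] at h0 h1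
    rw [← h0, h1]
  · intro h
    refine ⟨quat (z 2) (z 3), ?_⟩
    funext i
    fin_cases i <;> simp [toQuat_apply, h, quat_one]

lemma mem_twistorLine_ptInf {z : Fin 4 → ℂ} {hz : z ≠ 0} :
    Projectivization.mk ℂ z hz ∈ twistorLine ptInf ↔ z 2 = 0 ∧ z 3 = 0 := by
  change hp _ _ = _ ↔ _
  rw [ptInf, hp_eq_iff, ← quat_eq_zero]
  constructor
  · rintro ⟨a, ha⟩
    have h1 := congrFun ha 1
    simpa [quat_zero, toQuat_apply, eq_comm] using h1
  · intro h
    refine ⟨quat (z 0) (z 1), ?_⟩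
    funext i
    fin_cases i <;> simp [toQuat_apply, h, quat_one, quat_zero]

/-! ### Möbius transformations with prescribed values -/

lemma exists_mobius_basis {v w : Fin 2 → ℍ} (hv : v ≠ 0) (hw : w ≠ 0) (h : hp v hv ≠ hp w hw) :
    ∃ T : MobiusGroup, T • e₀ = v ∧ T • e₁ = w := by
  let f : (Fin 2 → ℍ) →ₗ[ℍ] (Fin 2 → ℍ) :=
    { toFun := fun x => x 0 • v + x 1 • w
      map_add' := fun x y => by simp only [Pi.add_apply, add_smul]; abel
      map_smul' := fun c x => by simp only [Pi.smul_apply, smul_eq_mul, mul_smul, smul_add,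
        RingHom.id_apply] }
  have hf : Function.Injective f := by
    rw [← LinearMap.ker_eq_bot, LinearMap.ker_eq_bot']
    intro x hx
    change x 0 • v + x 1 • w = 0 at hx
    have h0 : x 0 = 0 := by
      by_contra h0
      apply h
      rw [hp_eq_iff]
      refine ⟨-((x 0)⁻¹ * x 1), ?_⟩
      rw [neg_smul, mul_smul, ← smul_neg, ← eq_neg_of_add_eq_zero_left hx, inv_smul_smul₀ h0]
    have h1 : x 1 = 0 := by
      rw [h0, zero_smul, zero_add] at hx
      exact (smul_eq_zero.1 hx).resolve_right hw
    funext i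
    fin_cases i
    · exact h0
    · exact h1
  refine ⟨LinearMap.GeneralLinearGroup.ofLinearEquiv (LinearEquiv.ofInjectiveEndo f hf), ?_, ?_⟩
  · change f e₀ = v
    simp [f, e₀]
  · change f e₁ = w
    simp [f, e₁]

lemma e₀_ne_zero : e₀ ≠ 0 := fun h => by simpa [e₀] using congrFun h 0

lemma e₁_ne_zero : e₁ ≠ 0 := fun h => by simpa [e₁] using congrFun h 1

lemma hp_congr {v w : Fin 2 → ℍ} {hv : v ≠ 0} {hw : w ≠ 0} (h : v = w) : hp v hv = hp w hw := by
  subst h; rfl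

lemma ptInf_eq : ptInf = hp e₀ e₀_ne_zero := hp_congr (by simp [quat_one, quat_zero, e₀])

lemma pt_zero_eq : pt 0 0 = hp e₁ e₁_ne_zero := hp_congr (by simp [quat_one, quat_zero, e₁])

/-- Möbius transformations act transitively on triples of distinct points. -/
lemma exists_mobius_three {a b c : HP1} (hab : a ≠ b) (hac : a ≠ c) (hbc : b ≠ c) :
    ∃ T : MobiusGroup, T • a = pt 0 0 ∧ T • b = pt 1 0 ∧ T • c = ptInf := by
  obtain ⟨v, hv, rfl⟩ := HP1.exists_rep a
  obtain ⟨w, hw, rfl⟩ := HP1.exists_rep b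
  obtain ⟨x, hx, rfl⟩ := HP1.exists_rep c
  obtain ⟨T, h0, h1⟩ := exists_mobius_basis hx hv hac.symm
  have hw' : w = (T⁻¹ • w) 0 • x + (T⁻¹ • w) 1 • v := by
    rw [← h0, ← h1, ← mobius_smul_eq, smul_inv_smul]
  set s := (T⁻¹ • w) 0
  set t := (T⁻¹ • w) 1
  have hs : s ≠ 0 := by
    intro hs
    rw [hs, zero_smul, zero_add] at hw'
    exact hab ((hp_eq_iff _ _).2 ⟨t, hw'.symm⟩).symm
  have ht : t ≠ 0 := by
    intro ht
    rw [ht, zero_smul, add_zero] at hw'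
    exact hbc ((hp_eq_iff _ _).2 ⟨s, hw'.symm⟩)
  have hsx : s • x ≠ 0 := smul_ne_zero hs hx
  have htv : t • v ≠ 0 := smul_ne_zero ht hv
  have e1 : hp (s • x) hsx = hp x hx := (hp_eq_iff _ _).2 ⟨s, rfl⟩
  have e2 : hp (t • v) htv = hp v hv := (hp_eq_iff _ _).2 ⟨t, rfl⟩
  -- rescaled representatives of `c` and `a`, whose sum represents `b`
  obtain ⟨R, h0', h1'⟩ := exists_mobius_basis hsx htv (by rw [e1, e2]; exact hac.symm)
  refine ⟨R⁻¹, ?_, ?_, ?_⟩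
  · rw [inv_smul_eq_iff, ← e2, pt_zero_eq, mobius_smul_hp]
    exact hp_congr h1'.symm
  · rw [inv_smul_eq_iff, pt, mobius_smul_hp]
    apply hp_congr
    rw [mobius_smul_eq, h0', h1', hw']
    simp [quat_one]
  · rw [inv_smul_eq_iff, ← e1, ptInf_eq, mobius_smul_hp]
    exact hp_congr h0'.symm

/-- Four distinct points can be moved to `0`, `1`, `∞` and a complex number. -/
lemma exists_mobius_four {a b c q : HP1} (hab : a ≠ b) (hac : a ≠ c) (hbc : b ≠ c) (hqc : q ≠ c) :
    ∃ T : MobiusGroup, ∃ ν : ℂ, T • a = pt 0 0 ∧ T • b = pt 1 0 ∧ T • c = ptInf ∧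
      T • q = pt ν 0 := by
  obtain ⟨T, ha, hb, hc⟩ := exists_mobius_three hab hac hbc
  obtain ⟨u, v, huv⟩ := (eq_pt_or_eq_ptInf (T • q)).resolve_right
    fun h => hqc (MulAction.injective T (h.trans hc.symm))
  -- the transformations that fix `0, 1, ∞` are the conjugations `q ↦ w⁻¹ q w`
  obtain ⟨w, hw, ν, hν⟩ := exists_conj_complex (quat u v)
  have hv : w • e₀ ≠ 0 := smul_ne_zero hw e₀_ne_zero
  have hv' : w • e₁ ≠ 0 := smul_ne_zero hw e₁_ne_zero
  have e1 : hp (w • e₀) hv = ptInf := by rw [ptInf_eq]; exact (hp_eq_iff _ _).2 ⟨w, rfl⟩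
  have e2 : hp (w • e₁) hv' = pt 0 0 := by rw [pt_zero_eq]; exact (hp_eq_iff _ _).2 ⟨w, rfl⟩
  obtain ⟨R, h0, h1⟩ := exists_mobius_basis hv hv' (by rw [e1, e2]; exact (pt_ne_ptInf 0 0).symm)
  refine ⟨R * T, ν, ?_, ?_, ?_, ?_⟩
  · rw [mul_smul, ha]
    conv_rhs => rw [← e2]
    rw [pt_zero_eq, mobius_smul_hp]
    exact hp_congr h1
  · rw [mul_smul, hb, pt, mobius_smul_hp, hp_eq_iff]
    refine ⟨w, ?_⟩
    rw [mobius_smul_eq, h0, h1]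
    funext i
    fin_cases i <;> simp [quat_one, e₀, e₁]
  · rw [mul_smul, hc]
    conv_rhs => rw [← e1]
    rw [ptInf_eq, mobius_smul_hp]
    exact hp_congr h0
  · rw [mul_smul, huv, pt, pt, mobius_smul_hp, hp_eq_iff]
    refine ⟨w, ?_⟩
    rw [mobius_smul_eq, h0, h1]
    funext i
    fin_cases i <;> simp [quat_one, e₀, e₁, hν]

/-! ### The standard sphere and its circles -/

/-- Hermitian matrices with complex entries. -/
def stdHerm : Submodule ℝ (ℍ × ℝ × ℝ) where
  carrier := {n | n.1.imJ = 0 ∧ n.1.imK = 0}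
  add_mem' := by
    rintro a b ⟨ha, ha'⟩ ⟨hb, hb'⟩
    exact ⟨by simp [ha, hb], by simp [ha', hb']⟩
  zero_mem' := by simp
  smul_mem' := by
    rintro c a ⟨ha, ha'⟩
    exact ⟨by simp [ha], by simp [ha']⟩

lemma mem_stdHerm {n : ℍ × ℝ × ℝ} : n ∈ stdHerm ↔ n.1.imJ = 0 ∧ n.1.imK = 0 := Iff.rfl

lemma finrank_stdHerm : Module.finrank ℝ stdHerm = 4 := by
  let e : stdHerm ≃ₗ[ℝ] ℂ × ℝ × ℝ :=
    { toFun := fun x => (⟨x.1.1.re, x.1.1.imI⟩, x.1.2)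
      invFun := fun x => ⟨(quat x.1 0, x.2), by simp [mem_stdHerm]⟩
      map_add' := fun _ _ => rfl
      map_smul' := fun c x => by
        apply Prod.ext
        · apply Complex.ext <;> simp
        · rfl
      left_inv := by
        rintro ⟨⟨q, r⟩, h⟩
        apply Subtype.ext
        apply Prod.ext
        · ext
          · simp
          · simp
          · simpa using h.1.symm
          · simpa using h.2.symm
        · rfl
      right_inv := by
        rintro ⟨x, r⟩
        apply Prod.ext
        · apply Complex.ext <;> simp
        · rfl }
  rw [e.finrank_eq, Module.finrank_prod, Module.finrank_prod, Module.finrank_self,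
    Complex.finrank_real_complex]

/-- The complex projective line in the 4-sphere. -/
def stdSphere : Set HP1 := hermSet stdHerm

lemma pt_mem_hermSet {u v : ℂ} {V : Submodule ℝ (ℍ × ℝ × ℝ)} : pt u v ∈ hermSet V ↔
    (quat (conj u) (-v), Complex.normSq u + Complex.normSq v, (1 : ℝ)) ∈ V := by
  rw [pt, hp_mem_hermSet, hermVec_vec, star_quat, normSq_quat, quat_one, mul_one, map_one]

lemma ptInf_mem_hermSet {V : Submodule ℝ (ℍ × ℝ × ℝ)} :
    ptInf ∈ hermSet V ↔ ((0 : ℍ), (1 : ℝ), (0 : ℝ)) ∈ V := by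
  rw [ptInf, hp_mem_hermSet, hermVec_vec, quat_one, quat_zero, map_one, map_zero, mul_zero]

lemma pt_mem_stdSphere {u v : ℂ} : pt u v ∈ stdSphere ↔ v = 0 := by
  rw [stdSphere, pt_mem_hermSet, mem_stdHerm, Complex.ext_iff]
  simp

lemma ptInf_mem_stdSphere : ptInf ∈ stdSphere := by
  rw [stdSphere, ptInf_mem_hermSet, mem_stdHerm]
  simp

lemma isRoundSphere_stdSphere : IsRoundSphere 2 stdSphere :=
  isRoundSphere_iff.2 ⟨⟨pt 0 0, pt_mem_stdSphere.2 rfl, ptInf, ptInf_mem_stdSphere,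
    pt_ne_ptInf 0 0⟩, stdHerm, finrank_stdHerm, rfl⟩

lemma std_mem_of_mem_hermSet {V : Submodule ℝ (ℍ × ℝ × ℝ)} (h0 : pt 0 0 ∈ hermSet V)
    (h1 : pt 1 0 ∈ hermSet V) (hI : ptInf ∈ hermSet V) :
    ((0 : ℍ), (1 : ℝ), (0 : ℝ)) ∈ V ∧ ((0 : ℍ), (0 : ℝ), (1 : ℝ)) ∈ V ∧
      ((1 : ℍ), (0 : ℝ), (0 : ℝ)) ∈ V := by
  rw [pt_mem_hermSet] at h0 h1
  rw [ptInf_mem_hermSet] at hI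
  simp [quat_zero, quat_one] at h0 h1
  refine ⟨hI, h0, ?_⟩
  convert V.sub_mem (V.sub_mem h1 h0) hI using 1
  simp

/-- The circle through `0`, `1`, `∞` is the real line. -/
lemma real_of_circle {C : Set HP1} (hC : IsRoundSphere 1 C) (h0 : pt 0 0 ∈ C) (h1 : pt 1 0 ∈ C)
    (hI : ptInf ∈ C) {u v : ℂ} (h : pt u v ∈ C) : u.im = 0 ∧ v = 0 := by
  obtain ⟨-, V, hV, rfl⟩ := isRoundSphere_iff.1 hC
  obtain ⟨m1, m2, m3⟩ := std_mem_of_mem_hermSet h0 h1 hI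
  let f : (ℝ × ℝ × ℝ) →ₗ[ℝ] (ℍ × ℝ × ℝ) :=
    LinearMap.prodMap (Algebra.linearMap ℝ ℍ) LinearMap.id
  have hf : Function.Injective f := by
    rintro ⟨a, r⟩ ⟨b, s⟩ hab
    obtain ⟨h1, h2⟩ := Prod.ext_iff.1 hab
    exact Prod.ext (Quaternion.coe_injective h1) h2
  have hle : LinearMap.range f ≤ V := by
    rintro _ ⟨⟨a, r, s⟩, rfl⟩
    have e : f (a, r, s) = a • ((1 : ℍ), (0 : ℝ), (0 : ℝ)) + r • ((0 : ℍ), (1 : ℝ), (0 : ℝ)) +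
        s • ((0 : ℍ), (0 : ℝ), (1 : ℝ)) := by
      simp [f, Algebra.algebraMap_eq_smul_one]
    rw [e]
    exact V.add_mem (V.add_mem (V.smul_mem _ m3) (V.smul_mem _ m1)) (V.smul_mem _ m2)
  have hVf : LinearMap.range f = V := Submodule.eq_of_le_of_finrank_eq hle (by
    rw [LinearMap.finrank_range_of_inj hf, hV]
    simp)
  rw [pt_mem_hermSet, ← hVf] at h
  obtain ⟨⟨a, r⟩, h⟩ := h
  have h' : (a : ℍ) = quat (conj u) (-v) := (Prod.ext_iff.1 h).1
  have e1 := congrArg (fun p : ℍ => p.imI) h'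
  have e2 := congrArg (fun p : ℍ => p.imJ) h'
  have e3 := congrArg (fun p : ℍ => p.imK) h'
  simp at e1 e2 e3
  exact ⟨e1, Complex.ext e2 e3⟩

/-- A round 2-sphere is determined by four points on it that are not concyclic. -/
lemma eq_stdSphere {S : Set HP1} (hS : IsRoundSphere 2 S) (h0 : pt 0 0 ∈ S) (h1 : pt 1 0 ∈ S)
    (hI : ptInf ∈ S) {l : ℂ} (h : pt l 0 ∈ S) (hl : l.im ≠ 0) : S = stdSphere := by
  obtain ⟨-, V, hV, rfl⟩ := isRoundSphere_iff.1 hS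
  obtain ⟨m1, m2, m3⟩ := std_mem_of_mem_hermSet h0 h1 hI
  rw [pt_mem_hermSet] at h
  have hle : stdHerm ≤ V := by
    rintro ⟨w, r, s⟩ ⟨hJ, hK⟩
    have e : (w, r, s) = (-(w.imI / l.im)) • (quat (conj l) (-0),
          Complex.normSq l + Complex.normSq 0, (1 : ℝ)) +
        (w.re + w.imI / l.im * l.re) • ((1 : ℍ), (0 : ℝ), (0 : ℝ)) +
        (r + w.imI / l.im * Complex.normSq l) • ((0 : ℍ), (1 : ℝ), (0 : ℝ)) +
        (s + w.imI / l.im) • ((0 : ℍ), (0 : ℝ), (1 : ℝ)) := by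
      apply Prod.ext
      · ext
        · simp
        · simp [hl]
        · simpa using hJ
        · simpa using hK
      · apply Prod.ext <;> simp
    rw [e]
    exact V.add_mem (V.add_mem (V.add_mem (V.smul_mem _ h) (V.smul_mem _ m3))
      (V.smul_mem _ m1)) (V.smul_mem _ m2)
  rw [stdSphere, Submodule.eq_of_le_of_finrank_eq hle (by rw [finrank_stdHerm, hV])]

/-- The value of a complex `(1, 1)`-form on a Hermitian matrix, of whose entry `conj v₀ v₁` only the
complex part is used. -/
noncomputable def formMap (m₀₀ m₁₀ m₀₁ m₁₁ : ℂ) : (ℍ × ℝ × ℝ) →ₗ[ℝ] ℂ where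
  toFun n := m₀₀ * n.2.1 + m₁₀ * ⟨n.1.re, -n.1.imI⟩ + m₀₁ * ⟨n.1.re, n.1.imI⟩ + m₁₁ * n.2.2
  map_add' a b := by
    apply Complex.ext <;> simp <;> ring
  map_smul' c a := by
    apply Complex.ext <;> simp <;> ring

/-- If a non-zero functional on the complex Hermitian matrices vanishes at a set of points of the
standard sphere, then these points are concyclic. -/
lemma exists_circle_of_functional {A : Set HP1} (hA : A.Nontrivial) (hAS : A ⊆ stdSphere)
    (φ : (ℍ × ℝ × ℝ) →ₗ[ℝ] ℝ) {n : ℍ × ℝ × ℝ} (hn : n ∈ stdHerm) (hφ : φ n ≠ 0)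
    (h : ∀ v hv, hp v hv ∈ A → φ (hermVec v) = 0) : ∃ C, IsRoundSphere 1 C ∧ A ⊆ C := by
  set ψ := φ.domRestrict stdHerm
  have hsub : A ⊆ hermSet ((LinearMap.ker ψ).map stdHerm.subtype) := by
    intro q hq
    obtain ⟨v, hv, rfl⟩ := HP1.exists_rep q
    rw [hp_mem_hermSet]
    exact ⟨⟨hermVec v, hp_mem_hermSet.1 (hAS hq)⟩, h v hv hq, rfl⟩
  refine ⟨_, isRoundSphere_iff.2 ⟨hA.mono hsub, _, ?_, rfl⟩, hsub⟩
  rw [Submodule.finrank_map_subtype_eq]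
  have hr : LinearMap.range ψ = ⊤ := LinearMap.range_eq_top.2
    (LinearMap.surjective_of_ne_zero fun h0 => hφ (LinearMap.congr_fun h0 ⟨n, hn⟩))
  have := LinearMap.finrank_range_add_finrank_ker ψ
  rw [hr, finrank_top, Module.finrank_self, finrank_stdHerm] at this
  omega

/-- Points `[x₀, x₁]` of the standard sphere at which a non-zero `(1, 1)`-form in `x` and `conj x`
vanishes are concyclic. -/
lemma exists_circle_of_form {A : Set HP1} (hA : A.Nontrivial) {m₀₀ m₁₀ m₀₁ m₁₁ : ℂ}
    (hm : ¬ (m₀₀ = 0 ∧ m₁₀ = 0 ∧ m₀₁ = 0 ∧ m₁₁ = 0)) (hAS : A ⊆ stdSphere)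
    (hI : ptInf ∈ A → m₀₀ = 0)
    (h : ∀ ν, pt ν 0 ∈ A → m₀₀ * ν * conj ν + m₁₀ * ν + m₀₁ * conj ν + m₁₁ = 0) :
    ∃ C, IsRoundSphere 1 C ∧ A ⊆ C := by
  have key : ∀ v hv, hp v hv ∈ A → formMap m₀₀ m₁₀ m₀₁ m₁₁ (hermVec v) = 0 := by
    intro v hv hvA
    have hcase : ∃ w hw, ∃ a : ℍ, hp v hv = hp w hw ∧ a • w = v ∧
        formMap m₀₀ m₁₀ m₀₁ m₁₁ (hermVec w) = 0 := by
      rcases eq_pt_or_eq_ptInf (hp v hv) with ⟨u, t, h1⟩ | h1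
      · have h2 := hAS hvA
        rw [h1, pt_mem_stdSphere] at h2
        subst h2
        obtain ⟨a, ha⟩ := (hp_eq_iff _ _).1 h1
        refine ⟨_, _, a, h1, ha, ?_⟩
        have e : hermVec ![quat u 0, quat 1 0] = (quat (conj u) 0, Complex.normSq u, (1 : ℝ)) := by
          rw [hermVec_vec, star_quat, normSq_quat, quat_one, mul_one, map_one, neg_zero,
            map_zero, add_zero]
        have e2 : (⟨u.re, u.im⟩ : ℂ) = u := rfl
        have e3 : (⟨u.re, -u.im⟩ : ℂ) = conj u := rfl
        refine Eq.trans ?_ (h u (h1 ▸ hvA))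
        rw [e]
        simp [formMap, e2, e3, ← Complex.mul_conj, mul_assoc]
      · obtain ⟨a, ha⟩ := (hp_eq_iff _ _).1 h1
        refine ⟨_, _, a, h1, ha, ?_⟩
        have h0 : m₀₀ = 0 := hI (h1 ▸ hvA)
        have e : (⟨0, 0⟩ : ℂ) = 0 := rfl
        simp [formMap, hermVec_vec, quat_one, quat_zero, h0, e]
    obtain ⟨w, hw, a, -, rfl, h0⟩ := hcase
    rw [hermVec_smul, map_smul, h0, smul_zero]
  by_contra hno
  -- otherwise the real and the imaginary part of the form vanish on all complex matrices
  have hz : ∀ n ∈ stdHerm, formMap m₀₀ m₁₀ m₀₁ m₁₁ n = 0 := by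
    intro n hn
    by_contra h0
    apply hno
    by_cases h1 : (formMap m₀₀ m₁₀ m₀₁ m₁₁ n).re = 0
    · refine exists_circle_of_functional hA hAS (Complex.imLm ∘ₗ formMap m₀₀ m₁₀ m₀₁ m₁₁) hn
        (fun h2 => h0 (Complex.ext h1 h2)) fun v hv hvA => ?_
      simp [key v hv hvA]
    · refine exists_circle_of_functional hA hAS (Complex.reLm ∘ₗ formMap m₀₀ m₁₀ m₀₁ m₁₁) hn h1
        fun v hv hvA => ?_
      simp [key v hv hvA]
  apply hm
  have g1 := hz (0, 1, 0) (by simp [mem_stdHerm])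
  have g2 := hz (0, 0, 1) (by simp [mem_stdHerm])
  have g3 := hz (quat 1 0, 0, 0) (by simp [mem_stdHerm])
  have g4 := hz (quat Complex.I 0, 0, 0) (by simp [mem_stdHerm])
  have e : (⟨0, 0⟩ : ℂ) = 0 := rfl
  have e' : (⟨1, 0⟩ : ℂ) = 1 := rfl
  have e2 : (⟨0, 1⟩ : ℂ) = Complex.I := rfl
  have e3 : (⟨0, -1⟩ : ℂ) = -Complex.I := by apply Complex.ext <;> simp
  simp [formMap, e, e', e2, e3] at g1 g2 g3 g4
  have g5 : m₀₁ - m₁₀ = 0 := by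
    have : Complex.I * (m₀₁ - m₁₀) = 0 := by linear_combination g4
    exact (mul_eq_zero.1 this).resolve_left Complex.I_ne_zero
  exact ⟨g1, by linear_combination (g3 - g5) / 2, by linear_combination (g3 + g5) / 2, g2⟩

/-- The five points `0, 1, λ, μ, ∞` of the standard sphere. -/
noncomputable def stdPts (l m : ℂ) : Fin 5 → HP1 := ![pt 0 0, pt 1 0, pt l 0, pt m 0, ptInf]

/-- `0, 1, λ, μ, ∞` are distinct, and no four of them are concyclic. -/
structure IsPentad (l m : ℂ) : Prop where
  injective : Function.Injective (stdPts l m)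
  noFour : NoFourConcyclic (Set.range (stdPts l m))

lemma stdPts_mem_stdSphere (l m : ℂ) (i : Fin 5) : stdPts l m i ∈ stdSphere := by
  fin_cases i
  · exact pt_mem_stdSphere.2 rfl
  · exact pt_mem_stdSphere.2 rfl
  · exact pt_mem_stdSphere.2 rfl
  · exact pt_mem_stdSphere.2 rfl
  · exact ptInf_mem_stdSphere

/-- The values of a `(1, 1)`-form at the five standard points; at `∞` this is the leading
coefficient. -/
noncomputable def formVal (l m m₀₀ m₁₀ m₀₁ m₁₁ : ℂ) : Fin 5 → ℂ :=
  ![m₁₁, m₀₀ + m₁₀ + m₀₁ + m₁₁, m₀₀ * l * conj l + m₁₀ * l + m₀₁ * conj l + m₁₁,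
    m₀₀ * m * conj m + m₁₀ * m + m₀₁ * conj m + m₁₁, m₀₀]

/-- A `(1, 1)`-form that vanishes at four of five points, no four of which are concyclic, is
zero. -/
lemma IsPentad.form_eq_zero {l m : ℂ} (hp : IsPentad l m) {m₀₀ m₁₀ m₀₁ m₁₁ : ℂ} (k : Fin 5)
    (h : ∀ i, i ≠ k → formVal l m m₀₀ m₁₀ m₀₁ m₁₁ i = 0) :
    m₀₀ = 0 ∧ m₁₀ = 0 ∧ m₀₁ = 0 ∧ m₁₁ = 0 := by
  by_contra hm
  have hc : (stdPts l m '' {k}ᶜ).ncard = 4 := by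
    rw [Set.ncard_image_of_injective _ hp.injective, Set.ncard_compl]
    simp
  refine hp.noFour (stdPts l m '' {k}ᶜ) (Set.image_subset_range _ _) hc ?_
  refine exists_circle_of_form ?_ hm ?_ ?_ ?_
  · rw [← Set.one_lt_ncard_iff_nontrivial, hc]
    norm_num
  · rintro _ ⟨i, -, rfl⟩
    exact stdPts_mem_stdSphere l m i
  · rintro ⟨i, hi, h'⟩
    have := h i hi
    fin_cases i
    · exact absurd h' (pt_ne_ptInf _ _)
    · exact absurd h' (pt_ne_ptInf _ _)
    · exact absurd h' (pt_ne_ptInf _ _)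
    · exact absurd h' (pt_ne_ptInf _ _)
    · exact this
  · rintro ν ⟨i, hi, h'⟩
    have := h i hi
    fin_cases i
    · obtain rfl := (pt_inj.1 h').1
      simpa [formVal] using this
    · obtain rfl := (pt_inj.1 h').1
      simpa [formVal] using this
    · obtain rfl := (pt_inj.1 h').1
      simpa [formVal] using this
    · obtain rfl := (pt_inj.1 h').1
      simpa [formVal] using this
    · exact absurd h'.symm (pt_ne_ptInf _ _)

open MvPolynomial (eval pderiv C X)

/-! ### Cubic forms in four variables -/

lemma prod_fin_four {f : Fin 4 → ℂ} : ∏ i, f i = f 0 * f 1 * f 2 * f 3 := Fin.prod_univ_four f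

/-- A cubic form in four variables is determined by twenty coefficients. -/
lemma exists_coeffs {F : MvPolynomial (Fin 4) ℂ} (hF : F.IsHomogeneous 3) :
    ∃ k : (Fin 4 → ℕ) → ℂ, ∀ z, eval z F =
      k ![3, 0, 0, 0] * z 0 ^ 3 + k ![0, 3, 0, 0] * z 1 ^ 3 +
      k ![0, 0, 3, 0] * z 2 ^ 3 + k ![0, 0, 0, 3] * z 3 ^ 3 +
      k ![2, 1, 0, 0] * z 0 ^ 2 * z 1 + k ![2, 0, 1, 0] * z 0 ^ 2 * z 2 +
      k ![2, 0, 0, 1] * z 0 ^ 2 * z 3 + k ![1, 2, 0, 0] * z 0 * z 1 ^ 2 +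
      k ![0, 2, 1, 0] * z 1 ^ 2 * z 2 + k ![0, 2, 0, 1] * z 1 ^ 2 * z 3 +
      k ![1, 0, 2, 0] * z 0 * z 2 ^ 2 + k ![0, 1, 2, 0] * z 1 * z 2 ^ 2 +
      k ![0, 0, 2, 1] * z 2 ^ 2 * z 3 + k ![1, 0, 0, 2] * z 0 * z 3 ^ 2 +
      k ![0, 1, 0, 2] * z 1 * z 3 ^ 2 + k ![0, 0, 1, 2] * z 2 * z 3 ^ 2 +
      k ![1, 1, 1, 0] * z 0 * z 1 * z 2 + k ![1, 1, 0, 1] * z 0 * z 1 * z 3 +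
      k ![1, 0, 1, 1] * z 0 * z 2 * z 3 + k ![0, 1, 1, 1] * z 1 * z 2 * z 3 := by
  refine ⟨fun t => F.coeff (Finsupp.equivFunOnFinite.symm t), fun z => ?_⟩
  have hsub : F.support ⊆ (Finset.Nat.antidiagonalTuple 4 3).map
      Finsupp.equivFunOnFinite.symm.toEmbedding := by
    intro d hd
    rw [Finset.mem_map_equiv, Finset.Nat.mem_antidiagonalTuple]
    have := hF (MvPolynomial.mem_support_iff.1 hd)
    rw [Finsupp.weight_apply, Finsupp.sum_fintype _ _ (by simp)] at this
    simpa using this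
  have e : Finset.Nat.antidiagonalTuple 4 3 = {![3, 0, 0, 0], ![0, 3, 0, 0], ![0, 0, 3, 0],
    ![0, 0, 0, 3], ![2, 1, 0, 0], ![2, 0, 1, 0], ![2, 0, 0, 1], ![1, 2, 0, 0], ![0, 2, 1, 0],
    ![0, 2, 0, 1], ![1, 0, 2, 0], ![0, 1, 2, 0], ![0, 0, 2, 1], ![1, 0, 0, 2], ![0, 1, 0, 2],
    ![0, 0, 1, 2], ![1, 1, 1, 0], ![1, 1, 0, 1], ![1, 0, 1, 1], ![0, 1, 1, 1]} := by decide
  rw [MvPolynomial.eval_eq', Finset.sum_subset hsub (fun d _ hd => by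
    rw [MvPolynomial.notMem_support_iff.1 hd, zero_mul]), Finset.sum_map, e]
  repeat rw [Finset.sum_insert (by decide)]
  rw [Finset.sum_singleton]
  simp [prod_fin_four]
  ring

lemma eval_smul_cubic {F : MvPolynomial (Fin 4) ℂ} (hF : F.IsHomogeneous 3) (c : ℂ)
    (z : Fin 4 → ℂ) : eval (c • z) F = c ^ 3 * eval z F := by
  obtain ⟨k, hk⟩ := exists_coeffs hF
  rw [hk, hk]
  simp only [Pi.smul_apply, smul_eq_mul]
  ring

lemma mk_mem_zeroLocus {F : MvPolynomial (Fin 4) ℂ} (hF : F.IsHomogeneous 3) {z : Fin 4 → ℂ}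
    {hz : z ≠ 0} : Projectivization.mk ℂ z hz ∈ zeroLocus F ↔ eval z F = 0 := by
  change (∀ w ∈ (Projectivization.mk ℂ z hz).submodule, eval w F = 0) ↔ _
  rw [Projectivization.submodule_mk]
  constructor
  · exact fun h => h z (Submodule.mem_span_singleton_self z)
  · intro h w hw
    obtain ⟨c, rfl⟩ := Submodule.mem_span_singleton.1 hw
    rw [eval_smul_cubic hF, h, mul_zero]

lemma eval_zero_cubic {F : MvPolynomial (Fin 4) ℂ} (hF : F.IsHomogeneous 3) : eval 0 F = 0 := by
  simpa using eval_smul_cubic hF 0 0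

lemma twistorLine_pt_subset {F : MvPolynomial (Fin 4) ℂ} (hF : F.IsHomogeneous 3) {u v : ℂ} :
    twistorLine (pt u v) ⊆ zeroLocus F ↔
      ∀ s t, eval ![s * u - t * conj v, s * v + t * conj u, s, t] F = 0 := by
  constructor
  · intro h s t
    by_cases h0 : (![s * u - t * conj v, s * v + t * conj u, s, t] : Fin 4 → ℂ) = 0
    · rw [h0, eval_zero_cubic hF]
    · rw [← mk_mem_zeroLocus hF (hz := h0)]
      exact h (mem_twistorLine_pt.2 ⟨rfl, rfl⟩)
  · intro h x hx
    obtain ⟨z, hz, rfl⟩ := CP3.exists_rep x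
    obtain ⟨h0, h1⟩ := mem_twistorLine_pt.1 hx
    rw [mk_mem_zeroLocus hF, ← h (z 2) (z 3)]
    congr 2
    funext i
    fin_cases i
    · exact h0
    · exact h1
    · rfl
    · rfl

lemma twistorLine_ptInf_subset {F : MvPolynomial (Fin 4) ℂ} (hF : F.IsHomogeneous 3) :
    twistorLine ptInf ⊆ zeroLocus F ↔ ∀ s t, eval ![s, t, 0, 0] F = 0 := by
  constructor
  · intro h s t
    by_cases h0 : (![s, t, 0, 0] : Fin 4 → ℂ) = 0
    · rw [h0, eval_zero_cubic hF]
    · rw [← mk_mem_zeroLocus hF (hz := h0)]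
      exact h (mem_twistorLine_ptInf.2 ⟨rfl, rfl⟩)
  · intro h x hx
    obtain ⟨z, hz, rfl⟩ := CP3.exists_rep x
    obtain ⟨h0, h1⟩ := mem_twistorLine_ptInf.1 hx
    rw [mk_mem_zeroLocus hF, ← h (z 0) (z 1)]
    congr 2
    funext i
    fin_cases i
    · rfl
    · rfl
    · exact h0
    · exact h1

/-! ### Linear substitutions and singular points -/

/-- The form `F ∘ g`. -/
noncomputable def pullback (g : ProjGroup) (F : MvPolynomial (Fin 4) ℂ) :
    MvPolynomial (Fin 4) ℂ :=
  MvPolynomial.bind₁ (fun i => ∑ j, C ((g • (Pi.single j 1 : Fin 4 → ℂ)) i) * X j) F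

lemma eval_pullback (g : ProjGroup) (F : MvPolynomial (Fin 4) ℂ) (z : Fin 4 → ℂ) :
    eval z (pullback g F) = eval (g • z) F := by
  have h : ∀ i, (g • z) i = ∑ j, (g • (Pi.single j 1 : Fin 4 → ℂ)) i * z j := fun i => by
    have hz : z = ∑ j, z j • (Pi.single j 1 : Fin 4 → ℂ) := by
      funext i; simp [Finset.sum_apply, Pi.single_apply]
    conv_lhs => rw [hz, Finset.smul_sum]
    rw [Finset.sum_apply]
    refine Finset.sum_congr rfl fun j _ => ?_
    rw [gl_smul_smul, Pi.smul_apply, smul_eq_mul, mul_comm]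
  rw [pullback, MvPolynomial.eval, MvPolynomial.eval₂Hom_bind₁]
  congr 2
  funext i
  rw [h]
  simp

lemma isHomogeneous_pullback {F : MvPolynomial (Fin 4) ℂ} (hF : F.IsHomogeneous 3)
    (g : ProjGroup) : (pullback g F).IsHomogeneous 3 := by
  have := hF.aeval (fun i => ∑ j, C ((g • (Pi.single j 1 : Fin 4 → ℂ)) i) * X j) (n := 1)
    fun i => MvPolynomial.IsHomogeneous.sum _ _ _ fun j _ => by
      simpa using (MvPolynomial.isHomogeneous_C _ _).mul (MvPolynomial.isHomogeneous_X ℂ j)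
  rwa [one_mul] at this

lemma transform_zeroLocus {F G : MvPolynomial (Fin 4) ℂ} (hF : F.IsHomogeneous 3)
    (hG : G.IsHomogeneous 3) {g : ProjGroup} (h : ∀ z, eval (g • z) G = 0 ↔ eval z F = 0) :
    transform g (zeroLocus F) = zeroLocus G := by
  ext x
  obtain ⟨z, hz, rfl⟩ := CP3.exists_rep x
  rw [mem_transform, gl_smul_mk, mk_mem_zeroLocus hF, mk_mem_zeroLocus hG, ← h, smul_inv_smul]

lemma transform_zeroLocus_pullback {F : MvPolynomial (Fin 4) ℂ} (hF : F.IsHomogeneous 3)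
    (g : ProjGroup) : transform g (zeroLocus (pullback g F)) = zeroLocus F :=
  transform_zeroLocus (isHomogeneous_pullback hF g) hF fun z => by rw [eval_pullback]

/-- The chain rule along lines, used to relate the gradients of `F` and `F ∘ g`. -/
lemma hasDerivAt_eval (F : MvPolynomial (Fin 4) ℂ) (z w : Fin 4 → ℂ) :
    HasDerivAt (fun t : ℂ => eval (z + t • w) F) (∑ i, w i * eval z (pderiv i F)) 0 := by
  induction F using MvPolynomial.induction_on with
  | C a => simpa using hasDerivAt_const (0 : ℂ) a
  | add p q hp hq =>
    have e : (fun t : ℂ => eval (z + t • w) (p + q)) =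
        (fun t : ℂ => eval (z + t • w) p) + fun t : ℂ => eval (z + t • w) q := by
      funext t; simp
    rw [e]
    exact (hp.add hq).congr_deriv (by simp [mul_add, Finset.sum_add_distrib])
  | mul_X p n hp =>
    have h1 : HasDerivAt (fun t : ℂ => z n + t * w n) (w n) 0 := by
      simpa using ((hasDerivAt_id (0 : ℂ)).mul_const (w n)).const_add (z n)
    have e : (fun t : ℂ => eval (z + t • w) (p * X n)) =
        (fun t : ℂ => eval (z + t • w) p) * fun t : ℂ => z n + t * w n := by
      funext t; simp
    rw [e]
    refine (hp.mul h1).congr_deriv ?_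
    simp only [zero_smul, add_zero, zero_mul, Derivation.leibniz, MvPolynomial.pderiv_X,
      smul_eq_mul, map_add, map_mul, MvPolynomial.eval_X, mul_add, Finset.sum_add_distrib,
      Finset.sum_mul]
    rw [add_comm]
    congr 1
    · rw [Finset.sum_eq_single n]
      · simp; ring
      · intro i _ hi
        simp [Pi.single_eq_of_ne hi.symm]
      · simp
    · exact Finset.sum_congr rfl fun i _ => by ring

/-- The singular points of the affine cone `F = 0`. -/
def SingAt (F : MvPolynomial (Fin 4) ℂ) (z : Fin 4 → ℂ) : Prop :=
  eval z F = 0 ∧ ∀ i, eval z (pderiv i F) = 0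

lemma isNonsingularForm_iff {F : MvPolynomial (Fin 4) ℂ} :
    IsNonsingularForm F ↔ F.IsHomogeneous 3 ∧ ∀ z, z ≠ 0 → ¬ SingAt F z := by
  simp [IsNonsingularForm, SingAt]

lemma SingAt.of_pullback {g : ProjGroup} {F : MvPolynomial (Fin 4) ℂ} {z : Fin 4 → ℂ}
    (h : SingAt (pullback g F) z) : SingAt F (g • z) := by
  refine ⟨by rw [← eval_pullback, h.1], fun i => ?_⟩
  have h1 := hasDerivAt_eval F (g • z) (Pi.single i 1)
  have h2 := hasDerivAt_eval (pullback g F) z (g⁻¹ • Pi.single i 1)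
  have e : (fun t : ℂ => eval (z + t • g⁻¹ • (Pi.single i 1 : Fin 4 → ℂ)) (pullback g F)) =
      fun t : ℂ => eval (g • z + t • (Pi.single i 1 : Fin 4 → ℂ)) F := by
    funext t
    rw [eval_pullback, gl_smul_add, gl_smul_smul, smul_inv_smul]
  rw [e] at h2
  have := h1.unique h2
  simpa [h.2, Pi.single_apply] using this

lemma pullback_pullback (g h : ProjGroup) (F : MvPolynomial (Fin 4) ℂ) :
    pullback g (pullback h F) = pullback (h * g) F :=
  MvPolynomial.funext fun z => by simp only [eval_pullback, mul_smul]

@[simp] lemma pullback_one (F : MvPolynomial (Fin 4) ℂ) : pullback 1 F = F :=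
  MvPolynomial.funext fun z => by simp only [eval_pullback, one_smul]

lemma singAt_pullback {g : ProjGroup} {F : MvPolynomial (Fin 4) ℂ} {z : Fin 4 → ℂ} :
    SingAt (pullback g F) z ↔ SingAt F (g • z) := by
  refine ⟨SingAt.of_pullback, fun h => ?_⟩
  have : SingAt (pullback g⁻¹ (pullback g F)) (g • z) := by
    rw [pullback_pullback]
    simpa using h
  simpa using this.of_pullback

lemma isNonsingularForm_pullback {F : MvPolynomial (Fin 4) ℂ} (hF : IsNonsingularForm F)
    (g : ProjGroup) : IsNonsingularForm (pullback g F) := by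
  rw [isNonsingularForm_iff] at hF ⊢
  refine ⟨isHomogeneous_pullback hF.1 g, fun z hz h => ?_⟩
  exact hF.2 _ (gl_smul_ne_zero g hz) (singAt_pullback.1 h)

lemma IsNonsingularCubic.transform {Y : Set CP3} (h : IsNonsingularCubic Y) (g : ProjGroup) :
    IsNonsingularCubic (transform g Y) := by
  obtain ⟨F, hF, rfl⟩ := h
  refine ⟨pullback g⁻¹ F, isNonsingularForm_pullback hF _, ?_⟩
  rw [← transform_zeroLocus_pullback (isHomogeneous_pullback hF.1 g⁻¹) g, pullback_pullback]
  simp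

/-! ### Transport of cubic surfaces by Möbius transformations -/

lemma Lifts.mem_twistorPoints {g : ProjGroup} {T : MobiusGroup} (h : Lifts g T) {Y : Set CP3}
    {q : HP1} : T • q ∈ twistorPoints (transform g Y) ↔ q ∈ twistorPoints Y := by
  change twistorLine (T • q) ⊆ transform g Y ↔ twistorLine q ⊆ Y
  rw [← h.transform_twistorLine, transform_mono]

lemma Lifts.twistorPoints_transform {g : ProjGroup} {T : MobiusGroup} (h : Lifts g T)
    (Y : Set CP3) : twistorPoints (transform g Y) = (fun q => T • q) '' twistorPoints Y := by
  ext q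
  constructor
  · intro hq
    refine ⟨T⁻¹ • q, ?_, smul_inv_smul _ _⟩
    rw [← h.mem_twistorPoints, smul_inv_smul]
    exact hq
  · rintro ⟨p, hp, rfl⟩
    exact h.mem_twistorPoints.2 hp

lemma Lifts.transform_mem_cubicsOver {g : ProjGroup} {T : MobiusGroup} (h : Lifts g T)
    {Y : Set CP3} {P : Set HP1} (hY : Y ∈ cubicsOver P) :
    TwistorCubic.transform g Y ∈ cubicsOver ((fun q => T • q) '' P) := by
  refine ⟨hY.1.transform g, ?_⟩
  rw [h.twistorPoints_transform]
  exact Set.image_mono hY.2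

lemma Lifts.transform_mem_cubicsOver_iff {g : ProjGroup} {T : MobiusGroup} (h : Lifts g T)
    {Y : Set CP3} {P : Set HP1} :
    TwistorCubic.transform g Y ∈ cubicsOver ((fun q => T • q) '' P) ↔ Y ∈ cubicsOver P := by
  refine ⟨fun hY => ?_, h.transform_mem_cubicsOver⟩
  have := h.inv.transform_mem_cubicsOver hY
  rwa [transform_inv_transform, image_inv_image] at this

/-! ### The pencil of cubic forms over five points -/

/-- The form of bidegree `(2, 1)` in `x = (z₁, z₃)` and `y = (z₂, z₄)`, normalized to have
coefficient 1 at `z₁² z₄`, without terms `z₁² z₂` and `z₃² z₄`. -/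
noncomputable def cubicForm (b c d : ℂ) : MvPolynomial (Fin 4) ℂ :=
  X 0 ^ 2 * X 3 + C b * X 0 * X 1 * X 2 + C c * X 0 * X 2 * X 3 + C d * X 1 * X 2 ^ 2

/-- The transform `z ↦ conj (F (j z))` of `cubicForm b c d`, of bidegree `(1, 2)`. -/
noncomputable def conjForm (b c d : ℂ) : MvPolynomial (Fin 4) ℂ :=
  X 1 ^ 2 * X 2 + C (conj b) * X 0 * X 1 * X 3 + C (conj c) * X 1 * X 2 * X 3 +
    C (conj d) * X 0 * X 3 ^ 2

/-- The linear combinations of `cubicForm b c d` and `conjForm b c d`. -/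
noncomputable def pencil (b c d α β : ℂ) : MvPolynomial (Fin 4) ℂ :=
  C α * cubicForm b c d + C β * conjForm b c d

lemma eval_cubicForm (b c d : ℂ) (z : Fin 4 → ℂ) : eval z (cubicForm b c d) =
    z 0 ^ 2 * z 3 + b * z 0 * z 1 * z 2 + c * z 0 * z 2 * z 3 + d * z 1 * z 2 ^ 2 := by
  simp [cubicForm]

lemma eval_conjForm (b c d : ℂ) (z : Fin 4 → ℂ) : eval z (conjForm b c d) =
    z 1 ^ 2 * z 2 + conj b * z 0 * z 1 * z 3 + conj c * z 1 * z 2 * z 3 +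
      conj d * z 0 * z 3 ^ 2 := by
  simp [conjForm]

lemma eval_pencil (b c d α β : ℂ) (z : Fin 4 → ℂ) : eval z (pencil b c d α β) =
    α * eval z (cubicForm b c d) + β * eval z (conjForm b c d) := by
  simp [pencil]

lemma conj_eval_cubicForm_jLinear (b c d : ℂ) (z : Fin 4 → ℂ) :
    conj (eval (jLinear z) (cubicForm b c d)) = eval z (conjForm b c d) := by
  rw [eval_cubicForm, eval_conjForm, jLinear_apply]
  simp
  ring

lemma conj_eval_conjForm_jLinear (b c d : ℂ) (z : Fin 4 → ℂ) :
    conj (eval (jLinear z) (conjForm b c d)) = -eval z (cubicForm b c d) := by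
  rw [eval_cubicForm, eval_conjForm, jLinear_apply]
  simp
  ring

lemma isHomogeneous_monomial (a : ℂ) (i j k : Fin 4) :
    (C a * X i * X j * X k : MvPolynomial (Fin 4) ℂ).IsHomogeneous 3 :=
  (((MvPolynomial.isHomogeneous_C _ a).mul (MvPolynomial.isHomogeneous_X ℂ i)).mul
    (MvPolynomial.isHomogeneous_X ℂ j)).mul (MvPolynomial.isHomogeneous_X ℂ k)

lemma isHomogeneous_cubicForm (b c d : ℂ) : (cubicForm b c d).IsHomogeneous 3 := by
  have := (((isHomogeneous_monomial 1 0 0 3).add (isHomogeneous_monomial b 0 1 2)).add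
    (isHomogeneous_monomial c 0 2 3)).add (isHomogeneous_monomial d 1 2 2)
  convert this using 1
  simp only [cubicForm, map_one]
  ring

lemma isHomogeneous_conjForm (b c d : ℂ) : (conjForm b c d).IsHomogeneous 3 := by
  have := (((isHomogeneous_monomial 1 1 1 2).add (isHomogeneous_monomial (conj b) 0 1 3)).add
    (isHomogeneous_monomial (conj c) 1 2 3)).add (isHomogeneous_monomial (conj d) 0 3 3)
  convert this using 1
  simp only [conjForm, map_one]
  ring

lemma isHomogeneous_pencil (b c d α β : ℂ) : (pencil b c d α β).IsHomogeneous 3 :=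
  ((isHomogeneous_cubicForm b c d).C_mul α).add ((isHomogeneous_conjForm b c d).C_mul β)

lemma eval_pderiv_pencil (b c d α β : ℂ) (z : Fin 4 → ℂ) :
    eval z (pderiv 0 (pencil b c d α β)) = α * (2 * z 0 * z 3 + b * z 1 * z 2 + c * z 2 * z 3) +
      β * (conj b * z 1 * z 3 + conj d * z 3 ^ 2) ∧
    eval z (pderiv 1 (pencil b c d α β)) = α * (b * z 0 * z 2 + d * z 2 ^ 2) +
      β * (2 * z 1 * z 2 + conj b * z 0 * z 3 + conj c * z 2 * z 3) ∧
    eval z (pderiv 2 (pencil b c d α β)) =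
      α * (b * z 0 * z 1 + c * z 0 * z 3 + 2 * d * z 1 * z 2) +
      β * (z 1 ^ 2 + conj c * z 1 * z 3) ∧
    eval z (pderiv 3 (pencil b c d α β)) = α * (z 0 ^ 2 + c * z 0 * z 2) +
      β * (conj b * z 0 * z 1 + conj c * z 1 * z 2 + 2 * conj d * z 0 * z 3) := by
  refine ⟨?_, ?_, ?_, ?_⟩
  iterate 3
    · simp [pencil, cubicForm, conjForm, MvPolynomial.pderiv_X, Derivation.leibniz,
        Derivation.leibniz_pow]
      ring
  · simp [pencil, cubicForm, conjForm, MvPolynomial.pderiv_X, Derivation.leibniz,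
      Derivation.leibniz_pow]
    left
    ring

/-! ### Points without concyclic quadruples -/

lemma IsPentad.ne {l m : ℂ} (h : IsPentad l m) :
    l ≠ 0 ∧ l ≠ 1 ∧ m ≠ 0 ∧ m ≠ 1 ∧ l ≠ m := by
  have key : ∀ i j : Fin 5, i ≠ j → stdPts l m i ≠ stdPts l m j := fun i j hij h' =>
    hij (h.injective h')
  refine ⟨?_, ?_, ?_, ?_, ?_⟩
  · rintro rfl; exact key 2 0 (by decide) rfl
  · rintro rfl; exact key 2 1 (by decide) rfl
  · rintro rfl; exact key 3 0 (by decide) rfl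
  · rintro rfl; exact key 3 1 (by decide) rfl
  · rintro rfl; exact key 2 3 (by decide) rfl

lemma IsPentad.conj_ne {l m : ℂ} (h : IsPentad l m) : conj l ≠ l := by
  intro hl
  have := h.form_eq_zero (m₀₀ := 0) (m₁₀ := 1) (m₀₁ := -1) (m₁₁ := 0) 3 (by
    intro i hi
    fin_cases i
    · simp [formVal]
    · simp [formVal]
    · simp [formVal, hl]
    · exact absurd rfl hi
    · simp [formVal])
  exact one_ne_zero this.2.1

/-- The value at `x = (ν, 1)`, `y = (conj ν, 1)` of the form of bidegree `(2, 1)` with coefficients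
`a, b, c, d` at `z₁² z₄, z₁ z₂ z₃, z₁ z₃ z₄, z₂ z₃²`, i.e. its restriction to the twistor line over
`ν`. -/
noncomputable def biVal (a b c d ν : ℂ) : ℂ := a * ν ^ 2 + b * ν * conj ν + c * ν + d * conj ν

/-- A `(2, 1)`-form `y₀ A(x) + y₁ B(x)` that vanishes at the five points is irreducible: if `A` and
`B` have a common zero then the form splits off a linear form in `x`, and the remaining
`(1, 1)`-form vanishes at four of the points, which are then concyclic. -/
lemma IsPentad.coprime {l m : ℂ} (hp : IsPentad l m) {a b c d : ℂ} (h1 : biVal a b c d 1 = 0)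
    (hl : biVal a b c d l = 0) (hm : biVal a b c d m = 0) {x₀ x₁ : ℂ} (hx : ¬ (x₀ = 0 ∧ x₁ = 0))
    (hA : x₁ * (b * x₀ + d * x₁) = 0) (hB : x₀ * (a * x₀ + c * x₁) = 0) :
    a = 0 ∧ b = 0 ∧ c = 0 ∧ d = 0 := by
  obtain ⟨l0, l1, m0, m1, lm⟩ := hp.ne
  simp only [biVal, map_one, mul_one, one_pow] at h1 hl hm
  by_cases hx1 : x₁ = 0
  · have hx0 : x₀ ≠ 0 := fun h => hx ⟨h, hx1⟩
    have ha : a = 0 := by simpa [hx1, hx0] using hB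
    subst ha
    have := hp.form_eq_zero (m₀₀ := b) (m₁₀ := c) (m₀₁ := d) (m₁₁ := 0) 4 (by
      intro i hi
      fin_cases i
      · simp [formVal]
      · simpa [formVal] using h1
      · simpa [formVal] using hl
      · simpa [formVal] using hm
      · exact absurd rfl hi)
    exact ⟨rfl, this.1, this.2.1, this.2.2.1⟩
  have hA' : b * x₀ + d * x₁ = 0 := (mul_eq_zero.1 hA).resolve_left hx1
  by_cases hx0 : x₀ = 0
  · have hd : d = 0 := by simpa [hx1, hx0] using hA'
    subst hd
    have := hp.form_eq_zero (m₀₀ := 0) (m₁₀ := a) (m₀₁ := b) (m₁₁ := c) 0 (by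
      intro i hi
      fin_cases i
      · exact absurd rfl hi
      · simpa [formVal] using h1
      · have : l * (a * l + b * conj l + c) = 0 := by linear_combination hl
        simpa [formVal] using (mul_eq_zero.1 this).resolve_left l0
      · have : m * (a * m + b * conj m + c) = 0 := by linear_combination hm
        simpa [formVal] using (mul_eq_zero.1 this).resolve_left m0
      · simp [formVal])
    exact ⟨this.2.1, this.2.2.1, this.2.2.2, rfl⟩
  have hB' : a * x₀ + c * x₁ = 0 := (mul_eq_zero.1 hB).resolve_left hx0
  obtain ⟨r, rfl⟩ : ∃ r, x₀ = r * x₁ := ⟨x₀ / x₁, by field_simp⟩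
  have hd : d = -(b * r) := by
    have : (d + b * r) * x₁ = 0 := by linear_combination hA'
    linear_combination (mul_eq_zero.1 this).resolve_right hx1
  have hc : c = -(a * r) := by
    have : (c + a * r) * x₁ = 0 := by linear_combination hB'
    linear_combination (mul_eq_zero.1 this).resolve_right hx1
  subst hd hc
  have g1 : (1 - r) * (a + b) = 0 := by linear_combination h1
  have gl : (l - r) * (a * l + b * conj l) = 0 := by linear_combination hl
  have gm : (m - r) * (a * m + b * conj m) = 0 := by linear_combination hm
  -- now the form is `(a ν + b conj ν) (ν - r)`, and at most one of the points is `r`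
  have main : ∀ k : Fin 5, (k ≠ 1 → 1 - r ≠ 0) → (k ≠ 2 → l - r ≠ 0) →
      (k ≠ 3 → m - r ≠ 0) → a = 0 ∧ b = 0 := by
    intro k k1 k2 k3
    have := hp.form_eq_zero (m₀₀ := 0) (m₁₀ := a) (m₀₁ := b) (m₁₁ := 0) k (by
      intro i hi
      fin_cases i
      · simp [formVal]
      · simpa [formVal] using (mul_eq_zero.1 g1).resolve_left (k1 hi.symm)
      · simpa [formVal] using (mul_eq_zero.1 gl).resolve_left (k2 hi.symm)
      · simpa [formVal] using (mul_eq_zero.1 gm).resolve_left (k3 hi.symm)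
      · simp [formVal])
    exact ⟨this.2.1, this.2.2.1⟩
  have hab : a = 0 ∧ b = 0 := by
    by_cases r1 : r = 1
    · subst r1
      exact main 1 (by simp) (fun _ => sub_ne_zero.2 l1) (fun _ => sub_ne_zero.2 m1)
    by_cases rl : r = l
    · subst rl
      exact main 2 (fun _ => sub_ne_zero.2 (Ne.symm r1)) (by simp)
        (fun _ => sub_ne_zero.2 (Ne.symm lm))
    · exact main 3 (fun _ => sub_ne_zero.2 (Ne.symm r1))
        (fun _ => sub_ne_zero.2 (Ne.symm rl)) (by simp)
  obtain ⟨rfl, rfl⟩ := hab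
  simp

/-- The normalized `(2, 1)`-form with coefficients `1, b, c, d` vanishes at the five points. -/
structure IsSol (l m b c d : ℂ) : Prop where
  at_one : biVal 1 b c d 1 = 0
  at_l : biVal 1 b c d l = 0
  at_m : biVal 1 b c d m = 0

lemma IsPentad.leading_ne_zero {l m : ℂ} (hp : IsPentad l m) {b c d : ℂ}
    (h1 : biVal 0 b c d 1 = 0) (hl : biVal 0 b c d l = 0) (hm : biVal 0 b c d m = 0) :
    b = 0 ∧ c = 0 ∧ d = 0 :=
  (hp.coprime h1 hl hm (x₀ := 1) (x₁ := 0) (by simp) (by simp) (by simp)).2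

lemma IsPentad.exists_sol {l m : ℂ} (hp : IsPentad l m) : ∃ b c d, IsSol l m b c d := by
  let f : (Fin 4 → ℂ) →ₗ[ℂ] (Fin 3 → ℂ) :=
    { toFun := fun v => ![biVal (v 0) (v 1) (v 2) (v 3) 1, biVal (v 0) (v 1) (v 2) (v 3) l,
        biVal (v 0) (v 1) (v 2) (v 3) m]
      map_add' := fun v w => by
        funext i; fin_cases i <;> simp [biVal] <;> ring
      map_smul' := fun a v => by
        funext i; fin_cases i <;> simp [biVal] <;> ring }
  obtain ⟨v, hv, hv0⟩ := Submodule.exists_mem_ne_zero_of_ne_bot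
    (LinearMap.ker_ne_bot_of_finrank_lt (f := f) (by simp))
  have hv' : f v = 0 := hv
  have g1 : biVal (v 0) (v 1) (v 2) (v 3) 1 = 0 := congrFun hv' 0
  have gl : biVal (v 0) (v 1) (v 2) (v 3) l = 0 := congrFun hv' 1
  have gm : biVal (v 0) (v 1) (v 2) (v 3) m = 0 := congrFun hv' 2
  have h0 : v 0 ≠ 0 := by
    intro h0
    rw [h0] at g1 gl gm
    obtain ⟨e1, e2, e3⟩ := hp.leading_ne_zero g1 gl gm
    apply hv0
    funext i
    fin_cases i
    · exact h0
    · exact e1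
    · exact e2
    · exact e3
  have key : ∀ ν, biVal (v 0) (v 1) (v 2) (v 3) ν = 0 →
      biVal 1 (v 1 / v 0) (v 2 / v 0) (v 3 / v 0) ν = 0 := by
    intro ν h
    have e : biVal 1 (v 1 / v 0) (v 2 / v 0) (v 3 / v 0) ν =
        biVal (v 0) (v 1) (v 2) (v 3) ν / v 0 := by
      simp only [biVal]
      field_simp
    rw [e, h, zero_div]
  exact ⟨_, _, _, key 1 g1, key l gl, key m gm⟩

/-- The form of bidegree `(2, 1)` through the five twistor lines is unique up to a factor. -/
lemma IsSol.eq_smul {l m b c d : ℂ} (hs : IsSol l m b c d) (hp : IsPentad l m) {a' b' c' d' : ℂ}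
    (h1 : biVal a' b' c' d' 1 = 0) (hl : biVal a' b' c' d' l = 0)
    (hm : biVal a' b' c' d' m = 0) : b' = a' * b ∧ c' = a' * c ∧ d' = a' * d := by
  have key : ∀ ν, biVal 1 b c d ν = 0 → biVal a' b' c' d' ν = 0 →
      biVal 0 (b' - a' * b) (c' - a' * c) (d' - a' * d) ν = 0 := by
    intro ν e1 e2
    simp only [biVal] at *
    linear_combination e2 - a' * e1
  obtain ⟨e1, e2, e3⟩ := hp.leading_ne_zero (key 1 hs.at_one h1) (key l hs.at_l hl)
    (key m hs.at_m hm)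
  exact ⟨sub_eq_zero.1 e1, sub_eq_zero.1 e2, sub_eq_zero.1 e3⟩

/-- The coefficients `A` and `B` of the form, as a linear form in `y`, have no common zero. -/
lemma IsSol.not_common_zero {l m b c d : ℂ} (hs : IsSol l m b c d) (hp : IsPentad l m)
    {x₀ x₁ : ℂ} (hA : x₁ * (b * x₀ + d * x₁) = 0) (hB : x₀ * (x₀ + c * x₁) = 0) :
    x₀ = 0 ∧ x₁ = 0 := by
  by_contra hx
  exact one_ne_zero (hp.coprime hs.at_one hs.at_l hs.at_m hx hA (by rwa [one_mul])).1

lemma vieta_cubic {e₃ e₂ e₁ e₀ l m : ℂ} (l1 : l ≠ 1) (m1 : m ≠ 1) (lm : l ≠ m)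
    (h1 : e₃ + e₂ + e₁ + e₀ = 0) (hl : e₃ * l ^ 3 + e₂ * l ^ 2 + e₁ * l + e₀ = 0)
    (hm : e₃ * m ^ 3 + e₂ * m ^ 2 + e₁ * m + e₀ = 0) :
    e₂ = -e₃ * (1 + l + m) ∧ e₁ = e₃ * (l + m + l * m) ∧ e₀ = -e₃ * (l * m) := by
  have a1 : e₃ * (l ^ 2 + l + 1) + e₂ * (l + 1) + e₁ = 0 :=
    mul_left_cancel₀ (sub_ne_zero.2 l1) (by linear_combination hl - h1)
  have a2 : e₃ * (m ^ 2 + m + 1) + e₂ * (m + 1) + e₁ = 0 :=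
    mul_left_cancel₀ (sub_ne_zero.2 m1) (by linear_combination hm - h1)
  have a3 : e₃ * (l + m + 1) + e₂ = 0 :=
    mul_left_cancel₀ (sub_ne_zero.2 lm) (by linear_combination a1 - a2)
  have b2 : e₂ = -e₃ * (1 + l + m) := by linear_combination a3
  have b1 : e₁ = e₃ * (l + m + l * m) := by linear_combination a1 - (l + 1) * a3
  exact ⟨b2, b1, by linear_combination h1 - b2 - b1⟩

/-- Substituting the solution `y = (B, -A)` of `y₀ A + y₁ B = 0` into the form of bidegree
`(1, 2)` gives `x₀ x₁` times a binary cubic with these coefficients. -/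
noncomputable def resCoeff (b c d : ℂ) : Fin 4 → ℂ :=
  ![d * d * conj d - c * d * conj c,
    b * d * conj d + d * (b * conj d - c * conj b) - d * conj c + c * (c - b * conj c),
    b * (b * conj d - c * conj b) - d * conj b + (c - b * conj c) + c,
    1 - b * conj b]

lemma resCoeff_spec (b c d x₀ x₁ A B : ℂ) (hA : A = x₁ * (b * x₀ + d * x₁))
    (hB : B = x₀ * (x₀ + c * x₁)) :
    B ^ 2 * x₁ - conj b * A * B * x₀ - conj c * A * B * x₁ + conj d * A ^ 2 * x₀ =
      x₀ * x₁ * (resCoeff b c d 3 * x₀ ^ 3 + resCoeff b c d 2 * x₀ ^ 2 * x₁ +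
        resCoeff b c d 1 * x₀ * x₁ ^ 2 + resCoeff b c d 0 * x₁ ^ 3) := by
  subst hA hB
  simp [resCoeff]
  ring

lemma conj_biVal (b c d ν : ℂ) : conj (biVal 1 b c d ν) =
    conj ν ^ 2 + conj b * conj ν * ν + conj c * conj ν + conj d * ν := by
  simp [biVal]

/-- The binary cubic vanishes at every `ν` with `f(ν, conj ν) = 0`. -/
lemma resCoeff_root {b c d ν : ℂ} (h : biVal 1 b c d ν = 0) (hν : ν ≠ 0) :
    resCoeff b c d 3 * ν ^ 3 + resCoeff b c d 2 * ν ^ 2 + resCoeff b c d 1 * ν +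
      resCoeff b c d 0 = 0 := by
  have hs := resCoeff_spec b c d ν 1 _ _ rfl rfl
  have hg : conj ν ^ 2 + conj b * conj ν * ν + conj c * conj ν + conj d * ν = 0 := by
    rw [← conj_biVal, h, map_zero]
  simp only [biVal] at h
  have e : ν * (resCoeff b c d 3 * ν ^ 3 + resCoeff b c d 2 * ν ^ 2 + resCoeff b c d 1 * ν +
      resCoeff b c d 0) = 0 := by
    linear_combination -hs + (b * ν + d) ^ 2 * hg + (ν * (ν + c) - conj ν * (b * ν + d) -
      (conj b * ν + conj c) * (b * ν + d)) * h
  exact (mul_eq_zero.1 e).resolve_left hν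

/-- The roots of the binary cubic are `1, λ, μ`. -/
lemma IsSol.resCoeff_eq {l m b c d : ℂ} (hs : IsSol l m b c d) (hp : IsPentad l m) :
    resCoeff b c d 2 = -resCoeff b c d 3 * (1 + l + m) ∧
    resCoeff b c d 1 = resCoeff b c d 3 * (l + m + l * m) ∧
    resCoeff b c d 0 = -resCoeff b c d 3 * (l * m) := by
  obtain ⟨l0, l1, m0, m1, lm⟩ := hp.ne
  refine vieta_cubic l1 m1 lm ?_ (resCoeff_root hs.at_l l0) (resCoeff_root hs.at_m m0)
  simpa using resCoeff_root hs.at_one one_ne_zero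

lemma IsSol.resCoeff_ne_zero {l m b c d : ℂ} (hs : IsSol l m b c d) (hp : IsPentad l m) :
    resCoeff b c d 3 ≠ 0 := by
  intro h3
  obtain ⟨h2, h1, h0⟩ := hs.resCoeff_eq hp
  rw [h3, neg_zero, zero_mul] at h2 h0
  rw [h3, zero_mul] at h1
  have hb : b ≠ 0 := by
    rintro rfl
    simp [resCoeff] at h3
  -- the root `(d, -b)` of `A` would also be a root of `B`
  have hspec := resCoeff_spec b c d d (-b) _ _ rfl rfl
  rw [h0, h1, h2, h3] at hspec
  have hB : b * (d * (d + c * -b)) ^ 2 = 0 := by linear_combination -hspec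
  have hB' := pow_eq_zero_iff (two_ne_zero) |>.1 ((mul_eq_zero.1 hB).resolve_left hb)
  have := hs.not_common_zero hp (x₀ := d) (x₁ := -b) (by ring) hB'
  exact hb (neg_eq_zero.1 this.2)

/-- The quintic `x₀ x₁ (x₀ - x₁) (x₀ - λ x₁) (x₀ - μ x₁)` has no double root. -/
lemma IsPentad.simple_roots {l m : ℂ} (hp : IsPentad l m) {x₀ x₁ : ℂ}
    (h0 : 4 * x₀ ^ 3 * x₁ - 3 * (1 + l + m) * x₀ ^ 2 * x₁ ^ 2 +
      2 * (l + m + l * m) * x₀ * x₁ ^ 3 - l * m * x₁ ^ 4 = 0)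
    (h1 : x₀ ^ 4 - 2 * (1 + l + m) * x₀ ^ 3 * x₁ + 3 * (l + m + l * m) * x₀ ^ 2 * x₁ ^ 2 -
      4 * (l * m) * x₀ * x₁ ^ 3 = 0) : x₀ = 0 ∧ x₁ = 0 := by
  obtain ⟨l0, l1, m0, m1, lm⟩ := hp.ne
  by_cases hx1 : x₁ = 0
  · subst hx1
    exact ⟨by simpa using h1, rfl⟩
  exfalso
  obtain ⟨r, rfl⟩ : ∃ r, x₀ = r * x₁ := ⟨x₀ / x₁, by field_simp⟩
  have hx : x₁ ^ 4 ≠ 0 := pow_ne_zero 4 hx1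
  have g0 : 4 * r ^ 3 - 3 * (1 + l + m) * r ^ 2 + 2 * (l + m + l * m) * r - l * m = 0 :=
    mul_left_cancel₀ hx (by linear_combination h0)
  have g1 : r * (r - 1) * (r - l) * (r - m) = 0 := by
    have : r ^ 4 - 2 * (1 + l + m) * r ^ 3 + 3 * (l + m + l * m) * r ^ 2 - 4 * (l * m) * r = 0 :=
      mul_left_cancel₀ hx (by linear_combination h1)
    linear_combination (this + r * g0) / 5
  simp only [mul_eq_zero, sub_eq_zero] at g1
  rcases g1 with ((rfl | rfl) | rfl) | rfl
  · exact mul_ne_zero l0 m0 (by linear_combination -g0)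
  · exact mul_ne_zero (sub_ne_zero.2 l1) (sub_ne_zero.2 m1) (by linear_combination g0)
  · exact mul_ne_zero (mul_ne_zero l0 (sub_ne_zero.2 l1)) (sub_ne_zero.2 lm)
      (by linear_combination g0)
  · exact mul_ne_zero (mul_ne_zero m0 (sub_ne_zero.2 m1)) (sub_ne_zero.2 lm)
      (by linear_combination -g0)

/-! ### Smoothness of the members of the pencil -/

/-- At a singular point with `x, y ≠ 0` both forms vanish by Euler's relation, so `y` is a multiple
of `(B(x), -A(x))`, and the chain rule makes `x` a double root of the quintic. -/
lemma IsSol.isNonsingularForm_pencil {l m b c d : ℂ} (hs : IsSol l m b c d) (hp : IsPentad l m)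
    {α β : ℂ} (hα : α ≠ 0) (hβ : β ≠ 0) : IsNonsingularForm (pencil b c d α β) := by
  refine isNonsingularForm_iff.2 ⟨isHomogeneous_pencil _ _ _ _ _, fun z hz ⟨_, h⟩ => hz ?_⟩
  obtain ⟨e0, e1, e2, e3⟩ := eval_pderiv_pencil b c d α β z
  rw [h 0] at e0
  rw [h 1] at e1
  rw [h 2] at e2
  rw [h 3] at e3
  generalize hx0 : z 0 = x₀ at *
  generalize hy0 : z 1 = y₀ at *
  generalize hx1 : z 2 = x₁ at *
  generalize hy1 : z 3 = y₁ at *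
  suffices x₀ = 0 ∧ x₁ = 0 ∧ y₀ = 0 ∧ y₁ = 0 by
    obtain ⟨rfl, rfl, rfl, rfl⟩ := this
    funext i
    fin_cases i
    · exact hx0
    · exact hy0
    · exact hx1
    · exact hy1
  -- the case `x = 0`
  have case_x : x₀ = 0 → x₁ = 0 → y₀ = 0 ∧ y₁ = 0 := by
    rintro rfl rfl
    have hA : y₁ * (conj b * y₀ + conj d * y₁) = 0 :=
      mul_left_cancel₀ hβ (by linear_combination -e0)
    have hB : y₀ * (y₀ + conj c * y₁) = 0 := mul_left_cancel₀ hβ (by linear_combination -e2)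
    have := hs.not_common_zero hp (x₀ := conj y₀) (x₁ := conj y₁)
      (by simpa using congrArg conj hA) (by simpa using congrArg conj hB)
    simpa using this
  -- the case `y = 0`
  have case_y : y₀ = 0 → y₁ = 0 → x₀ = 0 ∧ x₁ = 0 := by
    rintro rfl rfl
    exact hs.not_common_zero hp (mul_left_cancel₀ hα (by linear_combination -e1))
      (mul_left_cancel₀ hα (by linear_combination -e3))
  by_cases hx : x₀ = 0 ∧ x₁ = 0
  · exact ⟨hx.1, hx.2, case_x hx.1 hx.2⟩
  set A := x₁ * (b * x₀ + d * x₁) with hA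
  set B := x₀ * (x₀ + c * x₁) with hB
  have hf : y₀ * A + y₁ * B = 0 := by
    have : 3 * α * (y₀ * A + y₁ * B) = 0 := by
      rw [hA, hB]
      linear_combination -2 * x₀ * e0 - 2 * x₁ * e2 + y₀ * e1 + y₁ * e3
    exact (mul_eq_zero.1 this).resolve_left (mul_ne_zero three_ne_zero hα)
  obtain ⟨k, rfl, rfl⟩ : ∃ k, y₀ = k * B ∧ y₁ = -(k * A) := by
    by_cases hA0 : A = 0
    · have hB0 : B ≠ 0 := fun hB0 => hx (hs.not_common_zero hp hA0 hB0)
      refine ⟨y₀ / B, by field_simp, ?_⟩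
      rw [hA0] at hf ⊢
      simpa [hB0] using hf
    · refine ⟨-(y₁ / A), ?_, by field_simp⟩
      field_simp
      linear_combination hf
  by_cases hk : k = 0
  · subst hk
    exact absurd (case_y (by simp) (by simp)) hx
  exfalso
  obtain ⟨r2, r1, r0⟩ := hs.resCoeff_eq hp
  have hK := mul_ne_zero (mul_ne_zero hβ (mul_ne_zero hk hk)) (hs.resCoeff_ne_zero hp)
  -- the partial derivatives of the quintic, written in two ways
  refine hx (hp.simple_roots (x₀ := x₀) (x₁ := x₁) ?_ ?_)
  · have e : 4 * resCoeff b c d 3 * x₀ ^ 3 * x₁ + 3 * resCoeff b c d 2 * x₀ ^ 2 * x₁ ^ 2 +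
        2 * resCoeff b c d 1 * x₀ * x₁ ^ 3 + resCoeff b c d 0 * x₁ ^ 4 =
        (-(conj b * A * B) + conj d * A ^ 2) + (2 * B * x₁ - conj b * A * x₀ - conj c * A * x₁) *
          (2 * x₀ + c * x₁) - (conj b * B * x₀ + conj c * B * x₁ - 2 * conj d * A * x₀) *
            (b * x₁) := by
      simp [resCoeff, hA, hB]
      ring
    apply mul_left_cancel₀ hK
    rw [r2, r1, r0] at e
    rw [hA, hB] at e0 e1 e3 e
    linear_combination β * k * k * e - e0 - k * (2 * x₀ + c * x₁) * e1 + k * (b * x₁) * e3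
  · have e : resCoeff b c d 3 * x₀ ^ 4 + 2 * resCoeff b c d 2 * x₀ ^ 3 * x₁ +
        3 * resCoeff b c d 1 * x₀ ^ 2 * x₁ ^ 2 + 4 * resCoeff b c d 0 * x₀ * x₁ ^ 3 =
        (B ^ 2 - conj c * A * B) + (2 * B * x₁ - conj b * A * x₀ - conj c * A * x₁) *
          (c * x₀) - (conj b * B * x₀ + conj c * B * x₁ - 2 * conj d * A * x₀) *
            (b * x₀ + 2 * d * x₁) := by
      simp [resCoeff, hA, hB]
      ring
    apply mul_left_cancel₀ hK
    rw [r2, r1, r0] at e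
    rw [hA, hB] at e1 e2 e3 e
    linear_combination β * k * k * e - e2 - k * (c * x₀) * e1 + k * (b * x₀ + 2 * d * x₁) * e3

/-! ### Cubic surfaces containing given twistor lines -/

lemma binary_cubic_eq_zero {p q r t : ℂ}
    (h : ∀ x y : ℂ, p * x ^ 3 + q * x ^ 2 * y + r * x * y ^ 2 + t * y ^ 3 = 0) :
    p = 0 ∧ q = 0 ∧ r = 0 ∧ t = 0 := by
  have h1 := h 1 0
  have h2 := h 0 1
  have h3 := h 1 1
  have h4 := h 1 (-1)
  refine ⟨by linear_combination h1, ?_, ?_, by linear_combination h2⟩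
  · linear_combination (h3 - h4) / 2 - h2
  · linear_combination (h3 + h4) / 2 - h1

/-- A cubic form that contains the twistor lines over `0, 1, ∞` restricts to the quadric
`{(ρ s, ρ t, s, t)}` spanned by these lines as `ρ (ρ - 1)` times a binary cubic in `s, t`. If the
binary cubic is zero, the cubic surface contains the quadric, so it is singular. -/
lemma exists_residual_cubic {F : MvPolynomial (Fin 4) ℂ} (hF : IsNonsingularForm F)
    (h0 : twistorLine (pt 0 0) ⊆ zeroLocus F) (h1 : twistorLine (pt 1 0) ⊆ zeroLocus F)
    (hI : twistorLine ptInf ⊆ zeroLocus F) :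
    ∃ p q r w : ℂ, ¬ (p = 0 ∧ q = 0 ∧ r = 0 ∧ w = 0) ∧ ∀ ρ s t,
      eval ![ρ * s, ρ * t, s, t] F =
        ρ * (ρ - 1) * (p * s ^ 3 + q * s ^ 2 * t + r * s * t ^ 2 + w * t ^ 3) := by
  rw [isNonsingularForm_iff] at hF
  obtain ⟨hF, hns⟩ := hF
  rw [twistorLine_pt_subset hF] at h0 h1
  rw [twistorLine_ptInf_subset hF] at hI
  obtain ⟨k, hk⟩ := exists_coeffs hF
  simp only [hk, Matrix.cons_val] at h0 h1 hI
  obtain ⟨a1, a2, a3, a4⟩ := binary_cubic_eq_zero (p := k ![3, 0, 0, 0]) (q := k ![2, 1, 0, 0])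
    (r := k ![1, 2, 0, 0]) (t := k ![0, 3, 0, 0]) fun x y => by linear_combination hI x y
  obtain ⟨b1, b2, b3, b4⟩ := binary_cubic_eq_zero (p := k ![0, 0, 3, 0]) (q := k ![0, 0, 2, 1])
    (r := k ![0, 0, 1, 2]) (t := k ![0, 0, 0, 3]) fun x y => by
      have := h0 x y
      simp only [map_zero, mul_zero, sub_zero, add_zero] at this
      linear_combination this
  rw [a1, a2, a3, a4, b1, b2, b3, b4] at hk
  obtain ⟨c1, c2, c3, c4⟩ := binary_cubic_eq_zero (p := k ![2, 0, 1, 0] + k ![1, 0, 2, 0])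
    (q := k ![2, 0, 0, 1] + k ![1, 1, 1, 0] + k ![1, 0, 1, 1] + k ![0, 1, 2, 0])
    (r := k ![0, 2, 1, 0] + k ![1, 1, 0, 1] + k ![1, 0, 0, 2] + k ![0, 1, 1, 1])
    (t := k ![0, 2, 0, 1] + k ![0, 1, 0, 2]) fun x y => by
      have := h1 x y
      rw [a1, a2, a3, a4, b1, b2, b3, b4] at this
      simp only [map_zero, map_one, mul_zero, mul_one, sub_zero, zero_add] at this
      linear_combination this
  refine ⟨k ![2, 0, 1, 0], k ![2, 0, 0, 1] + k ![1, 1, 1, 0], k ![0, 2, 1, 0] + k ![1, 1, 0, 1],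
    k ![0, 2, 0, 1], ?_, fun ρ s t => ?_⟩
  · rintro ⟨d1, d2, d3, d4⟩
    set e1 := k ![2, 0, 0, 1] with he1
    set e2 := k ![1, 1, 0, 1] with he2
    set e3 := k ![1, 0, 1, 1] with he3
    set e4 := k ![1, 0, 0, 2] with he4
    have hFe : F = (X 0 * X 3 - X 1 * X 2) * (C e1 * X 0 + C e2 * X 1 + C e3 * X 2 + C e4 * X 3) :=
      MvPolynomial.funext fun z => by
        rw [hk]
        simp only [map_mul, map_sub, map_add, MvPolynomial.eval_X, MvPolynomial.eval_C]
        linear_combination z 0 ^ 2 * z 2 * d1 + z 0 * z 2 ^ 2 * (c1 - d1) + z 0 * z 1 * z 2 * d2 +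
          z 1 ^ 2 * z 2 * d3 + z 1 ^ 2 * z 3 * d4 + z 1 * z 3 ^ 2 * (c4 - d4) +
          z 1 * z 2 ^ 2 * (c2 - d2) + z 1 * z 2 * z 3 * (c3 - d3)
    -- a common zero of the quadric and the plane
    have hpt : ∀ s t : ℂ, e1 * s + e3 * t = 0 → SingAt F ![s, 0, t, 0] := by
      intro s t hst
      rw [hFe]
      constructor
      · simp
      · intro i
        fin_cases i <;>
        simp [MvPolynomial.pderiv_X, Derivation.leibniz, hst]
    by_cases he : e1 = 0 ∧ e3 = 0
    · exact hns _ (fun h => one_ne_zero (congrFun h 0)) (hpt 1 0 (by simp [he.1]))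
    · refine hns _ (fun h => he ⟨?_, congrFun h 0⟩) (hpt e3 (-e1) (by ring))
      simpa using congrFun h 2
  · simp only [hk, Matrix.cons_val]
    linear_combination ρ * s ^ 3 * c1 + ρ * s ^ 2 * t * c2 + ρ * s * t ^ 2 * c3 + ρ * t ^ 3 * c4

/-- If a non-singular cubic surface contains the twistor lines over `0, 1, ∞, ν` then `ν` is not
real, and every other twistor line in the surface lies over a complex number: each point where
another twistor line meets the quadric spanned by the first three gives a root of the residual
binary cubic, and the roots from a twistor line over `u + v j` with `v ≠ 0` would be too many. -/
lemma four_twistorLines {F : MvPolynomial (Fin 4) ℂ} (hF : IsNonsingularForm F)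
    (h0 : twistorLine (pt 0 0) ⊆ zeroLocus F) (h1 : twistorLine (pt 1 0) ⊆ zeroLocus F)
    (hI : twistorLine ptInf ⊆ zeroLocus F) {ν : ℂ} (hν0 : ν ≠ 0) (hν1 : ν ≠ 1)
    (hν : twistorLine (pt ν 0) ⊆ zeroLocus F) :
    conj ν ≠ ν ∧ ∀ u v, twistorLine (pt u v) ⊆ zeroLocus F → v = 0 := by
  obtain ⟨p, q, r, w, hne, hres⟩ := exists_residual_cubic hF h0 h1 hI
  rw [twistorLine_pt_subset hF.1] at hν
  -- the point of the quadric with parameters `ρ, s, t` is a root `(s, t)` if it is in the surface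
  have key : ∀ ρ s t, ρ ≠ 0 → ρ ≠ 1 → eval ![ρ * s, ρ * t, s, t] F = 0 →
      p * s ^ 3 + q * s ^ 2 * t + r * s * t ^ 2 + w * t ^ 3 = 0 := by
    intro ρ s t hρ hρ' h
    rw [hres] at h
    exact (mul_eq_zero.1 h).resolve_left (mul_ne_zero hρ (sub_ne_zero.2 hρ'))
  constructor
  · intro hc
    refine hne (binary_cubic_eq_zero fun s t => key ν s t hν0 hν1 ?_)
    have := hν s t
    simpa [hc, mul_comm] using this
  -- the twistor line over `ν` meets the quadric at `(s, t) = (1, 0)` and `(0, 1)`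
  · have hp : p = 0 := by
      have h := key ν 1 0 hν0 hν1 (by simpa using hν 1 0)
      simpa using h
    have hw : w = 0 := by
      have h := key (conj ν) 0 1 (by simpa using hν0)
        (fun h => hν1 (by simpa using congrArg conj h)) (by simpa using hν 0 1)
      simpa using h
    subst hp hw
    intro u v huv
    by_contra hv
    rw [twistorLine_pt_subset hF.1] at huv
    -- the eigenvalues `ρ` of the quaternion `u + v j`, with eigenvectors `(ρ - conj u, v)`
    have eig : ∀ ρ, ρ ^ 2 - (u + conj u) * ρ + (u * conj u + v * conj v) = 0 →
        q * (ρ - conj u) + r * v = 0 := by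
      intro ρ hρ
      have hvv : v * conj v ≠ 0 := mul_ne_zero hv (by simpa using hv)
      have hprod : (ρ - u) * (ρ - conj u) = -(v * conj v) := by linear_combination hρ
      have hs : ρ - conj u ≠ 0 := fun h => hvv (by linear_combination hprod - (ρ - u) * h)
      have hnn : ∀ a : ℂ, (u - a) * conj (u - a) + v * conj v ≠ 0 := by
        intro a h
        rw [Complex.mul_conj, Complex.mul_conj, ← Complex.ofReal_add, Complex.ofReal_eq_zero] at h
        have h1 := Complex.normSq_pos.2 hv
        have h2 := Complex.normSq_nonneg (u - a)
        linarith
      have hρ0 : ρ ≠ 0 := by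
        rintro rfl
        apply hnn 0
        simp only [sub_zero]
        linear_combination hρ
      have hρ1 : ρ ≠ 1 := by
        rintro rfl
        apply hnn 1
        simp only [map_sub, map_one]
        linear_combination hρ
      have h := key ρ (ρ - conj u) v hρ0 hρ1 (by
        rw [← huv (ρ - conj u) v]
        congr 2
        funext i
        fin_cases i
        · simp only [Fin.zero_eta, Matrix.cons_val]; linear_combination hρ
        · simp only [Fin.mk_one, Matrix.cons_val]; ring
        · rfl
        · rfl)
      have h' : (ρ - conj u) * v * (q * (ρ - conj u) + r * v) = 0 := by linear_combination h
      exact (mul_eq_zero.1 h').resolve_left (mul_ne_zero hs hv)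
    -- there are two different eigenvalues
    set D : ℝ := u.im ^ 2 + Complex.normSq v with hD
    have hDpos : 0 < D := by
      have := Complex.normSq_pos.2 hv
      positivity
    set δ : ℂ := Complex.I * (Real.sqrt D : ℂ) with hδ
    have hδ2 : δ ^ 2 = -(D : ℂ) := by
      rw [hδ, mul_pow, Complex.I_sq, ← Complex.ofReal_pow, Real.sq_sqrt hDpos.le]
      ring
    have hδ0 : δ ≠ 0 := by
      rw [hδ]
      exact mul_ne_zero Complex.I_ne_zero
        (Complex.ofReal_ne_zero.2 (Real.sqrt_pos.2 hDpos).ne')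
    have e1 : u + conj u = 2 * (u.re : ℂ) := by
      rw [Complex.add_conj]; push_cast; ring
    have e2 : u * conj u + v * conj v = (u.re : ℂ) ^ 2 + (D : ℂ) := by
      rw [Complex.mul_conj, Complex.mul_conj, hD, Complex.normSq_apply u]
      push_cast
      ring
    have g1 := eig (u.re + δ) (by rw [e1, e2]; linear_combination hδ2)
    have g2 := eig (u.re - δ) (by rw [e1, e2]; linear_combination hδ2)
    have hq : q = 0 := by
      have : 2 * δ * q = 0 := by linear_combination g1 - g2
      exact (mul_eq_zero.1 this).resolve_left (mul_ne_zero two_ne_zero hδ0)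
    rw [hq, zero_mul, zero_add] at g1
    exact hne ⟨rfl, hq, (mul_eq_zero.1 g1).resolve_right hv, rfl⟩

/-- The cubic forms that vanish on the twistor lines over the five points form a pencil. -/
lemma IsSol.exists_eq_pencil {l m b c d : ℂ} (hs : IsSol l m b c d) (hp : IsPentad l m)
    {F : MvPolynomial (Fin 4) ℂ} (hF : F.IsHomogeneous 3)
    (h : ∀ i, twistorLine (stdPts l m i) ⊆ zeroLocus F) : ∃ α β, F = pencil b c d α β := by
  obtain ⟨l0, l1, m0, m1, lm⟩ := hp.ne
  have h0 := (twistorLine_pt_subset hF).1 (h 0)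
  have h1 := (twistorLine_pt_subset hF).1 (h 1)
  have hl := (twistorLine_pt_subset hF).1 (h 2)
  have hm := (twistorLine_pt_subset hF).1 (h 3)
  have hI := (twistorLine_ptInf_subset hF).1 (h 4)
  obtain ⟨k, hk⟩ := exists_coeffs hF
  simp only [hk, Matrix.cons_val] at h0 h1 hI hl hm
  obtain ⟨a1, a2, a3, a4⟩ := binary_cubic_eq_zero (p := k ![3, 0, 0, 0]) (q := k ![2, 1, 0, 0])
    (r := k ![1, 2, 0, 0]) (t := k ![0, 3, 0, 0]) fun x y => by linear_combination hI x y
  obtain ⟨b1, b2, b3, b4⟩ := binary_cubic_eq_zero (p := k ![0, 0, 3, 0]) (q := k ![0, 0, 2, 1])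
    (r := k ![0, 0, 1, 2]) (t := k ![0, 0, 0, 3]) fun x y => by
      have := h0 x y
      simp only [map_zero, mul_zero, sub_zero, add_zero] at this
      linear_combination this
  rw [a1, a2, a3, a4, b1, b2, b3, b4] at hk
  simp only [a1, a2, a3, a4, b1, b2, b3, b4] at h1 hl hm
  have main : ∀ ν : ℂ, (∀ s t, eval ![s * ν - t * conj 0, s * 0 + t * conj ν, s, t] F = 0) →
      (k ![2, 0, 1, 0] * ν ^ 2 + k ![1, 0, 2, 0] * ν = 0 ∧
      biVal (k ![2, 0, 0, 1]) (k ![1, 1, 1, 0]) (k ![1, 0, 1, 1]) (k ![0, 1, 2, 0]) ν = 0 ∧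
      biVal (conj (k ![0, 2, 1, 0])) (conj (k ![1, 1, 0, 1])) (conj (k ![0, 1, 1, 1]))
        (conj (k ![1, 0, 0, 2])) ν = 0 ∧
      k ![0, 2, 0, 1] * conj ν ^ 2 + k ![0, 1, 0, 2] * conj ν = 0) := by
    intro ν hν
    obtain ⟨g1, g2, g3, g4⟩ := binary_cubic_eq_zero
      (p := k ![2, 0, 1, 0] * ν ^ 2 + k ![1, 0, 2, 0] * ν)
      (q := biVal (k ![2, 0, 0, 1]) (k ![1, 1, 1, 0]) (k ![1, 0, 1, 1]) (k ![0, 1, 2, 0]) ν)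
      (r := k ![0, 2, 1, 0] * conj ν ^ 2 + k ![1, 1, 0, 1] * ν * conj ν +
        k ![0, 1, 1, 1] * conj ν + k ![1, 0, 0, 2] * ν)
      (t := k ![0, 2, 0, 1] * conj ν ^ 2 + k ![0, 1, 0, 2] * conj ν) fun x y => by
        have := hν x y
        simp only [hk, Matrix.cons_val, map_zero, mul_zero, sub_zero, zero_add] at this
        simp only [biVal]
        linear_combination this
    refine ⟨g1, g2, ?_, g4⟩
    have := congrArg conj g3
    simp only [map_add, map_mul, map_pow, Complex.conj_conj, map_zero] at this
    simp only [biVal]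
    linear_combination this
  have n1 := main 1 ((twistorLine_pt_subset hF).1 (h 1))
  have nl := main l ((twistorLine_pt_subset hF).1 (h 2))
  have nm := main m ((twistorLine_pt_subset hF).1 (h 3))
  have two_roots : ∀ x y ν : ℂ, ν ≠ 0 → ν ≠ 1 → x + y = 0 → x * ν ^ 2 + y * ν = 0 →
      x = 0 ∧ y = 0 := by
    intro x y ν h0 h1 e1 e2
    have hx : ν * (ν - 1) * x = 0 := by linear_combination e2 - ν * e1
    have := (mul_eq_zero.1 hx).resolve_left (mul_ne_zero h0 (sub_ne_zero.2 h1))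
    exact ⟨this, by rw [this, zero_add] at e1; exact e1⟩
  -- the terms of degree 3 in `x` or in `y` vanish
  obtain ⟨p1, p2⟩ := two_roots _ _ l l0 l1 (by simpa using n1.1) nl.1
  obtain ⟨q1, q2⟩ := two_roots _ _ (conj l) (by simpa using l0)
    (fun h => l1 (by simpa using congrArg conj h)) (by simpa using n1.2.2.2) nl.2.2.2
  -- the parts of bidegree `(2, 1)` and `(1, 2)`
  obtain ⟨s1, s2, s3⟩ := hs.eq_smul hp n1.2.1 nl.2.1 nm.2.1
  obtain ⟨t1, t2, t3⟩ := hs.eq_smul hp n1.2.2.1 nl.2.2.1 nm.2.2.1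
  have t1' := congrArg conj t1
  have t2' := congrArg conj t2
  have t3' := congrArg conj t3
  simp only [map_mul, Complex.conj_conj] at t1' t2' t3'
  refine ⟨k ![2, 0, 0, 1], k ![0, 2, 1, 0], MvPolynomial.funext fun z => ?_⟩
  rw [hk, p1, p2, q1, q2, s1, s2, s3, t1', t2', t3', eval_pencil, eval_cubicForm, eval_conjForm]
  ring

lemma eval_pencil_twistorLine (b c d α β ν s t : ℂ) :
    eval ![s * ν - t * conj 0, s * 0 + t * conj ν, s, t] (pencil b c d α β) =
      α * s ^ 2 * t * biVal 1 b c d ν + β * s * t ^ 2 * conj (biVal 1 b c d ν) := by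
  rw [conj_biVal, eval_pencil, eval_cubicForm, eval_conjForm]
  simp only [Matrix.cons_val, biVal, map_zero]
  ring

lemma IsSol.twistorLine_subset {l m b c d : ℂ} (hs : IsSol l m b c d) (α β : ℂ) (i : Fin 5) :
    twistorLine (stdPts l m i) ⊆ zeroLocus (pencil b c d α β) := by
  have main : ∀ ν, biVal 1 b c d ν = 0 →
      twistorLine (pt ν 0) ⊆ zeroLocus (pencil b c d α β) := fun ν hν =>
    (twistorLine_pt_subset (isHomogeneous_pencil _ _ _ _ _)).2 fun s t => by
      rw [eval_pencil_twistorLine, hν]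
      simp
  fin_cases i
  · exact main 0 (by simp [biVal])
  · exact main 1 hs.at_one
  · exact main l hs.at_l
  · exact main m hs.at_m
  · refine (twistorLine_ptInf_subset (isHomogeneous_pencil _ _ _ _ _)).2 fun s t => ?_
    rw [eval_pencil, eval_cubicForm, eval_conjForm]
    simp

/-- A non-singular member of the pencil contains no further twistor lines: by `four_twistorLines`
another one would lie over a complex number, which would be a further root of the quintic. -/
lemma IsSol.twistorPoints_eq {l m b c d : ℂ} (hs : IsSol l m b c d) (hp : IsPentad l m) {α β : ℂ}
    (hα : α ≠ 0) (hβ : β ≠ 0) :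
    twistorPoints (zeroLocus (pencil b c d α β)) = Set.range (stdPts l m) := by
  obtain ⟨l0, l1, m0, m1, lm⟩ := hp.ne
  apply Set.Subset.antisymm
  · intro q hq
    rcases eq_pt_or_eq_ptInf q with ⟨u, v, rfl⟩ | rfl
    · have hv := (four_twistorLines (hs.isNonsingularForm_pencil hp hα hβ)
        (hs.twistorLine_subset α β 0) (hs.twistorLine_subset α β 1)
        (hs.twistorLine_subset α β 4) l0 l1 (hs.twistorLine_subset α β 2)).2 u v hq
      subst hv
      have hq' := (twistorLine_pt_subset (isHomogeneous_pencil _ _ _ _ _)).1 hq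
      simp only [eval_pencil_twistorLine] at hq'
      have hu : biVal 1 b c d u = 0 := by
        have := (binary_cubic_eq_zero (p := 0) (q := α * biVal 1 b c d u)
          (r := β * conj (biVal 1 b c d u)) (t := 0) fun x y => by
            linear_combination hq' x y).2.1
        exact (mul_eq_zero.1 this).resolve_left hα
      by_cases hu0 : u = 0
      · subst hu0
        exact ⟨0, rfl⟩
      have hr := resCoeff_root hu hu0
      obtain ⟨r2, r1, r0⟩ := hs.resCoeff_eq hp
      rw [r2, r1, r0] at hr
      have : resCoeff b c d 3 * ((u - 1) * (u - l) * (u - m)) = 0 := by linear_combination hr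
      have := (mul_eq_zero.1 this).resolve_left (hs.resCoeff_ne_zero hp)
      simp only [mul_eq_zero, sub_eq_zero] at this
      rcases this with (rfl | rfl) | rfl
      · exact ⟨1, rfl⟩
      · exact ⟨2, rfl⟩
      · exact ⟨3, rfl⟩
    · exact ⟨4, rfl⟩
  · rintro _ ⟨i, rfl⟩
    exact hs.twistorLine_subset α β i

lemma singAt_pencil_left (b c d α : ℂ) : SingAt (pencil b c d α 0) ![0, 1, 0, 0] := by
  obtain ⟨e0, e1, e2, e3⟩ := eval_pderiv_pencil b c d α 0 ![0, 1, 0, 0]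
  refine ⟨by simp [eval_pencil, eval_cubicForm], fun i => ?_⟩
  fin_cases i
  · exact e0.trans (by simp)
  · exact e1.trans (by simp)
  · exact e2.trans (by simp)
  · exact e3.trans (by simp)

lemma singAt_pencil_right (b c d β : ℂ) : SingAt (pencil b c d 0 β) ![1, 0, 0, 0] := by
  obtain ⟨e0, e1, e2, e3⟩ := eval_pderiv_pencil b c d 0 β ![1, 0, 0, 0]
  refine ⟨by simp [eval_pencil, eval_conjForm], fun i => ?_⟩
  fin_cases i
  · exact e0.trans (by simp)
  · exact e1.trans (by simp)
  · exact e2.trans (by simp)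
  · exact e3.trans (by simp)

lemma ne_zero_of_isNonsingularForm {b c d α β : ℂ} (h : IsNonsingularForm (pencil b c d α β)) :
    α ≠ 0 ∧ β ≠ 0 := by
  rw [isNonsingularForm_iff] at h
  constructor
  · rintro rfl
    exact h.2 _ (fun h => one_ne_zero (congrFun h 0)) (singAt_pencil_right b c d β)
  · rintro rfl
    exact h.2 _ (fun h => one_ne_zero (congrFun h 1)) (singAt_pencil_left b c d α)

/-- The non-singular cubic surfaces over the five points are the members of the pencil other than
the two singular ones. -/
lemma IsSol.mem_cubicsOver_iff {l m b c d : ℂ} (hs : IsSol l m b c d) (hp : IsPentad l m)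
    {Y : Set CP3} : Y ∈ cubicsOver (Set.range (stdPts l m)) ↔
      ∃ α β, α ≠ 0 ∧ β ≠ 0 ∧ Y = zeroLocus (pencil b c d α β) := by
  constructor
  · rintro ⟨⟨F, hF, rfl⟩, h⟩
    obtain ⟨α, β, rfl⟩ := hs.exists_eq_pencil hp hF.1 fun i => h ⟨i, rfl⟩
    obtain ⟨hα, hβ⟩ := ne_zero_of_isNonsingularForm hF
    exact ⟨α, β, hα, hβ, rfl⟩
  · rintro ⟨α, β, hα, hβ, rfl⟩
    exact ⟨⟨_, hs.isNonsingularForm_pencil hp hα hβ, rfl⟩,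
      (hs.twistorPoints_eq hp hα hβ).symm.subset⟩

/-- Members of the pencil with the same zeros are proportional. -/
lemma pencil_zeroLocus_injective {b c d α β α' β' : ℂ} (hα : α ≠ 0) (hβ : β ≠ 0)
    (h : zeroLocus (pencil b c d α β) = zeroLocus (pencil b c d α' β')) : α * β' = α' * β := by
  have hne : cubicForm b c d * conjForm b c d ≠ 0 := by
    refine mul_ne_zero (fun h => ?_) (fun h => ?_)
    · simpa [h] using eval_cubicForm b c d ![1, 0, 0, 1]
    · simpa [h] using eval_conjForm b c d ![0, 1, 1, 0]
  obtain ⟨z, hz⟩ : ∃ z, eval z (cubicForm b c d * conjForm b c d) ≠ 0 := by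
    by_contra hno
    push Not at hno
    exact hne (MvPolynomial.funext fun z => by simpa using hno z)
  rw [map_mul] at hz
  obtain ⟨hf, hg⟩ := mul_ne_zero_iff.1 hz
  set f := eval z (cubicForm b c d) with hf'
  set g := eval z (conjForm b c d) with hg'
  -- a zero of the first member outside the base locus, found by rescaling `x`
  set r := -(β * g) / (α * f) with hr
  have hr0 : r ≠ 0 := div_ne_zero (neg_ne_zero.2 (mul_ne_zero hβ hg)) (mul_ne_zero hα hf)
  have ef : eval ![r * z 0, z 1, r * z 2, z 3] (cubicForm b c d) = r ^ 2 * f := by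
    rw [hf', eval_cubicForm, eval_cubicForm]
    simp only [Matrix.cons_val]
    ring
  have eg : eval ![r * z 0, z 1, r * z 2, z 3] (conjForm b c d) = r * g := by
    rw [hg', eval_conjForm, eval_conjForm]
    simp only [Matrix.cons_val]
    ring
  have hw : (![r * z 0, z 1, r * z 2, z 3] : Fin 4 → ℂ) ≠ 0 := by
    intro h0
    rw [h0, eval_zero_cubic (isHomogeneous_cubicForm b c d)] at ef
    exact mul_ne_zero (pow_ne_zero 2 hr0) hf ef.symm
  have hrr : r * (α * f) = -(β * g) := by rw [hr]; field_simp
  have hmem : Projectivization.mk ℂ _ hw ∈ zeroLocus (pencil b c d α β) := by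
    rw [mk_mem_zeroLocus (isHomogeneous_pencil _ _ _ _ _), eval_pencil, ef, eg]
    linear_combination r * hrr
  rw [h, mk_mem_zeroLocus (isHomogeneous_pencil _ _ _ _ _), eval_pencil, ef, eg] at hmem
  have h2 : r * g * (α * β' - α' * β) = 0 := by
    linear_combination α * hmem - r * α' * hrr
  exact sub_eq_zero.1 ((mul_eq_zero.1 h2).resolve_left (mul_ne_zero hr0 hg))

/-! ### Transversals of the twistor lines -/

/-- The line `z₁ = z₃ = 0`. -/
def stdB5 : Set CP3 := {x | ∀ z ∈ x.submodule, z 0 = 0 ∧ z 2 = 0}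

/-- The line `z₂ = z₄ = 0`. -/
def stdB6 : Set CP3 := {x | ∀ z ∈ x.submodule, z 1 = 0 ∧ z 3 = 0}

lemma mk_mem_stdB5 {z : Fin 4 → ℂ} {hz : z ≠ 0} :
    Projectivization.mk ℂ z hz ∈ stdB5 ↔ z 0 = 0 ∧ z 2 = 0 := by
  change (∀ w ∈ (Projectivization.mk ℂ z hz).submodule, w 0 = 0 ∧ w 2 = 0) ↔ _
  rw [Projectivization.submodule_mk]
  refine ⟨fun h => h z (Submodule.mem_span_singleton_self z), fun h w hw => ?_⟩
  obtain ⟨c, rfl⟩ := Submodule.mem_span_singleton.1 hw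
  simp [h]

lemma mk_mem_stdB6 {z : Fin 4 → ℂ} {hz : z ≠ 0} :
    Projectivization.mk ℂ z hz ∈ stdB6 ↔ z 1 = 0 ∧ z 3 = 0 := by
  change (∀ w ∈ (Projectivization.mk ℂ z hz).submodule, w 1 = 0 ∧ w 3 = 0) ↔ _
  rw [Projectivization.submodule_mk]
  refine ⟨fun h => h z (Submodule.mem_span_singleton_self z), fun h w hw => ?_⟩
  obtain ⟨c, rfl⟩ := Submodule.mem_span_singleton.1 hw
  simp [h]

lemma mk_mem_iff_of_eq {W : Submodule ℂ (Fin 4 → ℂ)} {z : Fin 4 → ℂ} {hz : z ≠ 0} :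
    Projectivization.mk ℂ z hz ∈ {x : CP3 | x.submodule ≤ W} ↔ z ∈ W := by
  change (Projectivization.mk ℂ z hz).submodule ≤ W ↔ _
  rw [Projectivization.submodule_mk, Submodule.span_singleton_le_iff_mem]

lemma eq_of_mk_mem_iff {Y Z : Set CP3}
    (h : ∀ z (hz : z ≠ 0), Projectivization.mk ℂ z hz ∈ Y ↔ Projectivization.mk ℂ z hz ∈ Z) :
    Y = Z := by
  ext x
  obtain ⟨z, hz, rfl⟩ := CP3.exists_rep x
  exact h z hz

/-- The span of two vectors, when it has dimension 2. -/
lemma exists_of_finrank_two {W : Submodule ℂ (Fin 4 → ℂ)} (hW : Module.finrank ℂ W = 2)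
    {v w : Fin 4 → ℂ} (hv : v ∈ W) (hw : w ∈ W)
    (hi : ∀ a b : ℂ, a • v + b • w = 0 → a = 0 ∧ b = 0) (z : Fin 4 → ℂ) :
    z ∈ W ↔ ∃ a b : ℂ, a • v + b • w = z := by
  have hli : LinearIndependent ℂ ![v, w] := LinearIndependent.pair_iff.2 hi
  have e : Submodule.span ℂ {v, w} = W := Submodule.eq_of_le_of_finrank_eq
    (Submodule.span_le.2 (by rintro x (rfl | rfl) <;> assumption))
    (by
      have := finrank_span_eq_card hli
      rw [Matrix.range_cons, Matrix.range_cons, Matrix.range_empty, Set.union_empty,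
        Set.singleton_union] at this
      rw [this, hW, Fintype.card_fin])
  rw [← e, Submodule.mem_span_pair]

lemma isLine_stdB5 : IsLine stdB5 := by
  let f : (Fin 2 → ℂ) →ₗ[ℂ] (Fin 4 → ℂ) :=
    { toFun := fun v => ![0, v 0, 0, v 1]
      map_add' := fun v w => by funext i; fin_cases i <;> simp
      map_smul' := fun c v => by funext i; fin_cases i <;> simp }
  refine ⟨LinearMap.range f, ?_, eq_of_mk_mem_iff fun z hz => ?_⟩
  · rw [LinearMap.finrank_range_of_inj, Module.finrank_fin_fun]
    intro v w h
    funext i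
    fin_cases i
    · exact congrFun h 1
    · exact congrFun h 3
  · rw [mk_mem_stdB5, mk_mem_iff_of_eq]
    constructor
    · rintro ⟨h0, h2⟩
      refine ⟨![z 1, z 3], ?_⟩
      funext i
      fin_cases i <;> simp [f, h0, h2]
    · rintro ⟨v, rfl⟩
      simp [f]

lemma isLine_stdB6 : IsLine stdB6 := by
  let f : (Fin 2 → ℂ) →ₗ[ℂ] (Fin 4 → ℂ) :=
    { toFun := fun v => ![v 0, 0, v 1, 0]
      map_add' := fun v w => by funext i; fin_cases i <;> simp
      map_smul' := fun c v => by funext i; fin_cases i <;> simp }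
  refine ⟨LinearMap.range f, ?_, eq_of_mk_mem_iff fun z hz => ?_⟩
  · rw [LinearMap.finrank_range_of_inj, Module.finrank_fin_fun]
    intro v w h
    funext i
    fin_cases i
    · exact congrFun h 0
    · exact congrFun h 2
  · rw [mk_mem_stdB6, mk_mem_iff_of_eq]
    constructor
    · rintro ⟨h0, h2⟩
      refine ⟨![z 0, z 2], ?_⟩
      funext i
      fin_cases i <;> simp [f, h0, h2]
    · rintro ⟨v, rfl⟩
      simp [f]

/-- The only lines that meet the twistor lines over `0, 1, ∞, ν`, with `ν` not real, are the two
lines over the standard sphere. -/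
lemma eq_of_isLine_of_meets {b : Set CP3} (hb : IsLine b) {ν : ℂ} (hν : conj ν ≠ ν)
    (h0 : (b ∩ twistorLine (pt 0 0)).Nonempty) (h1 : (b ∩ twistorLine (pt 1 0)).Nonempty)
    (hI : (b ∩ twistorLine ptInf).Nonempty) (hl : (b ∩ twistorLine (pt ν 0)).Nonempty) :
    b = stdB5 ∨ b = stdB6 := by
  obtain ⟨W, hW, rfl⟩ := hb
  obtain ⟨x0, hx0, hx0'⟩ := h0
  obtain ⟨x1, hx1, hx1'⟩ := h1
  obtain ⟨xI, hxI, hxI'⟩ := hI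
  obtain ⟨xl, hxl, hxl'⟩ := hl
  obtain ⟨p, hp, rfl⟩ := CP3.exists_rep x0
  obtain ⟨q, hq, rfl⟩ := CP3.exists_rep x1
  obtain ⟨r, hr, rfl⟩ := CP3.exists_rep xI
  obtain ⟨s, hs, rfl⟩ := CP3.exists_rep xl
  rw [mk_mem_iff_of_eq] at hx0 hx1 hxI hxl
  rw [mem_twistorLine_pt] at hx0' hx1' hxl'
  rw [mem_twistorLine_ptInf] at hxI'
  simp only [map_zero, map_one, mul_zero, mul_one, sub_zero, add_zero, zero_add]
    at hx0' hx1' hxl'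
  have hr' : ¬ (r 0 = 0 ∧ r 1 = 0) := fun h => hr (by
    funext i
    fin_cases i
    exacts [h.1, h.2, hxI'.1, hxI'.2])
  have hp' : ¬ (p 2 = 0 ∧ p 3 = 0) := fun h => hp (by
    funext i
    fin_cases i
    exacts [hx0'.1, hx0'.2, h.1, h.2])
  have hmem := exists_of_finrank_two hW hxI hx0 (by
    intro a b hab
    have e0 := congrFun hab 0
    have e1 := congrFun hab 1
    have e2 := congrFun hab 2
    have e3 := congrFun hab 3
    simp [hx0', hxI'] at e0 e1 e2 e3
    constructor
    · by_contra ha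
      exact hr' ⟨e0.resolve_left ha, e1.resolve_left ha⟩
    · by_contra hb
      exact hp' ⟨e2.resolve_left hb, e3.resolve_left hb⟩)
  have coords : ∀ a b : ℂ, ∀ z : Fin 4 → ℂ, a • r + b • p = z →
      z 0 = a * r 0 ∧ z 1 = a * r 1 ∧ z 2 = b * p 2 ∧ z 3 = b * p 3 := by
    rintro a b _ rfl
    simp [hx0', hxI']
  obtain ⟨a, b, hab⟩ := (hmem q).1 hx1
  obtain ⟨q0, q1, q2, q3⟩ := coords a b q hab
  rw [hx1'.1, q2] at q0
  rw [hx1'.2, q3] at q1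
  have ha : a ≠ 0 := by
    rintro rfl
    have hb : b = 0 := by
      by_contra hb
      exact hp' ⟨by simpa [hb] using q0, by simpa [hb] using q1⟩
    exact hq (by rw [← hab, hb]; simp)
  have hb : b ≠ 0 := by
    rintro rfl
    exact hr' ⟨by simpa [ha] using q0.symm, by simpa [ha] using q1.symm⟩
  obtain ⟨a', b', hab'⟩ := (hmem s).1 hxl
  obtain ⟨s0, s1, s2, s3⟩ := coords a' b' s hab'
  rw [hxl'.1, s2] at s0
  rw [hxl'.2, s3] at s1
  have hb' : b' ≠ 0 := by
    rintro rfl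
    have ha' : a' = 0 := by
      by_contra ha'
      exact hr' ⟨by simpa [ha'] using s0.symm, by simpa [ha'] using s1.symm⟩
    exact hs (by rw [← hab', ha']; simp)
  -- the ratio `r : p` is that of `b : a`, so one of the coordinates must vanish
  have hrs : r 0 = 0 ∨ r 1 = 0 := by
    by_contra hne
    push Not at hne
    have t0 : a' * b - b' * a * ν = 0 := mul_left_cancel₀ hne.1
      (by linear_combination -b * s0 - b' * ν * (-q0))
    have t1 : a' * b - b' * a * conj ν = 0 := mul_left_cancel₀ hne.2
      (by linear_combination -b * s1 - b' * conj ν * (-q1))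
    have : b' * a * (conj ν - ν) = 0 := by linear_combination t0 - t1
    exact mul_ne_zero (mul_ne_zero hb' ha) (sub_ne_zero.2 hν) this
  rcases hrs with hr0 | hr1
  · left
    have hp2 : p 2 = 0 := by simpa [hr0, hb] using q0
    have hr1 : r 1 ≠ 0 := fun h => hr' ⟨hr0, h⟩
    have hp3 : p 3 ≠ 0 := fun h => hp' ⟨hp2, h⟩
    refine eq_of_mk_mem_iff fun z hz => ?_
    rw [mk_mem_iff_of_eq, mk_mem_stdB5, hmem]
    constructor
    · rintro ⟨a, b, h⟩
      obtain ⟨e0, -, e2, -⟩ := coords a b z h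
      simp [e0, e2, hr0, hp2]
    · rintro ⟨h0, h2⟩
      refine ⟨z 1 / r 1, z 3 / p 3, ?_⟩
      funext i
      fin_cases i <;> simp [hx0', hxI', hr0, hp2, h0, h2, hr1, hp3]
  · right
    have hp3 : p 3 = 0 := by simpa [hr1, hb] using q1
    have hr0 : r 0 ≠ 0 := fun h => hr' ⟨h, hr1⟩
    have hp2 : p 2 ≠ 0 := fun h => hp' ⟨h, hp3⟩
    refine eq_of_mk_mem_iff fun z hz => ?_
    rw [mk_mem_iff_of_eq, mk_mem_stdB6, hmem]
    constructor
    · rintro ⟨a, b, h⟩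
      obtain ⟨-, e0, -, e2⟩ := coords a b z h
      simp [e0, e2, hr1, hp3]
    · rintro ⟨h0, h2⟩
      refine ⟨z 0 / r 0, z 2 / p 2, ?_⟩
      funext i
      fin_cases i <;> simp [hx0', hxI', hr0, hp2, h0, h2, hr1, hp3]

lemma stdB5_meets_pt {u v : ℂ} : (stdB5 ∩ twistorLine (pt u v)).Nonempty ↔ v = 0 := by
  constructor
  · rintro ⟨x, h, h'⟩
    obtain ⟨z, hz, rfl⟩ := CP3.exists_rep x
    obtain ⟨h0, h2⟩ := mk_mem_stdB5.1 h
    obtain ⟨e0, e1⟩ := mem_twistorLine_pt.1 h'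
    rw [h0, h2] at e0
    rw [h2] at e1
    have h3 : z 3 ≠ 0 := fun h3 => hz (by
      funext i
      fin_cases i
      exacts [h0, by simpa [h3] using e1, h2, h3])
    simpa [h3] using e0
  · rintro rfl
    refine ⟨Projectivization.mk ℂ ![0, conj u, 0, 1] fun h => one_ne_zero (congrFun h 3),
      mk_mem_stdB5.2 ⟨rfl, rfl⟩, mem_twistorLine_pt.2 ?_⟩
    simp

lemma stdB6_meets_pt {u v : ℂ} : (stdB6 ∩ twistorLine (pt u v)).Nonempty ↔ v = 0 := by
  constructor
  · rintro ⟨x, h, h'⟩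
    obtain ⟨z, hz, rfl⟩ := CP3.exists_rep x
    obtain ⟨h0, h2⟩ := mk_mem_stdB6.1 h
    obtain ⟨e0, e1⟩ := mem_twistorLine_pt.1 h'
    rw [h2] at e0
    rw [h0, h2] at e1
    have h3 : z 2 ≠ 0 := fun h3 => hz (by
      funext i
      fin_cases i
      exacts [by simpa [h3] using e0, h0, h3, h2])
    simpa [h3] using e1
  · rintro rfl
    refine ⟨Projectivization.mk ℂ ![u, 0, 1, 0] fun h => one_ne_zero (congrFun h 2),
      mk_mem_stdB6.2 ⟨rfl, rfl⟩, mem_twistorLine_pt.2 ?_⟩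
    simp

lemma stdB5_meets_ptInf : (stdB5 ∩ twistorLine ptInf).Nonempty :=
  ⟨Projectivization.mk ℂ ![0, 1, 0, 0] fun h => one_ne_zero (congrFun h 1),
    mk_mem_stdB5.2 ⟨rfl, rfl⟩, mem_twistorLine_ptInf.2 ⟨rfl, rfl⟩⟩

lemma stdB6_meets_ptInf : (stdB6 ∩ twistorLine ptInf).Nonempty :=
  ⟨Projectivization.mk ℂ ![1, 0, 0, 0] fun h => one_ne_zero (congrFun h 0),
    mk_mem_stdB6.2 ⟨rfl, rfl⟩, mem_twistorLine_ptInf.2 ⟨rfl, rfl⟩⟩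

lemma stdB5_meets (l m : ℂ) (i : Fin 5) : (stdB5 ∩ twistorLine (stdPts l m i)).Nonempty := by
  fin_cases i
  exacts [stdB5_meets_pt.2 rfl, stdB5_meets_pt.2 rfl, stdB5_meets_pt.2 rfl, stdB5_meets_pt.2 rfl,
    stdB5_meets_ptInf]

lemma stdB6_meets (l m : ℂ) (i : Fin 5) : (stdB6 ∩ twistorLine (stdPts l m i)).Nonempty := by
  fin_cases i
  exacts [stdB6_meets_pt.2 rfl, stdB6_meets_pt.2 rfl, stdB6_meets_pt.2 rfl, stdB6_meets_pt.2 rfl,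
    stdB6_meets_ptInf]

lemma stdB5_ne_stdB6 : stdB5 ≠ stdB6 := by
  intro h
  have hz : (![0, 1, 0, 0] : Fin 4 → ℂ) ≠ 0 := fun h => one_ne_zero (congrFun h 1)
  have h5 : Projectivization.mk ℂ _ hz ∈ stdB5 := mk_mem_stdB5.2 ⟨rfl, rfl⟩
  rw [h, mk_mem_stdB6] at h5
  exact one_ne_zero h5.1

lemma jMap_jMap (x : CP3) : jMap (jMap x) = x := by
  obtain ⟨z, hz, rfl⟩ := CP3.exists_rep x
  rw [jMap_mk, jMap_mk, mk_eq_iff]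
  exact ⟨-1, by rw [jLinear_jLinear, neg_smul, one_smul]⟩

lemma jMap_mem_stdB6 {x : CP3} : jMap x ∈ stdB6 ↔ x ∈ stdB5 := by
  obtain ⟨z, hz, rfl⟩ := CP3.exists_rep x
  rw [jMap_mk, mk_mem_stdB6, mk_mem_stdB5]
  simp [jLinear_apply]

lemma jMap_image_stdB5 : jMap '' stdB5 = stdB6 := by
  ext x
  constructor
  · rintro ⟨y, hy, rfl⟩
    exact jMap_mem_stdB6.2 hy
  · intro hx
    refine ⟨jMap x, ?_, jMap_jMap x⟩
    rw [← jMap_mem_stdB6, jMap_jMap]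
    exact hx

lemma image_twistorProj_eq {b : Set CP3} {S : Set HP1}
    (h : ∀ q, (b ∩ twistorLine q).Nonempty ↔ q ∈ S) : twistorProj '' b = S := by
  ext q
  rw [← h]
  rfl

lemma twistorProj_image_stdB5 : twistorProj '' stdB5 = stdSphere := image_twistorProj_eq fun q => by
  rcases eq_pt_or_eq_ptInf q with ⟨u, v, rfl⟩ | rfl
  · rw [stdB5_meets_pt, pt_mem_stdSphere]
  · exact iff_of_true stdB5_meets_ptInf ptInf_mem_stdSphere

lemma twistorProj_image_stdB6 : twistorProj '' stdB6 = stdSphere := image_twistorProj_eq fun q => by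
  rcases eq_pt_or_eq_ptInf q with ⟨u, v, rfl⟩ | rfl
  · rw [stdB6_meets_pt, pt_mem_stdSphere]
  · exact iff_of_true stdB6_meets_ptInf ptInf_mem_stdSphere

lemma IsLine.transform {b : Set CP3} (hb : IsLine b) (g : ProjGroup) : IsLine (transform g b) := by
  obtain ⟨W, hW, rfl⟩ := hb
  refine ⟨W.map g.toLinearEquiv.toLinearMap, ?_, eq_of_mk_mem_iff fun z hz => ?_⟩
  · rw [← hW]
    exact LinearEquiv.finrank_map_eq _ _
  · rw [mem_transform, gl_smul_mk, mk_mem_iff_of_eq, mk_mem_iff_of_eq]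
    constructor
    · intro h
      exact ⟨_, h, smul_inv_smul g z⟩
    · rintro ⟨w, hw, rfl⟩
      change g⁻¹ • g • w ∈ W
      rwa [inv_smul_smul]

/-! ### Transformations that commute with `j` -/

lemma PreservesJ.mul {g h : ProjGroup} (hg : PreservesJ g) (hh : PreservesJ h) :
    PreservesJ (g * h) := fun x => by
  rw [mul_smul, mul_smul, hh, hg]

/-- A linear automorphism of `ℂ⁴` that commutes with `j` is `ℍ`-linear. -/
lemma exists_lifts_of_comm {g : ProjGroup} (h : ∀ z, g • jLinear z = jLinear (g • z)) :
    ∃ T, Lifts g T := by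
  let e := Equiv.ofBijective toQuat ⟨toQuat_injective, toQuat_surjective⟩
  have he : ∀ v, toQuat (e.symm v) = v := fun v => e.apply_symm_apply v
  have he' : ∀ z, e.symm (toQuat z) = z := fun z => e.symm_apply_apply z
  have hsm : ∀ (u v : ℂ) z, quat u v • toQuat z = toQuat (u • z + v • jLinear z) := by
    intro u v z
    rw [map_add, map_smulₛₗ, map_smulₛₗ, toQuat_jLinear, smul_smul, ← add_smul]
    rfl
  let F : (k : ProjGroup) → (∀ z, k • jLinear z = jLinear (k • z)) →
      (Fin 2 → ℍ) →ₗ[ℍ] (Fin 2 → ℍ) := fun k hk =>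
    { toFun := fun v => toQuat (k • e.symm v)
      map_add' := fun v w => by
        have : e.symm (v + w) = e.symm v + e.symm w :=
          toQuat_injective (by simp only [map_add, he])
        rw [this, smul_add, map_add]
      map_smul' := fun c v => by
        obtain ⟨a, b, rfl⟩ := exists_quat c
        have : e.symm (quat a b • v) = a • e.symm v + b • jLinear (e.symm v) :=
          toQuat_injective (by rw [← hsm, he, he])
        rw [this, gl_smul_add, gl_smul_smul, gl_smul_smul, hk, RingHom.id_apply, hsm] }
  have hinv : ∀ z, g⁻¹ • jLinear z = jLinear (g⁻¹ • z) := fun z => by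
    rw [inv_smul_eq_iff, h, smul_inv_smul]
  have hF : ∀ k hk z, F k hk (toQuat z) = toQuat (k • z) := fun k hk z => by
    change toQuat (k • e.symm (toQuat z)) = _
    rw [he']
  refine ⟨⟨F g h, F g⁻¹ hinv, ?_, ?_⟩, fun z => (hF g h z).symm⟩
  · refine LinearMap.ext fun v => ?_
    obtain ⟨z, rfl⟩ := toQuat_surjective v
    rw [Module.End.mul_apply, hF g⁻¹ hinv, hF g h, smul_inv_smul, Module.End.one_apply]
  · refine LinearMap.ext fun v => ?_
    obtain ⟨z, rfl⟩ := toQuat_surjective v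
    rw [Module.End.mul_apply, hF g h, hF g⁻¹ hinv, inv_smul_smul, Module.End.one_apply]

lemma jLinear_smul (c : ℂ) (z : Fin 4 → ℂ) : jLinear (c • z) = conj c • jLinear z :=
  map_smulₛₗ jLinear c z

lemma exists_eq_smul_of_forall {f : (Fin 4 → ℂ) →ₗ[ℂ] (Fin 4 → ℂ)}
    (h : ∀ z, z ≠ 0 → ∃ c : ℂ, f z = c • z) : ∃ a : ℂ, ∀ z, f z = a • z := by
  obtain ⟨a, ha⟩ := f.exists_eq_smul_id_of_forall_notLinearIndependent fun z hli => by
    by_cases hz : z = 0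
    · exact hli.ne_zero 0 hz
    obtain ⟨c, hc⟩ := h z hz
    have := (LinearIndependent.pair_iff.1 hli) c (-1) (by simp [hc])
    simp at this
  exact ⟨a, fun z => by rw [ha]; rfl⟩

/-- A projective transformation that commutes with `j` on `CP³` is represented by a linear map that
commutes with `j` on `ℂ⁴`, hence it comes from a Möbius transformation. -/
lemma PreservesJ.exists_lifts {g : ProjGroup} (h : PreservesJ g) :
    ∃ g' T, Lifts g' T ∧ ∀ x : CP3, g' • x = g • x := by
  let f : (Fin 4 → ℂ) →ₗ[ℂ] (Fin 4 → ℂ) :=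
    { toFun := fun z => jLinear (g⁻¹ • jLinear (g • z))
      map_add' := fun z w => by simp only [gl_smul_add, map_add]
      map_smul' := fun c z => by
        simp only [gl_smul_smul, map_smulₛₗ, Complex.conj_conj, RingHom.id_apply] }
  obtain ⟨a, ha⟩ := exists_eq_smul_of_forall (f := f) (by
    intro z hz
    have hx := h (Projectivization.mk ℂ z hz)
    rw [jMap_mk, gl_smul_mk, gl_smul_mk, jMap_mk, mk_eq_iff] at hx
    obtain ⟨c, hc⟩ := hx
    have hc0 : c ≠ 0 := by
      rintro rfl
      rw [zero_smul] at hc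
      exact gl_smul_ne_zero g (jLinear_ne_zero hz) hc.symm
    refine ⟨-conj c⁻¹, ?_⟩
    have e : jLinear (g • z) = c⁻¹ • (g • jLinear z) := by
      rw [← hc, smul_smul, inv_mul_cancel₀ hc0, one_smul]
    change jLinear (g⁻¹ • jLinear (g • z)) = _
    rw [e, gl_smul_smul, inv_smul_smul, map_smulₛₗ, jLinear_jLinear, smul_neg, neg_smul])
  -- `j g = κ g j` with `κ` of absolute value 1
  set κ : ℂ := -conj a with hκ
  have hg : ∀ z, jLinear (g • z) = κ • (g • jLinear z) := by
    intro z
    have h1 : jLinear (g⁻¹ • jLinear (g • z)) = a • z := ha z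
    have h2 := congrArg jLinear h1
    rw [jLinear_jLinear, jLinear_smul, neg_eq_iff_eq_neg, ← neg_smul, inv_smul_eq_iff,
      gl_smul_smul] at h2
    exact h2
  have hκ1 : conj κ * κ = 1 := by
    have h1 := congrArg jLinear (hg (Pi.single 0 1))
    rw [jLinear_jLinear, map_smulₛₗ, hg, jLinear_jLinear, smul_neg, smul_smul] at h1
    have hne : g • (Pi.single 0 1 : Fin 4 → ℂ) ≠ 0 := gl_smul_ne_zero g (fun h => by
      simpa using congrFun h 0)
    by_contra hne1
    apply hne
    have h2 : (conj κ * κ - 1) • (g • (Pi.single 0 1 : Fin 4 → ℂ)) = 0 := by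
      rw [sub_smul, one_smul, sub_eq_zero]
      simpa using h1.symm
    exact (smul_eq_zero.1 h2).resolve_left (sub_ne_zero.2 hne1)
  obtain ⟨r, hr⟩ := IsAlgClosed.exists_pow_nat_eq κ (n := 2) (by norm_num)
  have hr1 : conj r * r = 1 := by
    have h1 : ‖κ‖ ^ 2 = 1 := by
      have := congrArg norm hκ1
      simpa [sq] using this
    have h2 : ‖κ‖ = 1 := by
      rwa [pow_eq_one_iff_of_nonneg (norm_nonneg κ) two_ne_zero] at h1
    have h3 : ‖r‖ ^ 2 = 1 := by rw [← norm_pow, hr, h2]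
    rw [Complex.conj_mul', ← Complex.ofReal_pow, h3, Complex.ofReal_one]
  have hr0 : r ≠ 0 := by
    rintro rfl
    simp at hr1
  let g' : ProjGroup :=
    { val := r • (g : Module.End ℂ (Fin 4 → ℂ))
      inv := r⁻¹ • ((g⁻¹ : ProjGroup) : Module.End ℂ (Fin 4 → ℂ))
      val_inv := by simp [smul_smul, hr0]
      inv_val := by simp [smul_smul, hr0] }
  have hg' : ∀ z : Fin 4 → ℂ, g' • z = r • (g • z) := fun z => rfl
  obtain ⟨T, hT⟩ := exists_lifts_of_comm (g := g') (fun z => by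
    rw [hg', hg', map_smulₛₗ, hg, smul_smul, ← hr]
    congr 1
    linear_combination -r * hr1)
  refine ⟨g', T, hT, fun x => ?_⟩
  obtain ⟨z, hz, rfl⟩ := CP3.exists_rep x
  rw [gl_smul_mk, gl_smul_mk, mk_eq_iff]
  exact ⟨r, (hg' z).symm⟩

lemma transform_congr {g g' : ProjGroup} (h : ∀ x : CP3, g' • x = g • x) (Y : Set CP3) :
    transform g' Y = transform g Y := by
  simp only [transform, h]

/-! ### Normalization of the five points -/

lemma range_smul (T : MobiusGroup) (p : Fin 5 → HP1) :
    (fun q => T • q) '' Set.range p = Set.range fun i => T • p i := by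
  rw [← Set.range_comp]
  rfl

lemma exists_fin_five {P : Set HP1} (hP : P.ncard = 5) :
    ∃ p : Fin 5 → HP1, Function.Injective p ∧ Set.range p = P := by
  have : Finite P := Set.finite_of_ncard_ne_zero (by rw [hP]; norm_num)
  let e := Finite.equivFinOfCardEq (α := P) (n := 5) hP
  refine ⟨fun i => e.symm i, fun i j h => e.symm.injective (Subtype.ext h), ?_⟩
  ext q
  constructor
  · rintro ⟨i, rfl⟩
    exact (e.symm i).2
  · intro hq
    exact ⟨e ⟨q, hq⟩, by simp⟩

/-- The first, second, fifth and third point can be moved to `0, 1, ∞` and a complex number. -/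
lemma exists_normalize_four {p : Fin 5 → HP1} (hp : Function.Injective p) :
    ∃ T : MobiusGroup, ∃ l u v : ℂ, T • p 0 = pt 0 0 ∧ T • p 1 = pt 1 0 ∧ T • p 4 = ptInf ∧
      T • p 2 = pt l 0 ∧ T • p 3 = pt u v ∧ l ≠ 0 ∧ l ≠ 1 := by
  have hne : ∀ {i j : Fin 5}, i ≠ j → p i ≠ p j := fun hij h => hij (hp h)
  obtain ⟨T, l, h0, h1, hI, hl⟩ := exists_mobius_four (a := p 0) (b := p 1) (c := p 4) (q := p 2)
    (hne (by decide)) (hne (by decide)) (hne (by decide)) (hne (by decide))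
  obtain ⟨u, v, huv⟩ := (eq_pt_or_eq_ptInf (T • p 3)).resolve_right fun h =>
    hne (i := 3) (j := 4) (by decide) (MulAction.injective T (h.trans hI.symm))
  refine ⟨T, l, u, v, h0, h1, hI, hl, huv, ?_, ?_⟩
  · rintro rfl
    exact hne (i := 2) (j := 0) (by decide) (MulAction.injective T (hl.trans h0.symm))
  · rintro rfl
    exact hne (i := 2) (j := 1) (by decide) (MulAction.injective T (hl.trans h1.symm))

lemma eq_stdPts {q : Fin 5 → HP1} {l m : ℂ} (h0 : q 0 = pt 0 0) (h1 : q 1 = pt 1 0)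
    (hI : q 4 = ptInf) (hl : q 2 = pt l 0) (hm : q 3 = pt m 0) (i : Fin 5) :
    q i = stdPts l m i := by
  fin_cases i
  exacts [h0, h1, hl, hm, hI]

lemma isPentad_of_eq {p : Fin 5 → HP1} (hp : Function.Injective p)
    (hP : NoFourConcyclic (Set.range p)) {T : MobiusGroup} {l m : ℂ}
    (h : ∀ i, T • p i = stdPts l m i) : IsPentad l m := by
  have e : (fun i => T • p i) = stdPts l m := funext h
  constructor
  · rw [← e]
    exact fun i j hij => hp (MulAction.injective T hij)
  · rw [← e, ← range_smul]
    exact hP.image T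

/-- If `0, 1, ∞, λ` are among five points of which no four are concyclic, then `λ` is not real. -/
lemma conj_ne_of_noFour {q : Fin 5 → HP1} (hq : Function.Injective q)
    (hP : NoFourConcyclic (Set.range q)) {l : ℂ} (h0 : q 0 = pt 0 0) (h1 : q 1 = pt 1 0)
    (hI : q 4 = ptInf) (hl : q 2 = pt l 0) : conj l ≠ l := by
  intro hc
  have hcard : (q '' {3}ᶜ).ncard = 4 := by
    rw [Set.ncard_image_of_injective _ hq, Set.ncard_compl]
    simp
  have hcase : ∀ x ∈ q '' {3}ᶜ, x = pt 0 0 ∨ x = pt 1 0 ∨ x = pt l 0 ∨ x = ptInf := by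
    rintro _ ⟨i, hi, rfl⟩
    fin_cases i
    · exact Or.inl h0
    · exact Or.inr (Or.inl h1)
    · exact Or.inr (Or.inr (Or.inl hl))
    · exact absurd rfl hi
    · exact Or.inr (Or.inr (Or.inr hI))
  refine hP _ (Set.image_subset_range _ _) hcard
    (exists_circle_of_form (m₀₀ := 0) (m₁₀ := 1) (m₀₁ := -1) (m₁₁ := 0) ?_ (by simp) ?_
      (fun _ => rfl) ?_)
  · rw [← Set.one_lt_ncard_iff_nontrivial, hcard]
    norm_num
  · intro x hx
    rcases hcase x hx with rfl | rfl | rfl | rfl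
    exacts [pt_mem_stdSphere.2 rfl, pt_mem_stdSphere.2 rfl, pt_mem_stdSphere.2 rfl,
      ptInf_mem_stdSphere]
  · intro ν hν
    rcases hcase _ hν with h | h | h | h
    · simp [(pt_inj.1 h).1]
    · simp [(pt_inj.1 h).1]
    · simp [(pt_inj.1 h).1, hc]
    · exact absurd h (pt_ne_ptInf _ _)

lemma im_ne_zero_of_conj_ne {l : ℂ} (h : conj l ≠ l) : l.im ≠ 0 := fun h0 =>
  h (Complex.conj_eq_iff_im.2 h0)

/-- Five points on a round 2-sphere, no four of them concyclic, can be moved to the standard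
sphere. -/
lemma exists_normalize_of_sphere {S : Set HP1} (hS : IsRoundSphere 2 S) {p : Fin 5 → HP1}
    (hp : Function.Injective p) (hpS : ∀ i, p i ∈ S) (hP : NoFourConcyclic (Set.range p)) :
    ∃ (T : MobiusGroup) (l m : ℂ), IsPentad l m ∧ (∀ i, T • p i = stdPts l m i) ∧
      (fun q => T • q) '' S = stdSphere := by
  obtain ⟨T, l, u, v, h0, h1, hI, hl, huv, hl0, hl1⟩ := exists_normalize_four hp
  have hc : conj l ≠ l := conj_ne_of_noFour (q := fun i => T • p i)
    (fun i j hij => hp (MulAction.injective T hij)) (range_smul T p ▸ hP.image T) h0 h1 hI hl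
  have hmem : ∀ i, T • p i ∈ (fun q => T • q) '' S := fun i => ⟨_, hpS i, rfl⟩
  have hST : (fun q => T • q) '' S = stdSphere := eq_stdSphere (hS.image T) (h0 ▸ hmem 0)
    (h1 ▸ hmem 1) (hI ▸ hmem 4) (hl ▸ hmem 2) (im_ne_zero_of_conj_ne hc)
  have hv : v = 0 := by
    have := hmem 3
    rwa [hST, huv, pt_mem_stdSphere] at this
  subst hv
  have heq := eq_stdPts (q := fun i => T • p i) h0 h1 hI hl huv
  exact ⟨T, l, u, isPentad_of_eq hp hP heq, heq, hST⟩

/-- The twistor lines in a non-singular cubic surface lie over points of which no four are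
concyclic. -/
lemma noFourConcyclic_of_mem_cubicsOver {P : Set HP1} {Y : Set CP3} (hY : Y ∈ cubicsOver P) :
    NoFourConcyclic P := by
  rintro A hA hcard ⟨C, hC, hAC⟩
  obtain ⟨a, b, c, e, hab, hac, hae, hbc, hbe, hce, rfl⟩ := Set.ncard_eq_four.1 hcard
  obtain ⟨T, ν, h0, h1, hI, hν⟩ := exists_mobius_four hab hac hbc hce.symm
  obtain ⟨g, hg⟩ := exists_lift T
  obtain ⟨⟨F, hF, hYF⟩, hsub⟩ := hg.transform_mem_cubicsOver hY
  have hmem : ∀ x ∈ ({a, b, c, e} : Set HP1), twistorLine (T • x) ⊆ zeroLocus F := fun x hx =>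
    hYF ▸ hsub ⟨x, hA hx, rfl⟩
  have hmemC : ∀ x ∈ ({a, b, c, e} : Set HP1), T • x ∈ (fun q => T • q) '' C := fun x hx =>
    ⟨x, hAC hx, rfl⟩
  have hν0 : ν ≠ 0 := by
    rintro rfl
    exact hae (MulAction.injective T (h0.trans hν.symm))
  have hν1 : ν ≠ 1 := by
    rintro rfl
    exact hbe (MulAction.injective T (h1.trans hν.symm))
  refine (four_twistorLines hF (h0 ▸ hmem a (by simp)) (h1 ▸ hmem b (by simp))
    (hI ▸ hmem c (by simp)) hν0 hν1 (hν ▸ hmem e (by simp))).1 ?_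
  exact Complex.conj_eq_iff_im.2 (real_of_circle (hC.image T) (h0 ▸ hmemC a (by simp))
    (h1 ▸ hmemC b (by simp)) (hI ▸ hmemC c (by simp)) (hν ▸ hmemC e (by simp))).1

/-- Five points over which a non-singular cubic surface contains the twistor lines can be moved to
the standard sphere. -/
lemma exists_normalize_of_cubic {p : Fin 5 → HP1} (hp : Function.Injective p) {Y : Set CP3}
    (hY : Y ∈ cubicsOver (Set.range p)) :
    ∃ (T : MobiusGroup) (l m : ℂ), IsPentad l m ∧ ∀ i, T • p i = stdPts l m i := by
  obtain ⟨T, l, u, v, h0, h1, hI, hl, huv, hl0, hl1⟩ := exists_normalize_four hp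
  obtain ⟨g, hg⟩ := exists_lift T
  obtain ⟨⟨F, hF, hYF⟩, hsub⟩ := hg.transform_mem_cubicsOver hY
  have hmem : ∀ i, twistorLine (T • p i) ⊆ zeroLocus F := fun i => hYF ▸ hsub ⟨_, ⟨i, rfl⟩, rfl⟩
  have hv := (four_twistorLines hF (h0 ▸ hmem 0) (h1 ▸ hmem 1) (hI ▸ hmem 4) hl0 hl1
    (hl ▸ hmem 2)).2 u v (huv ▸ hmem 3)
  subst hv
  have heq := eq_stdPts (q := fun i => T • p i) h0 h1 hI hl huv
  exact ⟨T, l, u, isPentad_of_eq hp (noFourConcyclic_of_mem_cubicsOver hY) heq, heq⟩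

/-! ### Projective transformations between configurations of twistor lines -/

/-- A projective transformation that maps five twistor lines over points of the standard sphere to
twistor lines acts on these points as a Möbius transformation, although it need not commute with
`j`: its restriction to the line `z₂ = z₄ = 0`, composed with the twistor fibration, extends to a
Möbius transformation. -/
lemma exists_mobius_of_maps_twistorLines {g : ProjGroup} {l m : ℂ} {q : Fin 5 → HP1}
    (h : ∀ i, transform g (twistorLine (stdPts l m i)) = twistorLine (q i)) :
    ∃ T : MobiusGroup, ∀ i, T • stdPts l m i = q i := by
  have proj : ∀ i z (hz : z ≠ 0), Projectivization.mk ℂ z hz ∈ twistorLine (stdPts l m i) →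
      hp (toQuat (g • z)) (toQuat_ne_zero (gl_smul_ne_zero g hz)) = q i := by
    intro i z hz hmem
    have h1 := smul_mem_transform (g := g).2 hmem
    rw [h] at h1
    exact h1
  have hz0 : (![1, 0, 0, 0] : Fin 4 → ℂ) ≠ 0 := fun h => one_ne_zero (congrFun h 0)
  have hz2 : ∀ ν : ℂ, (![ν, 0, 1, 0] : Fin 4 → ℂ) ≠ 0 := fun ν h => one_ne_zero (congrFun h 2)
  have hv := proj 4 _ hz0 (mem_twistorLine_ptInf.2 ⟨rfl, rfl⟩)
  have hpt : ∀ i ν, stdPts l m i = pt ν 0 →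
      hp (toQuat (g • ![ν, 0, 1, 0])) (toQuat_ne_zero (gl_smul_ne_zero g (hz2 ν))) = q i := by
    intro i ν hi
    refine proj i _ (hz2 ν) ?_
    rw [hi, mem_twistorLine_pt]
    simp
  have hw := hpt 0 0 rfl
  obtain ⟨T, h0, h1⟩ := exists_mobius_basis (toQuat_ne_zero (gl_smul_ne_zero g hz0))
    (toQuat_ne_zero (gl_smul_ne_zero g (hz2 0))) (by
      rw [hv, hw]
      intro heq
      have := h 4
      rw [heq, ← h 0] at this
      exact pt_ne_ptInf 0 0 (twistorLine_injective (transform_injective g this)).symm)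
  have main : ∀ i ν, stdPts l m i = pt ν 0 → T • stdPts l m i = q i := by
    intro i ν hi
    rw [← hpt i ν hi, hi, pt, mobius_smul_hp]
    apply hp_congr
    have e : (![ν, 0, 1, 0] : Fin 4 → ℂ) = ν • ![1, 0, 0, 0] + ![0, 0, 1, 0] := by
      funext i
      fin_cases i <;> simp
    have hsm : toQuat (ν • (g • ![1, 0, 0, 0] : Fin 4 → ℂ)) =
        complexToQuat ν • toQuat (g • ![1, 0, 0, 0]) := map_smulₛₗ toQuat _ _
    rw [mobius_smul_eq, h0, h1, e, gl_smul_add, gl_smul_smul, map_add, hsm]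
    simp [complexToQuat_eq_quat, quat_one]
  refine ⟨T, fun i => ?_⟩
  fin_cases i
  · exact main 0 0 rfl
  · exact main 1 1 rfl
  · exact main 2 l rfl
  · exact main 3 m rfl
  · change T • ptInf = q 4
    rw [← hv, ptInf_eq, mobius_smul_hp]
    exact hp_congr h0

/-! ### Diagonal transformations -/

/-- The transformation `(x, y) ↦ (p x, r y)`, where `x = (z₁, z₃)` and `y = (z₂, z₄)`. -/
noncomputable def diag (p r : ℂˣ) : ProjGroup where
  val :=
    { toFun := fun z => ![p * z 0, r * z 1, p * z 2, r * z 3]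
      map_add' := fun z w => by funext i; fin_cases i <;> simp <;> ring
      map_smul' := fun c z => by funext i; fin_cases i <;> simp <;> ring }
  inv :=
    { toFun := fun z => ![↑p⁻¹ * z 0, ↑r⁻¹ * z 1, ↑p⁻¹ * z 2, ↑r⁻¹ * z 3]
      map_add' := fun z w => by funext i; fin_cases i <;> simp <;> ring
      map_smul' := fun c z => by funext i; fin_cases i <;> simp <;> ring }
  val_inv := by
    refine LinearMap.ext fun z => ?_
    funext i
    fin_cases i <;> simp
  inv_val := by
    refine LinearMap.ext fun z => ?_
    funext i
    fin_cases i <;> simp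

lemma diag_smul (p r : ℂˣ) (z : Fin 4 → ℂ) :
    diag p r • z = ![p * z 0, r * z 1, p * z 2, r * z 3] := rfl

lemma transform_eq_of_mem_iff {g : ProjGroup} {Y Z : Set CP3}
    (h : ∀ z hz, Projectivization.mk ℂ (g • z) (gl_smul_ne_zero g hz) ∈ Z ↔
      Projectivization.mk ℂ z hz ∈ Y) : transform g Y = Z := by
  ext x
  obtain ⟨z, hz, rfl⟩ := CP3.exists_rep x
  rw [mem_transform, gl_smul_mk, ← h]
  simp only [smul_inv_smul]

lemma diag_twistorLine (p r : ℂˣ) (l m : ℂ) (i : Fin 5) :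
    transform (diag p r) (twistorLine (stdPts l m i)) = twistorLine (stdPts l m i) := by
  have main : ∀ ν, transform (diag p r) (twistorLine (pt ν 0)) = twistorLine (pt ν 0) := fun ν =>
    transform_eq_of_mem_iff fun z hz => by
      rw [mem_twistorLine_pt, mem_twistorLine_pt]
      simp [diag_smul, mul_assoc]
  fin_cases i
  · exact main 0
  · exact main 1
  · exact main l
  · exact main m
  · have : transform (diag p r) (twistorLine ptInf) = twistorLine ptInf :=
      transform_eq_of_mem_iff fun z hz => by
        rw [mem_twistorLine_ptInf, mem_twistorLine_ptInf]
        simp [diag_smul]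
    exact this

lemma diag_stdB5 (p r : ℂˣ) : transform (diag p r) stdB5 = stdB5 :=
  transform_eq_of_mem_iff fun z hz => by
    rw [mk_mem_stdB5, mk_mem_stdB5]
    simp [diag_smul]

lemma diag_stdB6 (p r : ℂˣ) : transform (diag p r) stdB6 = stdB6 :=
  transform_eq_of_mem_iff fun z hz => by
    rw [mk_mem_stdB6, mk_mem_stdB6]
    simp [diag_smul]

lemma preservesJ_diag {p r : ℂˣ} (h : (r : ℂ) = conj (p : ℂ)) : PreservesJ (diag p r) := by
  intro x
  obtain ⟨z, hz, rfl⟩ := CP3.exists_rep x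
  rw [jMap_mk, gl_smul_mk, gl_smul_mk, jMap_mk, mk_eq_iff]
  refine ⟨1, ?_⟩
  rw [one_smul]
  funext i
  fin_cases i <;> simp [jLinear_apply, diag_smul, h]

lemma transform_diag_pencil (p r : ℂˣ) {b c d α β α' β' : ℂ}
    (h : α * (r * β') = p * α' * β) (hα : α ≠ 0) (hα' : α' ≠ 0) :
    transform (diag p r) (zeroLocus (pencil b c d α β)) = zeroLocus (pencil b c d α' β') := by
  refine transform_zeroLocus (isHomogeneous_pencil _ _ _ _ _) (isHomogeneous_pencil _ _ _ _ _)
    fun z => ?_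
  have e : α * eval (diag p r • z) (pencil b c d α' β') =
      p ^ 2 * r * α' * eval z (pencil b c d α β) := by
    rw [eval_pencil, eval_pencil, eval_cubicForm, eval_cubicForm, eval_conjForm, eval_conjForm,
      diag_smul]
    simp only [Matrix.cons_val]
    linear_combination p * r * (z 1 ^ 2 * z 2 + conj b * z 0 * z 1 * z 3 +
      conj c * z 1 * z 2 * z 3 + conj d * z 0 * z 3 ^ 2) * h
  have hne : (p : ℂ) ^ 2 * r * α' ≠ 0 :=
    mul_ne_zero (mul_ne_zero (pow_ne_zero 2 p.ne_zero) r.ne_zero) hα'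
  constructor
  · intro h0
    rw [h0, mul_zero] at e
    exact (mul_eq_zero.1 e.symm).resolve_left hne
  · intro h0
    rw [h0, mul_zero] at e
    exact (mul_eq_zero.1 e).resolve_left hα

/-- Members of the pencil with proportional absolute values of the coefficients are related by a
diagonal transformation that commutes with `j`. -/
lemma exists_diag_of_norm_eq {b c d α β α' β' : ℂ} (hα : α ≠ 0) (hβ : β ≠ 0) (hα' : α' ≠ 0)
    (hβ' : β' ≠ 0) (h : ‖α / β‖ = ‖α' / β'‖) : ∃ p r : ℂˣ, PreservesJ (diag p r) ∧
      transform (diag p r) (zeroLocus (pencil b c d α β)) = zeroLocus (pencil b c d α' β') := by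
  -- the diagonal transformation `(p, conj p)` with `|p| = 1` divides `α / β` by `p ^ 2`
  set κ := α * β' / (α' * β) with hκ
  have hκ0 : κ ≠ 0 := div_ne_zero (mul_ne_zero hα hβ') (mul_ne_zero hα' hβ)
  have hκ1 : ‖κ‖ = 1 := by
    have : κ = (α / β) / (α' / β') := by rw [hκ]; field_simp
    rw [this, norm_div, h, div_self]
    exact norm_ne_zero_iff.2 (div_ne_zero hα' hβ')
  obtain ⟨s, hs⟩ := IsAlgClosed.exists_pow_nat_eq κ (n := 2) (by norm_num)
  have hs0 : s ≠ 0 := by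
    rintro rfl
    exact hκ0 (by rw [← hs]; simp)
  have hs1 : s * conj s = 1 := by
    have h3 : ‖s‖ ^ 2 = 1 := by rw [← norm_pow, hs, hκ1]
    rw [Complex.mul_conj', ← Complex.ofReal_pow, h3, Complex.ofReal_one]
  refine ⟨Units.mk0 s hs0, Units.mk0 (conj s) (by simpa using hs0), preservesJ_diag rfl,
    transform_diag_pencil _ _ ?_ hα hα'⟩
  have hk : α * β' = s ^ 2 * (α' * β) := by
    rw [hs, hκ]
    field_simp
  simp only [Units.val_mk0]
  linear_combination conj s * hk + s * α' * β * hs1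

/-! ### Conformal symmetries of the pencil -/

/-- A transformation that commutes with `j` and permutes the five twistor lines preserves or
interchanges the two singular members of the pencil. -/
lemma IsSol.pullback_cases {l m b c d : ℂ} (hs : IsSol l m b c d) (hp : IsPentad l m)
    {g : ProjGroup} {T : MobiusGroup} (hg : Lifts g T)
    (hT : ∀ i, T • stdPts l m i ∈ Set.range (stdPts l m)) :
    (∃ κ, κ ≠ 0 ∧ ∀ z, eval (g • z) (cubicForm b c d) = κ * eval z (cubicForm b c d) ∧
      eval (g • z) (conjForm b c d) = conj κ * eval z (conjForm b c d)) ∨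
    (∃ κ, κ ≠ 0 ∧ ∀ z, eval (g • z) (cubicForm b c d) = κ * eval z (conjForm b c d) ∧
      eval (g • z) (conjForm b c d) = -conj κ * eval z (cubicForm b c d)) := by
  have h10 : pencil b c d 1 0 = cubicForm b c d := by simp [pencil]
  have hhom := isHomogeneous_cubicForm b c d
  obtain ⟨α, β, hαβ⟩ := hs.exists_eq_pencil hp (isHomogeneous_pullback hhom g) fun i => by
    rw [← transform_mono (g := g), transform_zeroLocus_pullback hhom, hg.transform_twistorLine]
    obtain ⟨j, hj⟩ := hT i
    rw [← hj, ← h10]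
    exact hs.twistorLine_subset 1 0 j
  have hev : ∀ z, eval (g • z) (cubicForm b c d) =
      α * eval z (cubicForm b c d) + β * eval z (conjForm b c d) := fun z => by
    rw [← eval_pullback, hαβ, eval_pencil]
  have hconj : ∀ z, eval (g • z) (conjForm b c d) =
      conj α * eval z (conjForm b c d) - conj β * eval z (cubicForm b c d) := fun z => by
    rw [← conj_eval_cubicForm_jLinear, ← hg.jLinear, hev, map_add, map_mul, map_mul,
      conj_eval_cubicForm_jLinear, conj_eval_conjForm_jLinear]
    ring
  -- the transform of `f` is a singular member of the pencil
  have hsing : SingAt (pencil b c d α β) (g⁻¹ • ![0, 1, 0, 0]) := by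
    rw [← hαβ, singAt_pullback, smul_inv_smul, ← h10]
    exact singAt_pencil_left b c d 1
  have hz0 : (g⁻¹ • ![0, 1, 0, 0] : Fin 4 → ℂ) ≠ 0 :=
    gl_smul_ne_zero _ fun h => one_ne_zero (congrFun h 1)
  have hor : α = 0 ∨ β = 0 := by
    by_contra hno
    push Not at hno
    exact (isNonsingularForm_iff.1 (hs.isNonsingularForm_pencil hp hno.1 hno.2)).2 _ hz0 hsing
  have hnot : ¬ (α = 0 ∧ β = 0) := by
    rintro ⟨rfl, rfl⟩
    have := hev (g⁻¹ • ![1, 0, 0, 1])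
    rw [smul_inv_smul, eval_cubicForm] at this
    simp at this
  rcases hor with rfl | rfl
  · right
    refine ⟨β, fun h => hnot ⟨rfl, h⟩, fun z => ⟨?_, ?_⟩⟩
    · rw [hev]; ring
    · rw [hconj, map_zero]; ring
  · left
    refine ⟨α, fun h => hnot ⟨h, rfl⟩, fun z => ⟨?_, ?_⟩⟩
    · rw [hev]; ring
    · rw [hconj, map_zero]; ring

lemma pencil_eq_of_transform {g : ProjGroup} {b c d α β α' β' γ δ : ℂ} (hα : α ≠ 0) (hβ : β ≠ 0)
    (hg : transform g (zeroLocus (pencil b c d α β)) = zeroLocus (pencil b c d α' β'))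
    (h : ∀ z, eval (g • z) (pencil b c d α' β') = eval z (pencil b c d γ δ)) :
    α * δ = γ * β := by
  have h1 : transform g (zeroLocus (pencil b c d γ δ)) = zeroLocus (pencil b c d α' β') :=
    transform_zeroLocus (isHomogeneous_pencil _ _ _ _ _) (isHomogeneous_pencil _ _ _ _ _)
      fun z => by rw [h]
  exact pencil_zeroLocus_injective hα hβ (transform_injective g (hg.trans h1.symm))

/-- A transformation that commutes with `j` and permutes the five twistor lines preserves or inverts
the absolute value of the parameter of a member of the pencil. -/
lemma IsSol.norm_of_transform {l m b c d : ℂ} (hs : IsSol l m b c d) (hp : IsPentad l m)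
    {g : ProjGroup} {T : MobiusGroup} (hg : Lifts g T)
    (hT : ∀ i, T • stdPts l m i ∈ Set.range (stdPts l m)) {s t : ℂ} (hs0 : s ≠ 0)
    (h : transform g (zeroLocus (pencil b c d 1 s)) = zeroLocus (pencil b c d 1 t)) :
    ‖s‖ = ‖t‖ ∨ ‖s‖ * ‖t‖ = 1 := by
  rcases hs.pullback_cases hp hg hT with ⟨κ, hκ, hz⟩ | ⟨κ, hκ, hz⟩
  · left
    have := pencil_eq_of_transform (γ := κ) (δ := t * conj κ) one_ne_zero hs0 h fun z => by
      rw [eval_pencil, eval_pencil, (hz z).1, (hz z).2]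
      ring
    have hn := congrArg norm this
    rw [one_mul, norm_mul, norm_mul, Complex.norm_conj, mul_comm] at hn
    exact (mul_left_cancel₀ (norm_ne_zero_iff.2 hκ) hn).symm
  · right
    have := pencil_eq_of_transform (γ := -(t * conj κ)) (δ := κ) one_ne_zero hs0 h fun z => by
      rw [eval_pencil, eval_pencil, (hz z).1, (hz z).2]
      ring
    have hn := congrArg norm this
    rw [one_mul, norm_mul, norm_neg, norm_mul, Complex.norm_conj] at hn
    have hκ' := norm_ne_zero_iff.2 hκ
    exact mul_left_cancel₀ hκ' (by linear_combination -hn)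

/-- A transformation that commutes with `j` and fixes the five twistor lines preserves the ratio of
the absolute values of the coefficients: it cannot interchange the two singular members, because
it would interchange the two transversals, which forces the cross-ratio `λ` to be real. -/
lemma IsSol.norm_of_transform_fix {l m b c d : ℂ} (hs : IsSol l m b c d) (hp : IsPentad l m)
    {g : ProjGroup} {T : MobiusGroup} (hg : Lifts g T)
    (hT : ∀ i, T • stdPts l m i = stdPts l m i) {α β α' β' : ℂ} (hα : α ≠ 0) (hβ : β ≠ 0)
    (hβ' : β' ≠ 0)
    (h : transform g (zeroLocus (pencil b c d α β)) = zeroLocus (pencil b c d α' β')) :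
    ‖α / β‖ = ‖α' / β'‖ := by
  rcases hs.pullback_cases hp hg fun i => ⟨i, (hT i).symm⟩ with ⟨κ, hκ, hz⟩ | ⟨κ, hκ, hz⟩
  · have := pencil_eq_of_transform (γ := α' * κ) (δ := β' * conj κ) hα hβ h fun z => by
      rw [eval_pencil, eval_pencil, (hz z).1, (hz z).2]
      ring
    have hn := congrArg norm this
    rw [norm_mul, norm_mul, norm_mul, norm_mul, Complex.norm_conj] at hn
    rw [norm_div, norm_div, div_eq_div_iff (norm_ne_zero_iff.2 hβ) (norm_ne_zero_iff.2 hβ')]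
    exact mul_left_cancel₀ (norm_ne_zero_iff.2 hκ) (by linear_combination hn)
  · exfalso
    have hpull : pullback g (pencil b c d 1 0) = pencil b c d 0 κ :=
      MvPolynomial.funext fun z => by
        rw [eval_pullback, eval_pencil, eval_pencil, (hz z).1]
        ring
    -- the transformation maps the line `y = 0` to the line `x = 0`
    have hx : ∀ x₀ x₁ : ℂ, (g • ![x₀, 0, x₁, 0] : Fin 4 → ℂ) 0 = 0 ∧
        (g • ![x₀, 0, x₁, 0] : Fin 4 → ℂ) 2 = 0 := by
      intro x₀ x₁
      have hsing : SingAt (pullback g (pencil b c d 1 0)) ![x₀, 0, x₁, 0] := by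
        rw [hpull]
        obtain ⟨e0, e1, e2, e3⟩ := eval_pderiv_pencil b c d 0 κ ![x₀, 0, x₁, 0]
        refine ⟨by simp [eval_pencil, eval_conjForm], fun i => ?_⟩
        fin_cases i
        · exact e0.trans (by simp)
        · exact e1.trans (by simp)
        · exact e2.trans (by simp)
        · exact e3.trans (by simp)
      have h2 := (singAt_pullback.1 hsing).2
      obtain ⟨-, e1, -, e3⟩ := eval_pderiv_pencil b c d 1 0 (g • ![x₀, 0, x₁, 0])
      rw [h2 1] at e1
      rw [h2 3] at e3
      exact hs.not_common_zero hp (by linear_combination -e1) (by linear_combination -e3)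
    have hfix : ∀ i z (hz : z ≠ 0), Projectivization.mk ℂ z hz ∈ twistorLine (stdPts l m i) →
        Projectivization.mk ℂ (g • z) (gl_smul_ne_zero g hz) ∈ twistorLine (stdPts l m i) := by
      intro i z hz hm
      have h1 := smul_mem_transform (g := g).2 hm
      rwa [hg.transform_twistorLine, hT] at h1
    set v := g • (![1, 0, 0, 0] : Fin 4 → ℂ) with hv
    set w := g • (![0, 0, 1, 0] : Fin 4 → ℂ) with hw
    have hlin : ∀ ν : ℂ, g • (![ν, 0, 1, 0] : Fin 4 → ℂ) = ν • v + w := fun ν => by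
      rw [hv, hw, ← gl_smul_smul, ← gl_smul_add]
      congr 1
      funext i
      fin_cases i <;> simp
    have hne : (![1, 0, 0, 0] : Fin 4 → ℂ) ≠ 0 := fun h => one_ne_zero (congrFun h 0)
    obtain ⟨-, hv3⟩ := mem_twistorLine_ptInf.1 (hfix 4 _ hne
      (mem_twistorLine_ptInf.2 ⟨rfl, rfl⟩))
    have hpt : ∀ i ν, stdPts l m i = pt ν 0 → ν * v 1 + w 1 = w 3 * conj ν := by
      intro i ν hi
      have hz : (![ν, 0, 1, 0] : Fin 4 → ℂ) ≠ 0 := fun h => one_ne_zero (congrFun h 2)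
      have h1 := hfix i _ hz (by rw [hi, mem_twistorLine_pt]; simp)
      rw [hi, mem_twistorLine_pt, hlin] at h1
      have h2 := h1.2
      simp only [Pi.add_apply, Pi.smul_apply, smul_eq_mul, mul_zero, zero_add] at h2
      rw [h2, show v 3 = 0 from hv3]
      ring
    have k0 := hpt 0 0 rfl
    have k1 := hpt 1 1 rfl
    have kl := hpt 2 l rfl
    simp only [map_zero, map_one, mul_zero, zero_mul, zero_add, mul_one, one_mul] at k0 k1
    rw [k0, add_zero] at k1 kl
    have hv1 : v 1 ≠ 0 := by
      intro hv1
      apply gl_smul_ne_zero g hne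
      funext i
      fin_cases i
      · exact (hx 1 0).1
      · exact hv1
      · exact (hx 1 0).2
      · exact hv3
    rw [← k1] at kl
    exact hp.conj_ne (mul_left_cancel₀ hv1 (by linear_combination -kl))

/-! ### Normal forms of labelled configurations -/

/-- The map `(z₁, z₂, z₃, z₄) ↦ (-z₂, z₁, -z₄, z₃)`, i.e. right multiplication by `j` on `ℍ²`. -/
noncomputable def rightJ : ProjGroup where
  val :=
    { toFun := fun z => ![-z 1, z 0, -z 3, z 2]
      map_add' := fun z w => by funext i; fin_cases i <;> simp <;> ring
      map_smul' := fun c z => by funext i; fin_cases i <;> simp }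
  inv :=
    { toFun := fun z => ![z 1, -z 0, z 3, -z 2]
      map_add' := fun z w => by funext i; fin_cases i <;> simp <;> ring
      map_smul' := fun c z => by funext i; fin_cases i <;> simp }
  val_inv := by
    refine LinearMap.ext fun z => ?_
    funext i
    fin_cases i <;> simp
  inv_val := by
    refine LinearMap.ext fun z => ?_
    funext i
    fin_cases i <;> simp

lemma rightJ_smul (z : Fin 4 → ℂ) : rightJ • z = ![-z 1, z 0, -z 3, z 2] := rfl

/-- The reflection of the standard sphere in the real circle is induced by a Möbius transformation
whose lift interchanges the two lines over the sphere. -/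
lemma exists_reflection : ∃ (g : ProjGroup) (R : MobiusGroup), Lifts g R ∧
    (∀ ν, R • pt ν 0 = pt (conj ν) 0) ∧ R • ptInf = ptInf ∧
    transform g stdB5 = stdB6 ∧ transform g stdB6 = stdB5 := by
  obtain ⟨R, hR⟩ := exists_lifts_of_comm (g := rightJ) fun z => by
    funext i
    fin_cases i <;> simp [rightJ_smul, jLinear_apply]
  refine ⟨rightJ, R, hR, fun ν => ?_, ?_, ?_, ?_⟩
  · apply twistorLine_injective
    rw [← hR.transform_twistorLine]
    refine transform_eq_of_mem_iff fun z hz => ?_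
    rw [mem_twistorLine_pt, mem_twistorLine_pt]
    simp [rightJ_smul, and_comm]
  · apply twistorLine_injective
    rw [← hR.transform_twistorLine]
    refine transform_eq_of_mem_iff fun z hz => ?_
    rw [mem_twistorLine_ptInf, mem_twistorLine_ptInf]
    simp [rightJ_smul, and_comm]
  · refine transform_eq_of_mem_iff fun z hz => ?_
    rw [mk_mem_stdB5, mk_mem_stdB6]
    simp [rightJ_smul]
  · refine transform_eq_of_mem_iff fun z hz => ?_
    rw [mk_mem_stdB5, mk_mem_stdB6]
    simp [rightJ_smul]

/-- `g` lifts the Möbius transformation `T`, which moves the five points to `0, 1, λ, μ, ∞`, and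
moves the two transversals to the standard ones. -/
structure LabelledPoints.IsNormal (c : LabelledPoints) (g : ProjGroup) (T : MobiusGroup)
    (l m : ℂ) : Prop where
  lifts : Lifts g T
  pentad : IsPentad l m
  smul_p : ∀ i, T • c.p i = stdPts l m i
  b5 : transform g c.b5 = stdB5
  b6 : transform g c.b6 = stdB6

lemma nonempty_transform_inter {g : ProjGroup} {T : MobiusGroup} (hg : Lifts g T) {b : Set CP3}
    {q : HP1} (h : (b ∩ twistorLine q).Nonempty) :
    (transform g b ∩ twistorLine (T • q)).Nonempty := by
  rw [← hg.transform_twistorLine, ← transform_inter]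
  exact h.image _

/-- Every labelled configuration without concyclic quadruples has a normal form. The transversals
determine which of `λ, μ` and `conj λ, conj μ` is to be used. -/
lemma LabelledPoints.exists_isNormal (c : LabelledPoints)
    (h : NoFourConcyclic (Set.range c.p)) : ∃ g T l m, c.IsNormal g T l m := by
  obtain ⟨T, l, u, v, h0, h1, hI, hl, huv, hl0, hl1⟩ := exists_normalize_four c.p_injective
  obtain ⟨g, hg⟩ := exists_lift T
  have hc : conj l ≠ l := conj_ne_of_noFour (q := fun i => T • c.p i)
    (fun i j hij => c.p_injective (MulAction.injective T hij)) (range_smul T c.p ▸ h.image T)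
    h0 h1 hI hl
  have hcases : ∀ b, IsLine b → (∀ i, (b ∩ twistorLine (c.p i)).Nonempty) →
      (transform g b = stdB5 ∨ transform g b = stdB6) ∧ v = 0 := by
    intro b hb hm
    have hm' := fun i => nonempty_transform_inter hg (hm i)
    have hcase := eq_of_isLine_of_meets (hb.transform g) hc (h0 ▸ hm' 0) (h1 ▸ hm' 1) (hI ▸ hm' 4)
      (hl ▸ hm' 2)
    refine ⟨hcase, ?_⟩
    have h3 := hm' 3
    rw [huv] at h3
    rcases hcase with e | e <;> rw [e] at h3
    exacts [stdB5_meets_pt.1 h3, stdB6_meets_pt.1 h3]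
  obtain ⟨h5, rfl⟩ := hcases _ c.b5_line c.b5_meets
  obtain ⟨h6, -⟩ := hcases _ c.b6_line c.b6_meets
  have hne : transform g c.b5 ≠ transform g c.b6 := fun e =>
    c.b5_ne_b6 (transform_injective g e)
  have heq := eq_stdPts (q := fun i => T • c.p i) h0 h1 hI hl huv
  rcases h5 with h5 | h5 <;> rcases h6 with h6 | h6
  · exact absurd (h5.trans h6.symm) hne
  · exact ⟨g, T, l, u, hg, isPentad_of_eq c.p_injective h heq, heq, h5, h6⟩
  · obtain ⟨k, R, hk, hpt, hinf, h56, h65⟩ := exists_reflection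
    have heq' := eq_stdPts (q := fun i => (R * T) • c.p i) (l := conj l) (m := conj u)
      (by rw [mul_smul, h0, hpt, map_zero]) (by rw [mul_smul, h1, hpt, map_one])
      (by rw [mul_smul, hI, hinf]) (by rw [mul_smul, hl, hpt]) (by rw [mul_smul, huv, hpt])
    refine ⟨k * g, R * T, conj l, conj u, hk.mul hg, isPentad_of_eq c.p_injective h heq', heq',
      ?_, ?_⟩
    · rw [transform_mul, h5, h65]
    · rw [transform_mul, h6, h56]
  · exact absurd (h5.trans h6.symm) hne

lemma through_iff {Y : Set CP3} {v : Fin 4 → ℂ} (hv : v ≠ 0) :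
    Through Y v ↔ Projectivization.mk ℂ v hv ∈ Y := by
  constructor
  · rintro ⟨x, hx, h⟩
    rw [← Projectivization.submodule_mk v hv] at h
    rwa [← Projectivization.submodule_injective h]
  · exact fun h => ⟨_, h, Projectivization.submodule_mk v hv⟩

lemma eq_of_through {p q : HP1} {v : Fin 4 → ℂ} (hv : v ≠ 0)
    (hp : Through (twistorLine p) v) (hq : Projectivization.mk ℂ v hv ∈ twistorLine q) : p = q :=
  Eq.trans (Eq.symm ((through_iff hv).1 hp)) hq

lemma LabelledPoints.IsNormal.adapted {c : LabelledPoints} {g : ProjGroup} {T : MobiusGroup}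
    {l m : ℂ} (h : c.IsNormal g T l m) : c.Adapted g := by
  have e : ∀ i, transform g (twistorLine (c.p i)) = twistorLine (stdPts l m i) := fun i => by
    rw [h.lifts.transform_twistorLine, h.smul_p]
  refine ⟨h.lifts.preservesJ, h.b5, h.b6, ?_, ?_, ?_, ?_, ?_, ?_⟩ <;> rw [e]
  · exact (through_iff fun h => one_ne_zero (congrFun h 3)).2 (mem_twistorLine_pt.2 (by simp))
  · exact (through_iff fun h => one_ne_zero (congrFun h 1)).2 (mem_twistorLine_pt.2 (by simp))
  · exact (through_iff fun h => one_ne_zero (congrFun h 1)).2 (mem_twistorLine_ptInf.2 (by simp))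
  · exact (through_iff fun h => one_ne_zero (congrFun h 2)).2 (mem_twistorLine_pt.2 (by simp))
  · exact (through_iff fun h => one_ne_zero (congrFun h 0)).2 (mem_twistorLine_pt.2 (by simp))
  · exact (through_iff fun h => one_ne_zero (congrFun h 0)).2 (mem_twistorLine_ptInf.2 (by simp))

/-- Adapted coordinates are normal coordinates, up to a scalar factor. -/
lemma LabelledPoints.Adapted.exists_isNormal {c : LabelledPoints} {g : ProjGroup}
    (h : c.Adapted g) (hP : NoFourConcyclic (Set.range c.p)) :
    ∃ g' T l m, c.IsNormal g' T l m ∧ ∀ x : CP3, g' • x = g • x := by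
  obtain ⟨hJ, h5, h6, t0, t1, tI, -⟩ := h
  obtain ⟨g', T, hg', hx⟩ := hJ.exists_lifts
  rw [← transform_congr hx, hg'.transform_twistorLine] at t0 t1 tI
  rw [← transform_congr hx] at h5 h6
  have e0 : T • c.p 0 = pt 0 0 := eq_of_through (fun h => one_ne_zero (congrFun h 3)) t0
    (mem_twistorLine_pt.2 (by simp))
  have e1 : T • c.p 1 = pt 1 0 := eq_of_through (fun h => one_ne_zero (congrFun h 1)) t1
    (mem_twistorLine_pt.2 (by simp))
  have eI : T • c.p 4 = ptInf := eq_of_through (fun h => one_ne_zero (congrFun h 1)) tI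
    (mem_twistorLine_ptInf.2 (by simp))
  have hpt : ∀ i, i ≠ 4 → ∃ ν, T • c.p i = pt ν 0 := by
    intro i hi
    obtain ⟨u, v, huv⟩ := (eq_pt_or_eq_ptInf (T • c.p i)).resolve_right fun h =>
      hi (c.p_injective (MulAction.injective T (h.trans eI.symm)))
    have hm := nonempty_transform_inter hg' (c.b5_meets i)
    rw [h5, huv] at hm
    obtain rfl := stdB5_meets_pt.1 hm
    exact ⟨u, huv⟩
  obtain ⟨l, hl⟩ := hpt 2 (by decide)
  obtain ⟨m, hm⟩ := hpt 3 (by decide)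
  have heq := eq_stdPts (q := fun i => T • c.p i) e0 e1 eI hl hm
  exact ⟨g', T, l, m, ⟨hg', isPentad_of_eq c.p_injective hP heq, heq, h5, h6⟩, hx⟩

/-- A transformation that preserves the line `z₂ = z₄ = 0` and fixes `0, 1, ∞` fixes the standard
sphere pointwise. -/
lemma smul_pt_eq_of_fix {h : ProjGroup} {R : MobiusGroup} (hR : Lifts h R)
    (h6 : transform h stdB6 = stdB6) (h0 : R • pt 0 0 = pt 0 0) (h1 : R • pt 1 0 = pt 1 0)
    (hI : R • ptInf = ptInf) (ν : ℂ) : R • pt ν 0 = pt ν 0 := by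
  have hz : ∀ ν : ℂ, (![ν, 0, 1, 0] : Fin 4 → ℂ) ≠ 0 := fun ν h => one_ne_zero (congrFun h 2)
  have hz0 : (![1, 0, 0, 0] : Fin 4 → ℂ) ≠ 0 := fun h => one_ne_zero (congrFun h 0)
  have hmem : ∀ ν : ℂ, Projectivization.mk ℂ _ (hz ν) ∈ twistorLine (pt ν 0) := fun ν =>
    mem_twistorLine_pt.2 (by simp)
  have hfix : ∀ q z (hz : z ≠ 0), Projectivization.mk ℂ z hz ∈ twistorLine q →
      Projectivization.mk ℂ (h • z) (gl_smul_ne_zero h hz) ∈ twistorLine (R • q) := by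
    intro q z hz hm
    rw [← hR.transform_twistorLine]
    exact smul_mem_transform (g := h).2 hm
  have h6' : ∀ z (hz : z ≠ 0), Projectivization.mk ℂ z hz ∈ stdB6 →
      (h • z) 1 = 0 ∧ (h • z) 3 = 0 := by
    intro z hz hm
    have := smul_mem_transform (g := h).2 hm
    rw [h6] at this
    exact mk_mem_stdB6.1 this
  set v := h • (![1, 0, 0, 0] : Fin 4 → ℂ) with hv
  set w := h • (![0, 0, 1, 0] : Fin 4 → ℂ) with hw
  have hlin : ∀ ν : ℂ, h • (![ν, 0, 1, 0] : Fin 4 → ℂ) = ν • v + w := fun ν => by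
    rw [hv, hw, ← gl_smul_smul, ← gl_smul_add]
    congr 1
    funext i
    fin_cases i <;> simp
  obtain ⟨v1, v3⟩ : v 1 = 0 ∧ v 3 = 0 := h6' _ hz0 (mk_mem_stdB6.2 ⟨rfl, rfl⟩)
  obtain ⟨w1, w3⟩ : w 1 = 0 ∧ w 3 = 0 := h6' _ (hz 0) (mk_mem_stdB6.2 ⟨rfl, rfl⟩)
  have v2 : v 2 = 0 := by
    have := hfix ptInf _ hz0 (mem_twistorLine_ptInf.2 ⟨rfl, rfl⟩)
    rw [hI] at this
    exact (mem_twistorLine_ptInf.1 this).1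
  have w0 : w 0 = 0 := by
    have := hfix _ _ (hz 0) (hmem 0)
    rw [h0, mem_twistorLine_pt] at this
    simpa using this.1
  have hvw : v 0 = w 2 := by
    have := hfix _ _ (hz 1) (hmem 1)
    rw [h1, mem_twistorLine_pt, hlin] at this
    simpa [v2, w0] using this.1
  refine Eq.trans (Eq.symm (hfix _ _ (hz ν) (hmem ν))) ?_
  refine mem_twistorLine_pt.2 ?_
  rw [hlin]
  simp [v1, v2, v3, w0, w1, w3, hvw, mul_comm]

/-- The parameters of a normal form of a labelled configuration are unique. -/
lemma LabelledPoints.IsNormal.eq {c : LabelledPoints} {g g' : ProjGroup} {T T' : MobiusGroup}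
    {l m l' m' : ℂ} (h : c.IsNormal g T l m) (h' : c.IsNormal g' T' l' m') :
    l' = l ∧ m' = m := by
  have hR : ∀ i, (T' * T⁻¹) • stdPts l m i = stdPts l' m' i := fun i => by
    rw [← h.smul_p, mul_smul, inv_smul_smul, h'.smul_p]
  have hB : transform (g' * g⁻¹) stdB6 = stdB6 := by
    rw [transform_mul, ← h.b6, transform_inv_transform, h'.b6, h.b6]
  have hfix := smul_pt_eq_of_fix (h'.lifts.mul h.lifts.inv) hB (hR 0) (hR 1) (hR 4)
  exact ⟨(pt_inj.1 ((hR 2).symm.trans (hfix l))).1, (pt_inj.1 ((hR 3).symm.trans (hfix m))).1⟩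

lemma LabelledPoints.IsNormal.of_carries {c c' : LabelledPoints} {g k : ProjGroup}
    {T S : MobiusGroup} {l m : ℂ} (h : c'.IsNormal g T l m) (hk : Lifts k S)
    (hc : LabelledPoints.Carries k c c') : c.IsNormal (g * k) (T * S) l m := by
  refine ⟨h.lifts.mul hk, h.pentad, fun i => ?_, ?_, ?_⟩
  · have e : S • c.p i = c'.p i := twistorLine_injective (by
      rw [← hk.transform_twistorLine, hc.1])
    rw [mul_smul, e, h.smul_p]
  · rw [transform_mul, hc.2.1, h.b5]
  · rw [transform_mul, hc.2.2, h.b6]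

lemma LabelledPoints.Carries.congr {c c' : LabelledPoints} {g g' : ProjGroup}
    (h : LabelledPoints.Carries g c c') (hx : ∀ x : CP3, g' • x = g • x) :
    LabelledPoints.Carries g' c c' := by
  simpa only [LabelledPoints.Carries, transform_congr hx] using h

/-! ### The invariant `ξ` -/

/-- The coefficients of `z₄ z₁²` and `z₃ z₂²` in a member of the pencil. -/
lemma coeff_pencil (b c d α β : ℂ) :
    (pencil b c d α β).coeff (Finsupp.single 3 1 + Finsupp.single 0 2) = α ∧
    (pencil b c d α β).coeff (Finsupp.single 2 1 + Finsupp.single 1 2) = β := by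
  have hm : ∀ (a : ℂ) (i j k : Fin 4), (C a * X i * X j * X k : MvPolynomial (Fin 4) ℂ) =
      MvPolynomial.monomial (Finsupp.single i 1 + Finsupp.single j 1 + Finsupp.single k 1) a := by
    intro a i j k
    simp only [MvPolynomial.X, MvPolynomial.C_mul_monomial, MvPolynomial.monomial_mul, mul_one]
  have e : pencil b c d α β = C α * X 0 * X 0 * X 3 + C (α * b) * X 0 * X 1 * X 2 +
      C (α * c) * X 0 * X 2 * X 3 + C (α * d) * X 1 * X 2 * X 2 + (C β * X 1 * X 1 * X 2 +
      C (β * conj b) * X 0 * X 1 * X 3 + C (β * conj c) * X 1 * X 2 * X 3 +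
      C (β * conj d) * X 0 * X 3 * X 3) := by
    simp only [pencil, cubicForm, conjForm, map_mul]
    ring
  rw [e]
  simp only [hm, MvPolynomial.coeff_add, MvPolynomial.coeff_monomial, Finsupp.ext_iff,
    Fin.forall_fin_succ, Finsupp.add_apply, Finsupp.single_apply]
  constructor <;> simp [Fin.ext_iff]

lemma LabelledCubic.mem_cubicsOver (L : LabelledCubic) : L.X ∈ cubicsOver (Set.range L.p) := by
  refine ⟨L.nonsingular, ?_⟩
  rintro _ ⟨i, rfl⟩
  exact L.twistorLine_subset i

lemma LabelledPoints.IsNormal.transform_mem_cubicsOver {L : LabelledCubic} {g : ProjGroup}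
    {T : MobiusGroup} {l m : ℂ} (h : L.IsNormal g T l m) :
    transform g L.X ∈ cubicsOver (Set.range (stdPts l m)) := by
  have := h.lifts.transform_mem_cubicsOver L.mem_cubicsOver
  rwa [range_smul, show (fun i => T • L.p i) = stdPts l m from funext h.smul_p] at this

/-- The invariant `ξ` can be read off from any normal form. -/
lemma LabelledCubic.hasXi_iff {L : LabelledCubic} {g : ProjGroup} {T : MobiusGroup} {l m : ℂ}
    (h : L.IsNormal g T l m) {b c d α β : ℂ} (hs : IsSol l m b c d) (hα : α ≠ 0) (hβ : β ≠ 0)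
    (hX : transform g L.X = zeroLocus (pencil b c d α β)) {r : ℝ} :
    L.HasXi r ↔ r = ‖α / β‖ := by
  constructor
  · rintro ⟨g', F, hg', hF, hXF, rfl⟩
    obtain ⟨g'', T', l', m', hn, hx⟩ := hg'.exists_isNormal
      (noFourConcyclic_of_mem_cubicsOver L.mem_cubicsOver)
    obtain ⟨rfl, rfl⟩ := h.eq hn
    rw [← transform_congr hx] at hXF
    have hsub := hn.transform_mem_cubicsOver.2
    obtain ⟨α', β', rfl⟩ := hs.exists_eq_pencil h.pentad hF.1 fun i => hXF ▸ hsub ⟨i, rfl⟩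
    obtain ⟨hα', hβ'⟩ := ne_zero_of_isNonsingularForm hF
    obtain ⟨c1, c2⟩ := coeff_pencil b c d α' β'
    rw [c1, c2]
    refine (hs.norm_of_transform_fix h.pentad (hn.lifts.mul h.lifts.inv) (fun i => ?_) hα hβ hβ'
      ?_).symm
    · rw [mul_smul, ← h.smul_p, inv_smul_smul, hn.smul_p, h.smul_p]
    · rw [transform_mul, ← hX, transform_inv_transform, hXF]
  · rintro rfl
    refine ⟨g, _, h.adapted, hs.isNonsingularForm_pencil h.pentad hα hβ, hX, ?_⟩
    obtain ⟨c1, c2⟩ := coeff_pencil b c d α β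
    rw [c1, c2]

lemma LabelledPoints.IsNormal.exists_pencil {L : LabelledCubic} {g : ProjGroup} {T : MobiusGroup}
    {l m b c d : ℂ} (h : L.IsNormal g T l m) (hs : IsSol l m b c d) :
    ∃ α β, α ≠ 0 ∧ β ≠ 0 ∧ transform g L.X = zeroLocus (pencil b c d α β) :=
  (hs.mem_cubicsOver_iff h.pentad).1 h.transform_mem_cubicsOver

lemma LabelledCubic.exists_hasXi (L : LabelledCubic) : ∃ s > 0, ∀ r, L.HasXi r ↔ r = s := by
  obtain ⟨g, T, l, m, h⟩ := L.exists_isNormal (noFourConcyclic_of_mem_cubicsOver L.mem_cubicsOver)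
  obtain ⟨b, c, d, hs⟩ := h.pentad.exists_sol
  obtain ⟨α, β, hα, hβ, hX⟩ := h.exists_pencil hs
  exact ⟨‖α / β‖, norm_pos_iff.2 (div_ne_zero hα hβ), fun r => L.hasXi_iff h hs hα hβ hX⟩

/-- A conformal equivalence of the labelled configurations gives the two cubic surfaces normal forms
in the same pencil, where they differ by a diagonal transformation. -/
lemma LabelledCubic.conformallyEquivalent_iff (L L' : LabelledCubic) {r r' : ℝ}
    (hr : L.HasXi r) (hr' : L'.HasXi r') : L.ConformallyEquivalent L' ↔
      L.toLabelledPoints.ConformallyEquivalent L'.toLabelledPoints ∧ r = r' := by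
  obtain ⟨g, T, l, m, h⟩ := L'.exists_isNormal
    (noFourConcyclic_of_mem_cubicsOver L'.mem_cubicsOver)
  obtain ⟨b, c, d, hs⟩ := h.pentad.exists_sol
  obtain ⟨α', β', hα', hβ', hX'⟩ := h.exists_pencil hs
  rw [L'.hasXi_iff h hs hα' hβ' hX'] at hr'
  constructor
  · rintro ⟨k, hk, hc, hkX⟩
    refine ⟨⟨k, hk, hc⟩, ?_⟩
    obtain ⟨k', S, hS, hx⟩ := hk.exists_lifts
    rw [L.hasXi_iff (h.of_carries hS (hc.congr hx)) hs hα' hβ'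
      (by rw [transform_mul, transform_congr hx, hkX, hX'])] at hr
    rw [hr, hr']
  · rintro ⟨⟨k, hk, hc⟩, rfl⟩
    obtain ⟨k', S, hS, hx⟩ := hk.exists_lifts
    have hc' := hc.congr hx
    have hn := h.of_carries hS hc'
    obtain ⟨α, β, hα, hβ, hX⟩ := hn.exists_pencil hs
    rw [L.hasXi_iff hn hs hα hβ hX, hr'] at hr
    obtain ⟨p, q, hJ, hD⟩ := exists_diag_of_norm_eq (b := b) (c := c) (d := d) hα hβ hα' hβ'
      hr.symm
    rw [transform_mul] at hX
    refine ⟨g⁻¹ * (diag p q * (g * k')), h.lifts.inv.preservesJ.mul (hJ.mul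
      (h.lifts.preservesJ.mul hS.preservesJ)), ⟨fun i => ?_, ?_, ?_⟩, ?_⟩ <;>
      simp only [transform_mul]
    · rw [hc'.1, h.lifts.transform_twistorLine, h.smul_p, diag_twistorLine, ← h.smul_p,
        ← h.lifts.transform_twistorLine, transform_inv_transform]
    · rw [hc'.2.1, h.b5, diag_stdB5, ← h.b5, transform_inv_transform]
    · rw [hc'.2.2, h.b6, diag_stdB6, ← h.b6, transform_inv_transform]
    · rw [hX, hD, ← hX', transform_inv_transform]

lemma LabelledPoints.exists_labelledCubic (c : LabelledPoints)
    (hc : NoFourConcyclic (Set.range c.p)) {r : ℝ} (hr : 0 < r) :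
    ∃ L : LabelledCubic, L.toLabelledPoints = c ∧ L.HasXi r := by
  obtain ⟨g, T, l, m, h⟩ := c.exists_isNormal hc
  obtain ⟨b, c', d, hs⟩ := h.pentad.exists_sol
  have hr0 : (r : ℂ) ≠ 0 := Complex.ofReal_ne_zero.2 hr.ne'
  have hmem := (hs.mem_cubicsOver_iff h.pentad).2 ⟨r, 1, hr0, one_ne_zero, rfl⟩
  have hsub : ∀ i, twistorLine (c.p i) ⊆ transform g⁻¹ (zeroLocus (pencil b c' d r 1)) := by
    intro i
    rw [← transform_mono (g := g), transform_transform_inv, h.lifts.transform_twistorLine,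
      h.smul_p]
    exact hmem.2 ⟨i, rfl⟩
  refine ⟨⟨c, _, hmem.1.transform g⁻¹, hsub⟩, rfl, ?_⟩
  rw [LabelledCubic.hasXi_iff h hs hr0 one_ne_zero (transform_transform_inv g _)]
  simp [abs_of_pos hr]

/-! ### Cubic surfaces over a given set of five points -/

lemma exists_normalize_of_sphere_set {S P : Set HP1} (hS : IsRoundSphere 2 S) (hPS : P ⊆ S)
    (hP : P.ncard = 5) (h4 : NoFourConcyclic P) :
    ∃ (g : ProjGroup) (T : MobiusGroup) (l m : ℂ), Lifts g T ∧ IsPentad l m ∧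
      (fun q => T • q) '' P = Set.range (stdPts l m) ∧ (fun q => T • q) '' S = stdSphere := by
  obtain ⟨p, hp, rfl⟩ := exists_fin_five hP
  obtain ⟨T, l, m, hlm, hT, hTS⟩ := exists_normalize_of_sphere hS hp (fun i => hPS ⟨i, rfl⟩) h4
  obtain ⟨g, hg⟩ := exists_lift T
  refine ⟨g, T, l, m, hg, hlm, ?_, hTS⟩
  rw [range_smul, funext hT]

lemma exists_normalize_of_cubic_set {P : Set HP1} (hP : P.ncard = 5) {Y : Set CP3}
    (hY : Y ∈ cubicsOver P) :
    ∃ (g : ProjGroup) (T : MobiusGroup) (l m : ℂ), Lifts g T ∧ IsPentad l m ∧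
      (fun q => T • q) '' P = Set.range (stdPts l m) := by
  obtain ⟨p, hp, rfl⟩ := exists_fin_five hP
  obtain ⟨T, l, m, hlm, hT⟩ := exists_normalize_of_cubic hp hY
  obtain ⟨g, hg⟩ := exists_lift T
  refine ⟨g, T, l, m, hg, hlm, ?_⟩
  rw [range_smul, funext hT]

lemma exists_smul_eq_stdPts {P : Set HP1} {T : MobiusGroup} {l m : ℂ}
    (hT : (fun q => T • q) '' P = Set.range (stdPts l m)) {q : HP1} (hq : q ∈ P) :
    ∃ i, T • q = stdPts l m i := by
  have h : T • q ∈ Set.range (stdPts l m) := hT ▸ ⟨q, hq, rfl⟩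
  obtain ⟨i, hi⟩ := h
  exact ⟨i, hi.symm⟩

lemma exists_smul_stdPts_eq {P : Set HP1} {T : MobiusGroup} {l m : ℂ}
    (hT : (fun q => T • q) '' P = Set.range (stdPts l m)) (i : Fin 5) :
    ∃ q ∈ P, T⁻¹ • stdPts l m i = q ∧ T • q = stdPts l m i := by
  have h : stdPts l m i ∈ (fun q => T • q) '' P := hT ▸ ⟨i, rfl⟩
  obtain ⟨q, hq, hqi⟩ := h
  exact ⟨q, hq, by rw [← hqi]; exact inv_smul_smul T q, hqi⟩

/-- A diagonal transformation, expressed in the original coordinates, fixes the twistor lines. -/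
lemma transform_conj_diag_twistorLine {P : Set HP1} {g : ProjGroup} {T : MobiusGroup} {l m : ℂ}
    (hg : Lifts g T) (hT : (fun q => T • q) '' P = Set.range (stdPts l m)) (p r : ℂˣ) {q : HP1}
    (hq : q ∈ P) : transform (g⁻¹ * (diag p r * g)) (twistorLine q) = twistorLine q := by
  obtain ⟨i, hi⟩ := exists_smul_eq_stdPts hT hq
  rw [transform_mul, transform_mul, hg.transform_twistorLine, hi, diag_twistorLine, ← hi,
    ← hg.transform_twistorLine, transform_inv_transform]

lemma transform_conj_diag {g : ProjGroup} {p r : ℂˣ} {Y Z : Set CP3}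
    (h : transform (diag p r) (transform g Y) = transform g Z) :
    transform (g⁻¹ * (diag p r * g)) Y = Z := by
  rw [transform_mul, transform_mul, h, transform_inv_transform]

/-- All non-singular cubic surfaces over the same five points are projectively equivalent. -/
lemma exists_transform_of_mem_cubicsOver {P : Set HP1} (hP : P.ncard = 5) {Y Z : Set CP3}
    (hY : Y ∈ cubicsOver P) (hZ : Z ∈ cubicsOver P) : ∃ g : ProjGroup,
      (∀ q ∈ P, transform g (twistorLine q) = twistorLine q) ∧ transform g Y = Z := by
  obtain ⟨g, T, l, m, hg, hlm, hT⟩ := exists_normalize_of_cubic_set hP hY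
  obtain ⟨b, c, d, hs⟩ := hlm.exists_sol
  obtain ⟨α, β, hα, hβ, hYe⟩ := (hs.mem_cubicsOver_iff hlm).1 (hT ▸ hg.transform_mem_cubicsOver hY)
  obtain ⟨α', β', hα', hβ', hZe⟩ := (hs.mem_cubicsOver_iff hlm).1
    (hT ▸ hg.transform_mem_cubicsOver hZ)
  refine ⟨_, fun q hq => transform_conj_diag_twistorLine hg hT
    (Units.mk0 (α * β') (mul_ne_zero hα hβ')) (Units.mk0 (α' * β) (mul_ne_zero hα' hβ)) hq,
    transform_conj_diag ?_⟩
  rw [hYe, hZe]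
  refine transform_diag_pencil _ _ ?_ hα hα'
  simp only [Units.val_mk0]
  ring

lemma zeroLocus_pencil_one {b c d α β : ℂ} (hα : α ≠ 0) :
    zeroLocus (pencil b c d 1 (β / α)) = zeroLocus (pencil b c d α β) := by
  rw [← transform_one (zeroLocus (pencil b c d 1 (β / α)))]
  refine transform_zeroLocus (isHomogeneous_pencil _ _ _ _ _) (isHomogeneous_pencil _ _ _ _ _)
    fun z => ?_
  have e : eval z (pencil b c d α β) = α * eval z (pencil b c d 1 (β / α)) := by
    rw [eval_pencil, eval_pencil]
    field_simp
  rw [one_smul, e, mul_eq_zero, or_iff_right hα]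

lemma stdB5_subset (b c d α β : ℂ) : stdB5 ⊆ zeroLocus (pencil b c d α β) := by
  intro x hx
  obtain ⟨z, hz, rfl⟩ := CP3.exists_rep x
  obtain ⟨h0, h2⟩ := mk_mem_stdB5.1 hx
  rw [mk_mem_zeroLocus (isHomogeneous_pencil _ _ _ _ _), eval_pencil, eval_cubicForm,
    eval_conjForm, h0, h2]
  ring

lemma stdB6_subset (b c d α β : ℂ) : stdB6 ⊆ zeroLocus (pencil b c d α β) := by
  intro x hx
  obtain ⟨z, hz, rfl⟩ := CP3.exists_rep x
  obtain ⟨h1, h3⟩ := mk_mem_stdB6.1 hx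
  rw [mk_mem_zeroLocus (isHomogeneous_pencil _ _ _ _ _), eval_pencil, eval_cubicForm,
    eval_conjForm, h1, h3]
  ring

lemma PreservesJ.jMap_image {g : ProjGroup} (h : PreservesJ g) (b : Set CP3) :
    jMap '' transform g b = transform g (jMap '' b) := by
  simp only [transform, Set.image_image, h _]

lemma Lifts.twistorProj_image {g : ProjGroup} {T : MobiusGroup} (h : Lifts g T) (b : Set CP3) :
    TwistorCubic.twistorProj '' TwistorCubic.transform g b =
      (fun q => T • q) '' (TwistorCubic.twistorProj '' b) := by
  simp only [TwistorCubic.transform, Set.image_image, h.twistorProj]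

/-- The two transversals of five twistor lines over a round sphere. -/
lemma exists_transversals {S P : Set HP1} (hS : IsRoundSphere 2 S) (hPS : P ⊆ S)
    (hP : P.ncard = 5) (h4 : NoFourConcyclic P) :
    ∃ b5 b6 : Set CP3, b5 ≠ b6 ∧ jMap '' b5 = b6 ∧
      twistorProj '' b5 = S ∧ twistorProj '' b6 = S ∧
      {l | IsLine l ∧ ∀ q ∈ P, (l ∩ twistorLine q).Nonempty} = {b5, b6} ∧
      ∀ Y ∈ cubicsOver P, b5 ⊆ Y ∧ b6 ⊆ Y := by
  obtain ⟨g, T, l, m, hg, hlm, hT, hTS⟩ := exists_normalize_of_sphere_set hS hPS hP h4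
  obtain ⟨b, c, d, hs⟩ := hlm.exists_sol
  have hS' : (fun q => T⁻¹ • q) '' stdSphere = S := by rw [← hTS, image_inv_image]
  have hmeet : ∀ b : Set CP3, (∀ i, (b ∩ twistorLine (stdPts l m i)).Nonempty) →
      ∀ q ∈ P, (transform g⁻¹ b ∩ twistorLine q).Nonempty := by
    intro b hb q hq
    obtain ⟨i, hi⟩ := exists_smul_eq_stdPts hT hq
    have h1 := nonempty_transform_inter hg.inv (hb i)
    rwa [← hi, inv_smul_smul] at h1
  refine ⟨transform g⁻¹ stdB5, transform g⁻¹ stdB6, fun h => stdB5_ne_stdB6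
    (transform_injective _ h), ?_, ?_, ?_, ?_, fun Y hY => ?_⟩
  · rw [hg.inv.preservesJ.jMap_image, jMap_image_stdB5]
  · rw [hg.inv.twistorProj_image, twistorProj_image_stdB5, hS']
  · rw [hg.inv.twistorProj_image, twistorProj_image_stdB6, hS']
  · ext t
    constructor
    · rintro ⟨ht, hm⟩
      have hm' : ∀ i, (transform g t ∩ twistorLine (stdPts l m i)).Nonempty := fun i => by
        obtain ⟨q, hq, -, hqi⟩ := exists_smul_stdPts_eq hT i
        rw [← hqi]
        exact nonempty_transform_inter hg (hm q hq)
      rcases eq_of_isLine_of_meets (ht.transform g) hlm.conj_ne (hm' 0) (hm' 1) (hm' 4) (hm' 2)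
        with h | h
      · left
        rw [← h, transform_inv_transform]
      · right
        rw [Set.mem_singleton_iff, ← h, transform_inv_transform]
    · rintro (rfl | rfl)
      · exact ⟨isLine_stdB5.transform _, hmeet _ (stdB5_meets l m)⟩
      · exact ⟨isLine_stdB6.transform _, hmeet _ (stdB6_meets l m)⟩
  · obtain ⟨α, β, -, -, hYe⟩ := (hs.mem_cubicsOver_iff hlm).1
      (hT ▸ hg.transform_mem_cubicsOver hY)
    rw [← transform_mono (g := g), ← transform_mono (g := g) (X := transform g⁻¹ stdB6),
      transform_transform_inv, transform_transform_inv, hYe]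
    exact ⟨stdB5_subset _ _ _ _ _, stdB6_subset _ _ _ _ _⟩

/-- The twistor lines in a cubic surface over five points are those over these points. -/
lemma twistorPoints_eq_of_mem_cubicsOver {P : Set HP1} (hP : P.ncard = 5) {Y : Set CP3}
    (hY : Y ∈ cubicsOver P) : twistorPoints Y = P := by
  obtain ⟨g, T, l, m, hg, hlm, hT⟩ := exists_normalize_of_cubic_set hP hY
  obtain ⟨b, c, d, hs⟩ := hlm.exists_sol
  obtain ⟨α, β, hα, hβ, hYe⟩ := (hs.mem_cubicsOver_iff hlm).1 (hT ▸ hg.transform_mem_cubicsOver hY)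
  have h := hs.twistorPoints_eq hlm hα hβ
  rw [← hYe, hg.twistorPoints_transform, ← hT] at h
  exact (MulAction.injective T).image_injective h

/-- The Möbius transformation under an equivalence of two cubic surfaces over the same five points
permutes these points. -/
lemma image_eq_of_transform_eq {P : Set HP1} (hP : P.ncard = 5) {Y Z : Set CP3}
    (hY : Y ∈ cubicsOver P) (hZ : Z ∈ cubicsOver P) {k : ProjGroup} {R : MobiusGroup}
    (hk : Lifts k R) (h : transform k Y = Z) : (fun q => R • q) '' P = P := by
  have e := hk.twistorPoints_transform Y
  rw [h, twistorPoints_eq_of_mem_cubicsOver hP hY, twistorPoints_eq_of_mem_cubicsOver hP hZ] at e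
  exact e.symm

/-- The one-parameter family of cubic surfaces over five points. -/
lemma exists_family {S P : Set HP1} (hS : IsRoundSphere 2 S) (hPS : P ⊆ S)
    (hP : P.ncard = 5) (h4 : NoFourConcyclic P) :
    ∃ F₁ F₂ : MvPolynomial (Fin 4) ℂ, F₁.IsHomogeneous 3 ∧ F₂.IsHomogeneous 3 ∧
      Set.BijOn (fun t : ℂ => zeroLocus (F₁ + C t * F₂)) {t | t ≠ 0} (cubicsOver P) ∧
      (∀ s t : ℂ, s ≠ 0 → t ≠ 0 → ((∃ g : ProjGroup, PreservesJ g ∧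
        (∀ q ∈ P, transform g (twistorLine q) = twistorLine q) ∧
        transform g (zeroLocus (F₁ + C s * F₂)) = zeroLocus (F₁ + C t * F₂)) ↔ ‖s‖ = ‖t‖)) ∧
      (∀ s t : ℂ, s ≠ 0 → t ≠ 0 → ConformallyEquivalent (zeroLocus (F₁ + C s * F₂))
        (zeroLocus (F₁ + C t * F₂)) → ‖s‖ = ‖t‖ ∨ ‖s‖ * ‖t‖ = 1) := by
  obtain ⟨g, T, l, m, hg, hlm, hT, -⟩ := exists_normalize_of_sphere_set hS hPS hP h4
  obtain ⟨b, c, d, hs⟩ := hlm.exists_sol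
  have hX : ∀ t, transform g (zeroLocus (pullback g (cubicForm b c d) +
      C t * pullback g (conjForm b c d))) = zeroLocus (pencil b c d 1 t) := by
    intro t
    refine transform_zeroLocus ((isHomogeneous_pullback (isHomogeneous_cubicForm b c d) g).add
      ((isHomogeneous_pullback (isHomogeneous_conjForm b c d) g).C_mul t))
      (isHomogeneous_pencil _ _ _ _ _) fun z => ?_
    rw [eval_pencil, map_add, map_mul, MvPolynomial.eval_C, eval_pullback, eval_pullback, one_mul]
  have hmem : ∀ Y, Y ∈ cubicsOver P ↔ transform g Y ∈ cubicsOver (Set.range (stdPts l m)) :=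
    fun Y => by rw [← hT, hg.transform_mem_cubicsOver_iff]
  have hbij : Set.BijOn (fun t : ℂ => zeroLocus (pullback g (cubicForm b c d) +
      C t * pullback g (conjForm b c d))) {t | t ≠ 0} (cubicsOver P) := by
    refine ⟨fun t ht => ?_, fun s hs0 t ht h => ?_, fun Y hY => ?_⟩
    · rw [hmem, hX]
      exact (hs.mem_cubicsOver_iff hlm).2 ⟨1, t, one_ne_zero, ht, rfl⟩
    · have e := congrArg (transform g) h
      simp only [hX] at e
      simpa using (pencil_zeroLocus_injective one_ne_zero hs0 e).symm
    · obtain ⟨α, β, hα, hβ, hYe⟩ := (hs.mem_cubicsOver_iff hlm).1 ((hmem Y).1 hY)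
      refine ⟨β / α, div_ne_zero hβ hα, transform_injective g ?_⟩
      simp only [hX]
      rw [zeroLocus_pencil_one hα, hYe]
  -- an equivalence of two members, in the normalized coordinates
  have hconj : ∀ {s t : ℂ} {k : ProjGroup}, transform k (zeroLocus (pullback g (cubicForm b c d) +
      C s * pullback g (conjForm b c d))) = zeroLocus (pullback g (cubicForm b c d) +
      C t * pullback g (conjForm b c d)) →
      transform (g * k * g⁻¹) (zeroLocus (pencil b c d 1 s)) = zeroLocus (pencil b c d 1 t) := by
    intro s t k h
    rw [transform_mul, transform_mul, ← hX s, transform_inv_transform, h, hX]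
  refine ⟨_, _, isHomogeneous_pullback (isHomogeneous_cubicForm b c d) g,
    isHomogeneous_pullback (isHomogeneous_conjForm b c d) g, hbij, fun s t hs0 ht0 => ⟨?_, ?_⟩,
    fun s t hs0 ht0 => ?_⟩
  · rintro ⟨k, hk, hfix, h⟩
    obtain ⟨k', R, hR, hx⟩ := hk.exists_lifts
    rw [← transform_congr hx] at h
    have hn := hs.norm_of_transform_fix hlm ((hg.mul hR).mul hg.inv) (fun i => by
      obtain ⟨q, hq, hqi, hqi'⟩ := exists_smul_stdPts_eq hT i
      have hRq : R • q = q := twistorLine_injective (by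
        rw [← hR.transform_twistorLine, transform_congr hx, hfix q hq])
      rw [mul_smul, mul_smul, hqi, hRq, hqi']) one_ne_zero hs0 ht0 (hconj h)
    simpa using hn
  · intro hn
    obtain ⟨p, r, hJ, hD⟩ := exists_diag_of_norm_eq (b := b) (c := c) (d := d) one_ne_zero hs0
      one_ne_zero ht0 (by rw [norm_div, norm_div, hn])
    exact ⟨_, hg.inv.preservesJ.mul (hJ.mul hg.preservesJ),
      fun q hq => transform_conj_diag_twistorLine hg hT p r hq,
      transform_conj_diag (by rw [hX, hX, hD])⟩
  · rintro ⟨k, hk, h⟩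
    obtain ⟨k', R, hR, hx⟩ := hk.exists_lifts
    rw [← transform_congr hx] at h
    have hRP := image_eq_of_transform_eq hP (hbij.mapsTo hs0) (hbij.mapsTo ht0) hR h
    refine hs.norm_of_transform hlm ((hg.mul hR).mul hg.inv) (fun i => ?_) hs0 (hconj h)
    obtain ⟨q, hq, hqi, -⟩ := exists_smul_stdPts_eq hT i
    rw [mul_smul, mul_smul, hqi, ← hT]
    exact ⟨R • q, hRP ▸ ⟨q, hq, rfl⟩, rfl⟩

lemma cubicsOver_nonempty_iff {S P : Set HP1} (hS : IsRoundSphere 2 S) (hPS : P ⊆ S)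
    (hP : P.ncard = 5) : (cubicsOver P).Nonempty ↔ NoFourConcyclic P := by
  refine ⟨fun ⟨Y, hY⟩ => noFourConcyclic_of_mem_cubicsOver hY, fun h4 => ?_⟩
  obtain ⟨F₁, F₂, -, -, hbij, -⟩ := exists_family hS hPS hP h4
  exact ⟨_, hbij.mapsTo (one_ne_zero (α := ℂ))⟩

/-- A projective transformation that carries the twistor lines over `P` to twistor lines over `P'`
induces a Möbius transformation from `P` to `P'`. -/
lemma conformallyEquivalent_of_transform {P P' : Set HP1} (hP : P.ncard = 5) (hP' : P'.ncard = 5)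
    {Y : Set CP3} (hY : Y ∈ cubicsOver P) {k : ProjGroup}
    (hk : ∀ q ∈ P, ∃ q' ∈ P', transform k (twistorLine q) = twistorLine q') :
    PointsConformallyEquivalent P P' := by
  obtain ⟨g, T, l, m, hg, hlm, hT⟩ := exists_normalize_of_cubic_set hP hY
  have h : ∀ i, ∃ q' ∈ P', transform (k * g⁻¹) (twistorLine (stdPts l m i)) = twistorLine q' := by
    intro i
    obtain ⟨q, hq, hqi, -⟩ := exists_smul_stdPts_eq hT i
    rw [transform_mul, hg.inv.transform_twistorLine, hqi]
    exact hk q hq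
  choose q hq hkq using h
  obtain ⟨R, hR⟩ := exists_mobius_of_maps_twistorLines hkq
  refine ⟨R * T, ?_⟩
  have hfin : P'.Finite := Set.finite_of_ncard_ne_zero (by rw [hP']; norm_num)
  refine Set.eq_of_subset_of_ncard_le ?_ ?_ hfin
  · rintro _ ⟨x, hx, rfl⟩
    obtain ⟨i, hi⟩ := exists_smul_eq_stdPts hT hx
    change (R * T) • x ∈ P'
    rw [mul_smul, hi, hR]
    exact hq i
  · rw [Set.ncard_image_of_injective _ (MulAction.injective _), hP, hP']

lemma exists_transform_of_conformallyEquivalent {P P' : Set HP1} (hP' : P'.ncard = 5)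
    {Y Y' : Set CP3} (hY : Y ∈ cubicsOver P) (hY' : Y' ∈ cubicsOver P')
    (h : PointsConformallyEquivalent P P') : ∃ k : ProjGroup, transform k Y = Y' ∧
      ∀ q ∈ P, ∃ q' ∈ P', transform k (twistorLine q) = twistorLine q' := by
  obtain ⟨T, rfl⟩ := h
  obtain ⟨g, hg⟩ := exists_lift T
  obtain ⟨k, hk, hkY⟩ := exists_transform_of_mem_cubicsOver hP' (hg.transform_mem_cubicsOver hY) hY'
  refine ⟨k * g, by rw [transform_mul, hkY], fun q hq => ⟨T • q, ⟨q, hq, rfl⟩, ?_⟩⟩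
  rw [transform_mul, hg.transform_twistorLine]
  exact hk _ ⟨q, hq, rfl⟩

lemma exists_isRoundSphere_of_mem_cubicsOver {P : Set HP1} (hP : P.ncard = 5) {Y : Set CP3}
    (hY : Y ∈ cubicsOver P) : ∃ S, IsRoundSphere 2 S ∧ P ⊆ S := by
  obtain ⟨g, T, l, m, hg, hlm, hT⟩ := exists_normalize_of_cubic_set hP hY
  refine ⟨_, isRoundSphere_stdSphere.image T⁻¹, fun q hq => ⟨T • q, ?_, inv_smul_smul T q⟩⟩
  obtain ⟨i, hi⟩ := exists_smul_eq_stdPts hT hq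
  rw [hi]
  exact stdPts_mem_stdSphere l m i

end TwistorCubic

open TwistorCubic in
theorem mainTheorem1 :
    -- five points on a round 2-sphere: a non-singular cubic over them exists iff no four of the
    -- points are concyclic
    (∀ (S P : Set HP1), IsRoundSphere 2 S → P ⊆ S → P.ncard = 5 →
      ((cubicsOver P).Nonempty ↔ NoFourConcyclic P)) ∧
    -- in that case the non-singular cubics over the points form a one-parameter family
    (∀ (S P : Set HP1), IsRoundSphere 2 S → P ⊆ S → P.ncard = 5 → NoFourConcyclic P →
      -- every member has exactly five twistor lines, those over the given points
      (∀ X ∈ cubicsOver P, twistorPoints X = P) ∧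
      -- the five twistor lines have exactly two transversals: the two lines over the sphere
      (∃ b5 b6 : Set CP3, b5 ≠ b6 ∧ jMap '' b5 = b6 ∧
        twistorProj '' b5 = S ∧ twistorProj '' b6 = S ∧
        {l | IsLine l ∧ ∀ q ∈ P, (l ∩ twistorLine q).Nonempty} = {b5, b6} ∧
        ∀ X ∈ cubicsOver P, b5 ⊆ X ∧ b6 ⊆ X) ∧
      ∃ F₁ F₂ : MvPolynomial (Fin 4) ℂ, F₁.IsHomogeneous 3 ∧ F₂.IsHomogeneous 3 ∧
        Set.BijOn (fun t : ℂ => zeroLocus (F₁ + MvPolynomial.C t * F₂)) {t | t ≠ 0}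
          (cubicsOver P) ∧
        -- all members are projectively equivalent, by transformations fixing the five lines
        (∀ s t : ℂ, s ≠ 0 → t ≠ 0 → ∃ g : ProjGroup,
          (∀ q ∈ P, transform g (twistorLine q) = twistorLine q) ∧
          transform g (zeroLocus (F₁ + MvPolynomial.C s * F₂)) =
            zeroLocus (F₁ + MvPolynomial.C t * F₂)) ∧
        -- they are conformally equivalent, with the five lines fixed, only for equal `|t|`
        (∀ s t : ℂ, s ≠ 0 → t ≠ 0 →
          ((∃ g : ProjGroup, PreservesJ g ∧
            (∀ q ∈ P, transform g (twistorLine q) = twistorLine q) ∧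
            transform g (zeroLocus (F₁ + MvPolynomial.C s * F₂)) =
              zeroLocus (F₁ + MvPolynomial.C t * F₂)) ↔ ‖s‖ = ‖t‖)) ∧
        -- the same without the labels, when the five points have no conformal symmetry
        ((∀ T : MobiusGroup, (fun q => T • q) '' P = P → ∀ q ∈ P, T • q = q) →
          ∀ s t : ℂ, s ≠ 0 → t ≠ 0 →
            (ConformallyEquivalent (zeroLocus (F₁ + MvPolynomial.C s * F₂))
              (zeroLocus (F₁ + MvPolynomial.C t * F₂)) ↔ ‖s‖ = ‖t‖)) ∧
        -- in general a conformal class meets the family in at most two values of `|t|`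
        (∃ c : ℝ, 0 < c ∧ ∀ s t : ℂ, s ≠ 0 → t ≠ 0 →
          ConformallyEquivalent (zeroLocus (F₁ + MvPolynomial.C s * F₂))
            (zeroLocus (F₁ + MvPolynomial.C t * F₂)) →
          ‖s‖ = ‖t‖ ∨ ‖s‖ * ‖t‖ = c)) ∧
    -- the real invariant `ξ` of labelled cubic surfaces with five twistor lines
    (∃ ξ : LabelledCubic → ℝ,
      (∀ L, 0 < ξ L) ∧
      (∀ L r, L.HasXi r ↔ r = ξ L) ∧
      (∀ L L' : LabelledCubic, L.ConformallyEquivalent L' ↔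
        L.toLabelledPoints.ConformallyEquivalent L'.toLabelledPoints ∧ ξ L = ξ L') ∧
      (∀ c : LabelledPoints, NoFourConcyclic (Set.range c.p) → ∀ r : ℝ, 0 < r →
        ∃ L : LabelledCubic, L.toLabelledPoints = c ∧ ξ L = r)) ∧
    -- two such cubics are projectively equivalent, as cubics with five twistor lines, iff the sets
    -- of five points are conformally equivalent
    (∀ (P P' : Set HP1) (X X' : Set CP3), P.ncard = 5 → P'.ncard = 5 →
      X ∈ cubicsOver P → X' ∈ cubicsOver P' →
      ((∃ g : ProjGroup, transform g X = X' ∧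
          ∀ q ∈ P, ∃ q' ∈ P', transform g (twistorLine q) = twistorLine q') ↔
        PointsConformallyEquivalent P P')) ∧
    -- every non-singular cubic with five twistor lines arises in this way
    (∀ (P : Set HP1) (X : Set CP3), P.ncard = 5 → X ∈ cubicsOver P →
      (∃ S, IsRoundSphere 2 S ∧ P ⊆ S) ∧ NoFourConcyclic P) := by
  refine ⟨fun S P hS hPS hP => cubicsOver_nonempty_iff hS hPS hP, fun S P hS hPS hP h4 =>
    ⟨fun X hX => twistorPoints_eq_of_mem_cubicsOver hP hX, exists_transversals hS hPS hP h4, ?_⟩,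
    ?_, fun P P' X X' hP hP' hX hX' => ⟨fun ⟨g, _, hg⟩ =>
      conformallyEquivalent_of_transform hP hP' hX hg,
      exists_transform_of_conformallyEquivalent hP' hX hX'⟩,
    fun P X hP hX => ⟨exists_isRoundSphere_of_mem_cubicsOver hP hX,
      noFourConcyclic_of_mem_cubicsOver hX⟩⟩
  · obtain ⟨F₁, F₂, h₁, h₂, hbij, hfix, hgen⟩ := exists_family hS hPS hP h4
    refine ⟨F₁, F₂, h₁, h₂, hbij, fun s t hs ht =>
      exists_transform_of_mem_cubicsOver hP (hbij.mapsTo hs) (hbij.mapsTo ht), hfix,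
      fun hsym s t hs ht => ?_, 1, one_pos, hgen⟩
    rw [← hfix s t hs ht]
    refine ⟨fun ⟨k, hk, h⟩ => ?_, fun ⟨k, hk, _, h⟩ => ⟨k, hk, h⟩⟩
    -- the Möbius transformation under `k` permutes the five points, hence fixes them
    obtain ⟨k', R, hR, hx⟩ := hk.exists_lifts
    rw [← transform_congr hx] at h
    have hRP := image_eq_of_transform_eq hP (hbij.mapsTo hs) (hbij.mapsTo ht) hR h
    exact ⟨k', hR.preservesJ, fun q hq => by rw [hR.transform_twistorLine, hsym R hRP q hq], h⟩
  · choose ξ hpos hξ using LabelledCubic.exists_hasXi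
    refine ⟨ξ, hpos, hξ, fun L L' => L.conformallyEquivalent_iff L' ((hξ L _).2 rfl)
      ((hξ L' _).2 rfl), fun c hc r hr => ?_⟩
    obtain ⟨L, hL, hLr⟩ := c.exists_labelledCubic hc hr
    exact ⟨L, hL, ((hξ L r).1 hLr).symm⟩
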